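/- Let $q$ be a complex number with $0<|q|<1$. Write $(x;q)_n=\prod_{k=0}^{n-1}(1-xq^k)$, $(x;q)_\infty=\prod_{k\ge 0}(1-xq^k)$, $j(x;q)=(x;q)_\infty(q/x;q)_\infty(q;q)_\infty$, $J_{a,m}=j(q^a;q^m)$, $\overline J_{a,m}=j(-q^a;q^m)$, $J_m=(q^m;q^m)_\infty$, $\binom r2=r(r-1)/2$ for $r\in\mathbb Z$, and $\mathrm{sg}(r)=1$ if $r\ge 0$, $\mathrm{sg}(r)=-1$ if $r<0$. Let $$m(x,q,z)=\frac1{j(z;q)}\sum_{r\in\mathbb Z}\frac{(-1)^rq^{\binom r2}z^r}{1-q^{r-1}xz},$$ $$f_{a,b,c}(x,y,q)=\sum_{\mathrm{sg}(r)=\mathrm{sg}(s)}\mathrm{sg}(r)(-1)^{r+s}x^ry^sq^{a\binom r2+brs+c\binom s2},\qquad \overline f_{a,b,c}(x,y,q)=\sum_{\mathrm{sg}(r)=\mathrm{sg}(s)}(-1)^{r+s}x^ry^sq^{a\binom r2+brs+c\binom s2},$$ and, for coprime positive integers $n,p$, $$\Phi_{n,p}(x,y,q)=\frac{J_{p^2(2n+p)}^3}{\overline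 J_{0,np(2n+p)}}\sum_{r^*=0}^{p-1}\sum_{s^*=0}^{p-1}\frac{q^{n\binom{\rho}2+(n+p)\rho\sigma+n\binom{\sigma}2}(-x)^{\rho}(-y)^{\sigma}\,j(-q^{np(s-r)}x^n/y^n;q^{np^2})\,j(q^{p(2n+p)(r+s)+p(n+p)}x^py^p;q^{p^2(2n+p)})}{j(q^{p(2n+p)r+p(n+p)/2}(-y)^{n+p}/(-x)^n;q^{p^2(2n+p)})\,j(q^{p(2n+p)s+p(n+p)/2}(-x)^{n+p}/(-y)^n;q^{p^2(2n+p)})},$$ where $r=r^*+\{\tfrac{n-1}2\}$, $s=s^*+\{\tfrac{n-1}2\}$ ($\{\cdot\}$ is the fractional part), $\rho=r-\tfrac{n-1}2$, $\sigma=s+\tfrac{n+1}2$. Let $$A^{(2)}(q)=\sum_{n\ge0}\frac{q^{n+1}(-q^2;q^2)_n}{(q;q^2)_{n+1}},\qquad \psi^{(3)}(q)=\sum_{n\ge1}\frac{q^{n^2}}{(q;q^2)_n},\qquad \sigma^{(6)}(q)=\sum_{n\ge0}\frac{q^{\binom{n+2}2}(-q;q)_n}{(q;q^2)_{n+1}}.$$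 Then all the series below converge absolutely (for the sums over $n\ge0$ of a finite sum over $j$: absolutely as series in $n$) and the following identities hold. (1) $$A^{(2)}(q)=q\frac{(-q^2;q^2)_\infty}{(q;q)_\infty^2}\sum_{n=0}^\infty\frac{1-q^{2n+2}}{1+q^{2n+2}}(-1)^nq^{n^2+2n}\sum_{j=0}^nq^{-j(j+1)/2}.$$ (2) \begin{align*}\frac{\psi^{(3)}(q)}q&=\sum_{n=0}^\infty\frac{q^{n^2+2n}}{(q;q^2)_{n+1}} =\frac1{(q;q)_\infty}\sum_{n=0}^\infty(-1)^n(1-q^{2n+2})q^{2n^2+3n}\sum_{j=0}^nq^{-j(j+1)/2}\\ &=\frac1{2J_1}\left(f_{3,5,3}(q^4,q^5,q)-q^5f_{3,5,3}(q^8,q^9,q)+j(q^4;q^3)\right)=\frac1{J_1}f_{3,5,3}(q^4,q^5,q)\\ &=-q^{-1}m(-q^{22},q^{48},-1)-q^{-2}m(-q^{14},q^{48},-1)-q^{-3}m(-q^{10},q^{48},-1)-q^{-6}m(-q^2,q^{48},-1)+\frac1{J_1}\Phi_{3,2}(q^4,q^5,q)\\ &=-q^{-1}m(q,-q^3,q)+\frac{J_{12}^3}{J_{3,12}J_{4,12}}.\end{align*}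 (3) \begin{align*}\sum_{n=0}^\infty\frac{(-1)^nq^{n(n+3)/2}(q;q)_n}{(q;q^2)_{n+1}}&=\sum_{n=0}^\infty(1+q^{n+1})q^{(3n^2+5n)/2}\sum_{j=0}^nq^{-j(j+1)/2}\\ &=\frac12\left(\overline f_{1,2,1}(-q^3,-q^4,q^2)+q^4\overline f_{1,2,1}(-q^6,-q^7,q^2)-q^{-1}\right).\end{align*} (4) \begin{align*}\frac{\sigma^{(6)}(q)}q&=\sum_{n=0}^\infty\frac{q^{(n^2+3n)/2}(-q;q)_n}{(q;q^2)_{n+1}} =\frac{(-q;q)_\infty}{(q;q)_\infty}\sum_{n=0}^\infty(-1)^n(1-q^{n+1})q^{(3n^2+5n)/2}\sum_{j=0}^nq^{-j(j+1)/2}\\ &=\frac{J_2}{2J_1^2}\left(f_{1,2,1}(q^3,q^4,q^2)-q^4f_{1,2,1}(q^6,q^7,q^2)+j(q^3;q^2)\right)=\frac{J_2}{J_1^2}f_{1,2,1}(q^3,q^4,q^2)\\ &=-q^{-1}m(q^2,q^6,-1)+\frac12q^{-1}\frac{J_2^4J_6^5}{J_1^2J_3^2J_4^2J_{12}^2}=-q^{-1}m(q^2,q^6,q).\end{align*}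 -/

import Mathlib

open Finset

noncomputable section

namespace MockTheta

/-- The finite `q`-shifted factorial `(x;q)_n = ∏_{k=0}^{n-1} (1 - x q^k)`. -/
def qPoch (x q : ℂ) (n : ℕ) : ℂ := ∏ k ∈ range n, (1 - x * q ^ k)

/-- The infinite `q`-shifted factorial `(x;q)_∞ = ∏_{k ≥ 0} (1 - x q^k)`, for `|q| < 1`. -/
def qPochInf (x q : ℂ) : ℂ := ∏' k : ℕ, (1 - x * q ^ k)

/-- The product defining `(x;q)_∞` converges for `|q| < 1`. -/
theorem multipliable_qPochInf (x : ℂ) {q : ℂ} (hq : ‖q‖ < 1) :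
    Multipliable (fun k : ℕ => 1 - x * q ^ k) := by
  have h : Summable (fun k : ℕ => ‖-(x * q ^ k)‖) := by
    have h1 : Summable (fun k : ℕ => ‖x‖ * ‖q‖ ^ k) :=
      (summable_geometric_of_lt_one (norm_nonneg q) hq).mul_left _
    simpa using h1
  simpa [sub_eq_add_neg] using multipliable_one_add_of_summable h

/-- The theta function `j(x;q) = (x;q)_∞ (q/x;q)_∞ (q;q)_∞`, for `x ≠ 0`. -/
def jTheta (x q : ℂ) : ℂ := qPochInf x q * qPochInf (q / x) q * qPochInf q q

/-- `J_{a,m} = j(q^a; q^m)`. -/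
def JJ (a m : ℤ) (q : ℂ) : ℂ := jTheta (q ^ a) (q ^ m)

/-- `\overline J_{a,m} = j(-q^a; q^m)`. -/
def JJbar (a m : ℤ) (q : ℂ) : ℂ := jTheta (-q ^ a) (q ^ m)

/-- `J_m = (q^m; q^m)_∞`. -/
def J (m : ℕ) (q : ℂ) : ℂ := qPochInf (q ^ m) (q ^ m)

/-- The binomial coefficient `r (r - 1) / 2` of an arbitrary integer `r`. -/
def choose2 (r : ℤ) : ℤ := r * (r - 1) / 2

/-- `sg(r) = 1` for `r ≥ 0` and `sg(r) = -1` for `r < 0`. -/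
def sg (r : ℤ) : ℤ := if 0 ≤ r then 1 else -1

/-- The general term of the Appell–Lerch sum in `m(x,q,z)`. -/
def appellTerm (x q z : ℂ) (r : ℤ) : ℂ :=
  (-1) ^ r * q ^ choose2 r * z ^ r / (1 - q ^ (r - 1) * x * z)

/-- The Appell–Lerch function `m(x,q,z)`. -/
def appellM (x q z : ℂ) : ℂ := (1 / jTheta z q) * ∑' r : ℤ, appellTerm x q z r

/-- The pairs of integers `(r, s)` with `sg(r) = sg(s)`. -/
abbrev SameSg : Type := {p : ℤ × ℤ // sg p.1 = sg p.2}

/-- The general term of `\overline f_{a,b,c}(x,y,q)`. -/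
def heckeBarTerm (a b c : ℤ) (x y q : ℂ) (p : SameSg) : ℂ :=
  (-1) ^ (p.1.1 + p.1.2) * x ^ p.1.1 * y ^ p.1.2 *
    q ^ (a * choose2 p.1.1 + b * p.1.1 * p.1.2 + c * choose2 p.1.2)

/-- The general term of `f_{a,b,c}(x,y,q)`. -/
def heckeTerm (a b c : ℤ) (x y q : ℂ) (p : SameSg) : ℂ :=
  (sg p.1.1 : ℂ) * heckeBarTerm a b c x y q p

/-- `f_{a,b,c}(x,y,q)`. -/
def heckeF (a b c : ℤ) (x y q : ℂ) : ℂ := ∑' p : SameSg, heckeTerm a b c x y q p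

/-- `\overline f_{a,b,c}(x,y,q)`. -/
def heckeFbar (a b c : ℤ) (x y q : ℂ) : ℂ := ∑' p : SameSg, heckeBarTerm a b c x y q p

/-- The theta quotient `Φ_{n,p}(x,y,q)` for coprime positive integers `n`, `p`.  Writing
`e = (n - 1) mod 2`, the half-integers `r = r* + {(n-1)/2}` and `s = s* + {(n-1)/2}` are
`r = r* + e/2` and `s = s* + e/2`, and
`ρ = r - (n-1)/2`, `σ = s + (n+1)/2` are integers, as are all exponents of `q`;
every integer division below is exact when `n` and `p` are coprime. -/
def PhiNP (n p : ℕ) (x y q : ℂ) : ℂ :=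
  (J (p ^ 2 * (2 * n + p)) q) ^ 3 / JJbar 0 (n * p * (2 * n + p)) q *
    ∑ r ∈ range p, ∑ s ∈ range p,
      let e : ℤ := ((n : ℤ) - 1) % 2
      let ρ : ℤ := (2 * r + e - (n - 1)) / 2
      let σ : ℤ := (2 * s + e + (n + 1)) / 2
      let Q : ℂ := q ^ (p ^ 2 * (2 * n + p))
      q ^ ((n : ℤ) * choose2 ρ + (n + p) * ρ * σ + n * choose2 σ) * (-x) ^ ρ * (-y) ^ σ *
        jTheta (-(q ^ ((n : ℤ) * p * (s - r))) * x ^ n / y ^ n) (q ^ (n * p ^ 2)) *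
        jTheta (q ^ ((p : ℤ) * (2 * n + p) * (r + s + e) + p * (n + p)) * x ^ p * y ^ p) Q /
        (jTheta (q ^ (((p : ℤ) * (2 * n + p) * (2 * r + e) + p * (n + p)) / 2) *
            (-y) ^ (n + p) / (-x) ^ n) Q *
          jTheta (q ^ (((p : ℤ) * (2 * n + p) * (2 * s + e) + p * (n + p)) / 2) *
            (-x) ^ (n + p) / (-y) ^ n) Q)

/-- The general term of the second order mock theta function `A^{(2)}(q)`. -/
def A2Term (q : ℂ) (n : ℕ) : ℂ :=
  q ^ (n + 1) * qPoch (-q ^ 2) (q ^ 2) n / qPoch q (q ^ 2) (n + 1)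

/-- The second order mock theta function `A^{(2)}(q)`. -/
def A2 (q : ℂ) : ℂ := ∑' n : ℕ, A2Term q n

/-- The third order mock theta function `ψ^{(3)}(q) = ∑_{n ≥ 1} q^{n^2} / (q;q^2)_n`. -/
def psi3 (q : ℂ) : ℂ := ∑' n : ℕ, q ^ ((n + 1) ^ 2) / qPoch q (q ^ 2) (n + 1)

/-- The sixth order mock theta function `σ^{(6)}(q)`. -/
def sigma6 (q : ℂ) : ℂ :=
  ∑' n : ℕ, q ^ ((n + 2).choose 2) * qPoch (-q) q n / qPoch q (q ^ 2) (n + 1)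

/-- The finite sum `∑_{j=0}^{n} q^{-j(j+1)/2}`. -/
def innerSum (q : ℂ) (n : ℕ) : ℂ := ∑ j ∈ range (n + 1), (q ^ (j * (j + 1) / 2))⁻¹

/-- The terms of `∑_{n ≥ 0} q^{n^2+2n} / (q;q^2)_{n+1}`. -/
def psiTerm (q : ℂ) (n : ℕ) : ℂ := q ^ (n ^ 2 + 2 * n) / qPoch q (q ^ 2) (n + 1)

/-- The terms of `∑_{n ≥ 0} (-1)^n q^{n(n+3)/2} (q;q)_n / (q;q^2)_{n+1}`. -/
def falseTerm (q : ℂ) (n : ℕ) : ℂ :=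
  (-1) ^ n * q ^ (n * (n + 3) / 2) * qPoch q q n / qPoch q (q ^ 2) (n + 1)

/-- The terms of `∑_{n ≥ 0} q^{(n^2+3n)/2} (-q;q)_n / (q;q^2)_{n+1}`. -/
def sigmaTerm (q : ℂ) (n : ℕ) : ℂ :=
  q ^ ((n ^ 2 + 3 * n) / 2) * qPoch (-q) q n / qPoch q (q ^ 2) (n + 1)

/-- The terms of the single-variable outer sum in the new representation of `A^{(2)}(q)`. -/
def A2OuterTerm (q : ℂ) (n : ℕ) : ℂ :=
  (1 - q ^ (2 * n + 2)) / (1 + q ^ (2 * n + 2)) * (-1) ^ n * q ^ (n ^ 2 + 2 * n) * innerSum q n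

/-- The outer terms of the Hecke-type double sum for `ψ^{(3)}(q) / q`. -/
def psiOuterTerm (q : ℂ) (n : ℕ) : ℂ :=
  (-1) ^ n * (1 - q ^ (2 * n + 2)) * q ^ (2 * n ^ 2 + 3 * n) * innerSum q n

/-- The outer terms of the double sum in the false-theta-type identity. -/
def falseOuterTerm (q : ℂ) (n : ℕ) : ℂ :=
  (1 + q ^ (n + 1)) * q ^ ((3 * n ^ 2 + 5 * n) / 2) * innerSum q n

/-- The outer terms of the Hecke-type double sum for `σ^{(6)}(q) / q`. -/
def sigmaOuterTerm (q : ℂ) (n : ℕ) : ℂ :=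
  (-1) ^ n * (1 - q ^ (n + 1)) * q ^ ((3 * n ^ 2 + 5 * n) / 2) * innerSum q n

end MockTheta

end

open MockTheta

/-!
The four families of identities rest on two mechanisms.

*From `q`-series to Hecke-type sums.* The `q`-Gauss sum (`hasSum_gaussTerm`) follows from a
contiguous relation whose difference telescopes, and it gives Bailey's lemma (`bailey_lemma`). The
Bailey pair relative to `q²` with `β_n = 1/(q;q²)_{n+1}`, whose `α_n` contains
`∑_{j ≤ n} q^{-j(j+1)/2}` (`bailey_pair_innerSum`), is verified by a recurrence in `n`.
Specializing the two free parameters of Bailey's lemma then yields the single sums on the right of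
each family (`A2_bailey`, `psi_bailey`, `false_bailey`, `sigma_bailey`). The numbers `r - s` on an
antidiagonal `r + s = n` produce the inner sum, so the last three are the double sums `f_{3,5,3}`,
`f_{1,2,1}` and its unsigned variant (`tsum_sameSg`); a shift of `n` by one relates each to the
double sum with shifted arguments, the defect being a theta function or the term `-q⁻¹`
(`hecke_shift_signed`, `heckeFbar_121`).

*Appell-Lerch series by weighted triple sums.* Give a pair of integers the weight
`(sg r + sg s) / 2` (`coneWt`). Kronecker's identity, the Appell-Lerch series and the double sums
`f_{a,b,c}` are then sums over `ℤ²` with this weight (`hasSum_cone_kronecker`,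
`hasSum_cone_appell`, `hasSum_heckeF`), and after multiplication by a theta function they become
sums over `ℤ³` of signed powers of `q`. A linear substitution changes the weight only. As weights
are additive in their arguments' signs and `sg (-r - 1) = -sg r`, an identity such as
`sg A + sg B + (sg r - sg B) + (sg s - sg A) = sg r + sg s` splits one triple sum into others. This
gives the dependence of `m(x,q,z)` on `z` (`appell_change_z`), the evaluation of `f_{1,2,1}`, where
two of three pieces contain a vanishing theta function (`heckeF_121_mul_jTheta`), and that of
`f_{3,5,3}` (`heckeF_353_eq_appellM`), where one piece is `Φ_{3,2}` and the other two, split modulo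
`3`, are the four Appell-Lerch series.

The expression of `ψ` through `m(q,-q³,q)` starts instead from pairing consecutive terms of the
series, which turns it into the universal mock theta function
`∑ q^{n(n+1)} / ((x)_{n+1} (q/x)_{n+1})` with base `q⁴` at `x = q`. A second Bailey pair expands
that as a Lambert series (`hasSum_universal`), and `1/(1-X) = (1+X+X²)/(1-X³)`, a bisection and
changes of `z` lead to the result (`psi_appell`).
-/

namespace MockTheta

open Filter Topology

/-! ### Shifted factorials -/

@[simp] theorem qPoch_zero (x q : ℂ) : qPoch x q 0 = 1 := by simp [qPoch]

theorem qPoch_succ (x q : ℂ) (n : ℕ) : qPoch x q (n + 1) = qPoch x q n * (1 - x * q ^ n) := by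
  simp [qPoch, prod_range_succ]

theorem qPoch_add (x q : ℂ) (m n : ℕ) :
    qPoch x q (m + n) = qPoch x q m * qPoch (x * q ^ m) q n := by
  simp only [qPoch, prod_range_add]
  congr 1
  exact prod_congr rfl fun k _ => by rw [pow_add]; ring

theorem qPoch_succ' (x q : ℂ) (n : ℕ) : qPoch x q (n + 1) = (1 - x) * qPoch (x * q) q n := by
  rw [add_comm, qPoch_add]; simp [qPoch]

theorem qPochInf_eq_qPoch_mul (x : ℂ) {q : ℂ} (hq : ‖q‖ < 1) (n : ℕ) :
    qPochInf x q = qPoch x q n * qPochInf (x * q ^ n) q := by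
  have e : (fun k : ℕ => 1 - x * q ^ (k + n)) = fun k => 1 - x * q ^ n * q ^ k := by
    funext k; rw [pow_add]; ring
  have h : Multipliable fun k : ℕ => 1 - x * q ^ (k + n) := by
    rw [e]; exact multipliable_qPochInf (x * q ^ n) hq
  have h2 := h.prod_mul_tprod_nat_mul' (f := fun k : ℕ => 1 - x * q ^ k)
  rw [e] at h2
  exact h2.symm

theorem qPochInf_eq_mul (x : ℂ) {q : ℂ} (hq : ‖q‖ < 1) :
    qPochInf x q = (1 - x) * qPochInf (x * q) q := by
  simpa [qPoch] using qPochInf_eq_qPoch_mul x hq 1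

theorem tendsto_qPoch (x : ℂ) {q : ℂ} (hq : ‖q‖ < 1) :
    Tendsto (qPoch x q) atTop (𝓝 (qPochInf x q)) :=
  (multipliable_qPochInf x hq).tendsto_prod_tprod_nat

theorem qPoch_ne_zero {x q : ℂ} (h : ∀ k : ℕ, 1 - x * q ^ k ≠ 0) (n : ℕ) : qPoch x q n ≠ 0 :=
  prod_ne_zero_iff.2 fun k _ => h k

theorem qPochInf_ne_zero {x q : ℂ} (hq : ‖q‖ < 1) (h : ∀ k : ℕ, 1 - x * q ^ k ≠ 0) :
    qPochInf x q ≠ 0 := by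
  have h1 : Summable (fun k : ℕ => ‖-(x * q ^ k)‖) := by
    have h1 : Summable (fun k : ℕ => ‖x‖ * ‖q‖ ^ k) :=
      (summable_geometric_of_lt_one (norm_nonneg q) hq).mul_left _
    simpa using h1
  have := tprod_one_add_ne_zero_of_summable (f := fun k : ℕ => -(x * q ^ k))
    (by simpa [← sub_eq_add_neg] using h) h1
  simpa [qPochInf, ← sub_eq_add_neg] using this

theorem exists_norm_qPoch_le (x : ℂ) {q : ℂ} (hq : ‖q‖ < 1) :
    ∃ M : ℝ, 0 < M ∧ ∀ n, ‖qPoch x q n‖ ≤ M := by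
  obtain ⟨M, hM⟩ := (Metric.isBounded_range_of_tendsto _ (tendsto_qPoch x hq)).exists_norm_le
  exact ⟨max M 1, by positivity, fun n => (hM _ ⟨n, rfl⟩).trans (le_max_left _ _)⟩

theorem exists_norm_inv_qPoch_le {x q : ℂ} (hq : ‖q‖ < 1) (h : ∀ k : ℕ, 1 - x * q ^ k ≠ 0) :
    ∃ M : ℝ, 0 < M ∧ ∀ n, ‖(qPoch x q n)⁻¹‖ ≤ M := by
  obtain ⟨M, hM⟩ := (Metric.isBounded_range_of_tendsto _
    ((tendsto_qPoch x hq).inv₀ (qPochInf_ne_zero hq h))).exists_norm_le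
  exact ⟨max M 1, by positivity, fun n => (hM _ ⟨n, rfl⟩).trans (le_max_left _ _)⟩

theorem one_sub_ne_zero_of_norm_lt {z : ℂ} (h : ‖z‖ < 1) : 1 - z ≠ 0 := by
  intro h0
  rw [sub_eq_zero] at h0
  simp [← h0] at h

theorem one_sub_q_pow_ne_zero {q : ℂ} (hq : ‖q‖ < 1) (k : ℕ) : 1 - q * q ^ k ≠ 0 := by
  apply one_sub_ne_zero_of_norm_lt
  rw [← pow_succ', norm_pow]
  exact pow_lt_one₀ (norm_nonneg _) hq (by omega)

theorem qPochInf_self_ne_zero {q : ℂ} (hq : ‖q‖ < 1) : qPochInf q q ≠ 0 :=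
  qPochInf_ne_zero hq (one_sub_q_pow_ne_zero hq)

/-! ### Theta functions and the Jacobi triple product -/

theorem two_mul_choose2 (r : ℤ) : 2 * choose2 r = r * (r - 1) := by
  unfold choose2
  exact Int.mul_ediv_cancel' (Int.even_mul_pred_self r).two_dvd

theorem choose2_add (r s : ℤ) : choose2 (r + s) = choose2 r + choose2 s + r * s := by
  have h1 := two_mul_choose2 (r + s)
  have h2 := two_mul_choose2 r
  have h3 := two_mul_choose2 s
  linarith

theorem choose2_add_one (r : ℤ) : choose2 (r + 1) = choose2 r + r := by
  rw [choose2_add]; simp [choose2]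

theorem choose2_one_sub (r : ℤ) : choose2 (1 - r) = choose2 r := by
  have h1 := two_mul_choose2 (1 - r)
  have h2 := two_mul_choose2 r
  linarith

/-- The ratio test in division-free form; the terms may vanish. -/
theorem summable_of_ratio_tendsto_zero {f g : ℕ → ℂ} (h : ∀ n, f (n + 1) = f n * g n)
    (hg : Tendsto g atTop (𝓝 0)) : Summable fun n => ‖f n‖ := by
  refine summable_of_ratio_norm_eventually_le (r := 1 / 2) (by norm_num) ?_
  have h0 : ∀ᶠ n in atTop, ‖g n‖ < 1 / 2 := by
    have := (tendsto_zero_iff_norm_tendsto_zero.1 hg)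
    exact this.eventually (gt_mem_nhds (by norm_num))
  filter_upwards [h0] with n hn
  rw [norm_norm, norm_norm, h, norm_mul, mul_comm]
  exact mul_le_mul_of_nonneg_right hn.le (norm_nonneg _)

theorem tendsto_pow_mul_zero {q : ℂ} (hq : ‖q‖ < 1) (x : ℂ) :
    Tendsto (fun n : ℕ => q ^ n * x) atTop (𝓝 0) := by
  simpa using (tendsto_pow_atTop_nhds_zero_of_norm_lt_one hq).mul_const x

/-- The terms of a theta series are absolutely summable over `ℤ`. -/
theorem summable_norm_theta {q : ℂ} (hq0 : q ≠ 0) (hq : ‖q‖ < 1) {x : ℂ} (hx : x ≠ 0) :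
    Summable fun r : ℤ => ‖q ^ choose2 r * x ^ r‖ := by
  refine Summable.of_nat_of_neg_add_one ?_ ?_
  · refine summable_of_ratio_tendsto_zero (f := fun n : ℕ => q ^ choose2 n * x ^ (n : ℤ))
      (g := fun n => q ^ n * x) (fun n => ?_) (tendsto_pow_mul_zero hq x)
    push_cast
    rw [choose2_add_one, zpow_add₀ hq0, zpow_add₀ hx]
    simp; ring
  · refine summable_of_ratio_tendsto_zero
      (f := fun n : ℕ => q ^ choose2 (-((n : ℤ) + 1)) * x ^ (-((n : ℤ) + 1)))
      (g := fun n => q ^ n * (q ^ 2 * x⁻¹)) (fun n => ?_) (tendsto_pow_mul_zero hq _)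
    have h : choose2 (-((n : ℤ) + 1 + 1)) = choose2 (-((n : ℤ) + 1)) + n + 2 := by
      have h1 := two_mul_choose2 (-((n : ℤ) + 1 + 1))
      have h2 := two_mul_choose2 (-((n : ℤ) + 1))
      linarith
    push_cast
    rw [h, show -((n : ℤ) + 1 + 1) = -((n : ℤ) + 1) + (-1) by ring, zpow_add₀ hx, zpow_add₀ hq0,
      zpow_add₀ hq0, zpow_natCast, zpow_neg_one]
    norm_cast
    ring

/-- Euler's expansion of `(y;q)_∞`. -/
theorem hasSum_euler {q : ℂ} (hq0 : q ≠ 0) (hq : ‖q‖ < 1) (y : ℂ) :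
    HasSum (fun n : ℕ => (-1) ^ n * q ^ choose2 n * y ^ n / qPoch q q n) (qPochInf y q) := by
  set c : ℕ → ℂ := fun n => (-1) ^ n * q ^ choose2 n / qPoch q q n with hc
  have hcs : ∀ n, c (n + 1) * (1 - q ^ (n + 1)) = -(q ^ n) * c n := by
    intro n
    have h1 := qPoch_ne_zero (one_sub_q_pow_ne_zero hq) n
    have h2 := one_sub_q_pow_ne_zero hq n
    rw [← pow_succ'] at h2
    simp only [hc]
    rw [qPoch_succ, ← pow_succ']
    push_cast
    rw [choose2_add_one, zpow_add₀ hq0, zpow_natCast]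
    field_simp; ring
  have hsum : ∀ y : ℂ, Summable fun n => ‖c n * y ^ n‖ := by
    intro y
    refine summable_of_ratio_tendsto_zero (g := fun n => q ^ n * (-y) / (1 - q * q ^ n))
      (fun n => ?_) ?_
    · have h2 := one_sub_q_pow_ne_zero hq n
      rw [eq_comm, mul_div_assoc', div_eq_iff h2, ← pow_succ', pow_succ, pow_succ]
      have := hcs n
      rw [pow_succ] at this
      linear_combination (-y ^ n * y) * this
    · have h1 := (tendsto_pow_mul_zero hq (-y))
      have h2 : Tendsto (fun n : ℕ => 1 - q * q ^ n) atTop (𝓝 (1 - q * 0)) :=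
        ((tendsto_pow_atTop_nhds_zero_of_norm_lt_one hq).const_mul q).const_sub 1
      have h3 := h1.div h2 (by simp)
      rwa [zero_div] at h3
  set F : ℂ → ℂ := fun y => ∑' n, c n * y ^ n with hF
  -- The series satisfies the functional equation `F(y) = (1 - y) F(qy)` of the product; iterating
  -- it and letting `y q^N → 0` identifies the two.
  have hFE : ∀ y, F y = (1 - y) * F (q * y) := by
    intro y
    have s1 := (hsum y).of_norm
    have s2 := (hsum (q * y)).of_norm
    have e : F y - F (q * y) = -y * F (q * y) := by
      rw [hF]
      simp only
      rw [← s1.tsum_sub s2, ← tsum_mul_left, (s1.sub s2).tsum_eq_zero_add]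
      simp only [pow_zero, mul_one, sub_self, zero_add]
      refine tsum_congr fun n => ?_
      have := hcs n
      rw [mul_pow, mul_pow, pow_succ y]
      linear_combination (y ^ n * y) * this
    linear_combination e
  have hit : ∀ N : ℕ, F y = qPoch y q N * F (y * q ^ N) := by
    intro N
    induction N with
    | zero => simp
    | succ N ih => rw [ih, hFE, qPoch_succ, pow_succ]; ring_nf
  have hlim : Tendsto (fun N : ℕ => F (y * q ^ N)) atTop (𝓝 (∑' n, c n * 0 ^ n)) := by
    refine tendsto_tsum_of_dominated_convergence (hsum y) (fun n => ?_) (Eventually.of_forall ?_)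
    · have h1 : Tendsto (fun N : ℕ => y * q ^ N) atTop (𝓝 0) := by
        simpa using (tendsto_pow_atTop_nhds_zero_of_norm_lt_one hq).const_mul y
      exact (h1.pow n).const_mul _
    · intro N n
      rw [norm_mul, norm_mul, norm_pow, norm_pow, norm_mul, norm_pow]
      gcongr
      exact mul_le_of_le_one_right (norm_nonneg _) (pow_le_one₀ (norm_nonneg _) hq.le)
  have h0 : ∑' n, c n * (0 : ℂ) ^ n = 1 := by
    rw [tsum_eq_single 0 (fun n hn => by simp [hn])]
    simp [hc, choose2]
  have := (tendsto_qPoch y hq).mul hlim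
  rw [h0, mul_one] at this
  have h3 : F y = qPochInf y q :=
    tendsto_nhds_unique (tendsto_const_nhds) (this.congr fun N => (hit N).symm)
  have h4 := (hsum y).of_norm.hasSum
  rw [show (∑' n, c n * y ^ n) = F y from rfl, h3] at h4
  have e : (fun n : ℕ => (-1) ^ n * q ^ choose2 n * y ^ n / qPoch q q n) =
      fun n => c n * y ^ n := by
    funext n; simp only [hc]; ring
  rw [e]
  exact h4

/-- A one-sided series whose start recedes to `-∞` tends to the two-sided series. -/
theorem tendsto_tsum_shift {f : ℤ → ℂ} (hf : Summable fun r => ‖f r‖) {d : ℕ → ℂ} {D : ℂ}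
    (hd : Tendsto d atTop (𝓝 D)) :
    Tendsto (fun N : ℕ => ∑' n : ℕ, f (n - N) * d n) atTop (𝓝 ((∑' r, f r) * D)) := by
  obtain ⟨M, hM⟩ := (Metric.isBounded_range_of_tendsto _ hd).exists_norm_le
  have hM' : ∀ n, ‖d n‖ ≤ M := fun n => hM _ ⟨n, rfl⟩
  set g : ℕ → ℤ → ℂ := fun N r => if 0 ≤ r + N then f r * d (r + N).toNat else 0 with hg
  have e : ∀ N : ℕ, ∑' n : ℕ, f (n - N) * d n = ∑' r, g N r := by
    intro N
    have hinj : Function.Injective fun n : ℕ => (n : ℤ) - N := by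
      intro a b h
      simp only at h
      omega
    rw [← hinj.tsum_eq (f := g N)]
    · refine tsum_congr fun n => ?_
      simp [hg]
    · intro r hr
      by_cases h : 0 ≤ r + N
      · exact ⟨(r + N).toNat, by simp only; omega⟩
      · simp [hg, h] at hr
  simp only [e]
  rw [← tsum_mul_right]
  refine tendsto_tsum_of_dominated_convergence (bound := fun r => ‖f r‖ * M) (hf.mul_right M)
    (fun r => ?_) (Eventually.of_forall fun N r => ?_)
  · have h1 : Tendsto (fun N : ℕ => (r + N).toNat) atTop atTop := by
      refine tendsto_atTop_mono (f := fun N : ℕ => N - r.natAbs) (fun N => by omega) ?_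
      exact tendsto_sub_atTop_nat _
    refine ((hd.comp h1).const_mul (f r)).congr' ?_
    filter_upwards [eventually_ge_atTop r.natAbs] with N hN
    have : 0 ≤ r + N := by omega
    simp [hg, this]
  · by_cases h : 0 ≤ r + N
    · simp only [hg, h, if_true, norm_mul]
      exact mul_le_mul_of_nonneg_left (hM' _) (norm_nonneg _)
    · simp only [hg, h, if_false, norm_zero]
      exact mul_nonneg (norm_nonneg _) ((norm_nonneg _).trans (hM' 0))

/-- Reversal of the shifted factorial: `(x/q^N;q)_N` in terms of `(q/x;q)_N`. -/
theorem qPoch_div_pow {q : ℂ} (hq0 : q ≠ 0) {x : ℂ} (hx : x ≠ 0) (N : ℕ) :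
    qPoch (x / q ^ N) q N = (-1) ^ N * x ^ N / q ^ choose2 (N + 1) * qPoch (q / x) q N := by
  induction N with
  | zero => simp [choose2]
  | succ N ih =>
    have h : x / q ^ (N + 1) * q = x / q ^ N := by field_simp; ring
    rw [qPoch_succ', h, ih, qPoch_succ]
    push_cast
    rw [choose2_add_one ((N : ℤ) + 1), zpow_add₀ hq0,
      zpow_add_one₀ hq0, zpow_natCast]
    field_simp
    ring

/-- The Jacobi triple product identity. -/
theorem hasSum_jTheta {q : ℂ} (hq0 : q ≠ 0) (hq : ‖q‖ < 1) {x : ℂ} (hx : x ≠ 0) :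
    HasSum (fun r : ℤ => (-1) ^ r * q ^ choose2 r * x ^ r) (jTheta x q) := by
  have hs : Summable fun r : ℤ => ‖(-1) ^ r * q ^ choose2 r * x ^ r‖ := by
    simpa [mul_assoc] using summable_norm_theta hq0 hq hx
  have hq' := qPochInf_self_ne_zero hq
  have h1 := tendsto_tsum_shift hs ((tendsto_qPoch q hq).inv₀ hq')
  -- Euler's expansion at `x/q^N`, with the summation index moved by `N`. The factor `1/(q;q)_n`
  -- then sits at `n = r + N` and tends to `1/(q;q)_∞` for fixed `r`.
  have h2 : ∀ N : ℕ, ∑' n : ℕ, (-1) ^ ((n : ℤ) - N) * q ^ choose2 ((n : ℤ) - N) * x ^ ((n : ℤ) - N)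
      * (qPoch q q n)⁻¹ = qPochInf x q * qPoch (q / x) q N := by
    intro N
    have h3 := (hasSum_euler hq0 hq (x / q ^ N)).tsum_eq
    rw [qPochInf_eq_qPoch_mul _ hq N, qPoch_div_pow hq0 hx, div_mul_cancel₀ _ (pow_ne_zero _ hq0)]
      at h3
    set K : ℂ := (-1) ^ N * x ^ N / q ^ choose2 (N + 1) with hK
    have hK0 : K ≠ 0 := by
      refine div_ne_zero (mul_ne_zero (by simp) (pow_ne_zero _ hx)) (zpow_ne_zero _ hq0)
    refine mul_left_cancel₀ hK0 ?_
    rw [← tsum_mul_left, show K * (qPochInf x q * qPoch (q / x) q N) =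
      K * qPoch (q / x) q N * qPochInf x q by ring, ← h3]
    refine tsum_congr fun n => ?_
    have e1 : ((-1 : ℂ)) ^ ((n : ℤ) - N) = (-1) ^ n * (-1) ^ N := by
      rw [zpow_sub₀ (by norm_num), zpow_natCast, zpow_natCast, div_eq_iff (by simp), mul_assoc,
        ← mul_pow]
      simp
    have e2 : choose2 (n : ℤ) = choose2 ((n : ℤ) - N) - choose2 ((N : ℤ) + 1) + N * n := by
      have a1 := two_mul_choose2 (n : ℤ)
      have a2 := two_mul_choose2 ((n : ℤ) - N)
      have a3 := two_mul_choose2 ((N : ℤ) + 1)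
      linarith
    rw [e1, e2, zpow_add₀ hq0, zpow_sub₀ hq0, zpow_sub₀ hx, hK]
    have e3 : q ^ ((N : ℤ) * n) = (q ^ N) ^ n := by rw [zpow_mul]; norm_cast
    have e4 : ((-1 : ℂ) ^ N) * (-1) ^ N = 1 := by rw [← mul_pow]; simp
    rw [e3, div_pow]
    have := zpow_ne_zero (choose2 ((N : ℤ) + 1)) hq0
    have := pow_ne_zero n (pow_ne_zero N hq0)
    have := qPoch_ne_zero (one_sub_q_pow_ne_zero hq) n
    simp only [zpow_natCast]
    field_simp
    linear_combination e4
  simp only [h2] at h1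
  have h4 := (tendsto_qPoch (q / x) hq).const_mul (qPochInf x q)
  have h5 := tendsto_nhds_unique h1 h4
  have h6 := hs.of_norm.hasSum
  rwa [mul_inv_eq_iff_eq_mul₀ hq'|>.mp h5] at h6

/-- Quasi-periodicity: `j(qx;q) = -x⁻¹ j(x;q)`. -/
theorem jTheta_mul_left {q : ℂ} (hq0 : q ≠ 0) (hq : ‖q‖ < 1) {x : ℂ} (hx : x ≠ 0) :
    jTheta (q * x) q = -x⁻¹ * jTheta x q := by
  unfold jTheta
  have h1 := qPochInf_eq_mul x hq
  have h2 := qPochInf_eq_mul (q / (q * x)) hq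
  have e : q / (q * x) * q = q / x := by field_simp
  rw [e] at h2
  have e2 : q / (q * x) = x⁻¹ := by field_simp
  rw [h1, h2, e2, mul_comm x q]
  field_simp
  ring

/-- Quasi-periodicity under an arbitrary integral power of `q`. -/
theorem jTheta_zpow_mul {q : ℂ} (hq0 : q ≠ 0) (hq : ‖q‖ < 1) {x : ℂ} (hx : x ≠ 0) (k : ℤ) :
    jTheta (q ^ k * x) q = (-1) ^ k * (q ^ choose2 k)⁻¹ * (x ^ k)⁻¹ * jTheta x q := by
  have step : ∀ k : ℤ, jTheta (q ^ (k + 1) * x) q = -(q ^ k * x)⁻¹ * jTheta (q ^ k * x) q := by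
    intro k
    rw [← jTheta_mul_left hq0 hq (mul_ne_zero (zpow_ne_zero _ hq0) hx), zpow_add₀ hq0, zpow_one]
    ring_nf
  have hn : ((-1 : ℂ)) ≠ 0 := by norm_num
  have eqv : ∀ k : ℤ, (-1 : ℂ) ^ (k + 1) * (q ^ choose2 (k + 1))⁻¹ * (x ^ (k + 1))⁻¹ =
      -(q ^ k * x)⁻¹ * ((-1) ^ k * (q ^ choose2 k)⁻¹ * (x ^ k)⁻¹) := by
    intro k
    rw [choose2_add_one, zpow_add₀ hq0, zpow_add₀ hx, zpow_add₀ hn]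
    have := zpow_ne_zero k hq0
    field_simp
  induction k using Int.induction_on with
  | zero => simp [choose2]
  | succ k ih => rw [step, ih, eqv]; ring
  | pred k ih =>
    have h1 := step (-(k : ℤ) - 1)
    have h2 := eqv (-(k : ℤ) - 1)
    rw [sub_add_cancel] at h1 h2
    rw [h1, h2, mul_assoc] at ih
    exact mul_left_cancel₀
      (neg_ne_zero.2 (inv_ne_zero (mul_ne_zero (zpow_ne_zero _ hq0) hx))) (by rw [ih])

theorem jTheta_div {q x : ℂ} (hq0 : q ≠ 0) : jTheta (q / x) q = jTheta x q := by
  unfold jTheta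
  rw [div_div_cancel₀ hq0]
  ring

theorem jTheta_inv {q : ℂ} (hq0 : q ≠ 0) (hq : ‖q‖ < 1) {x : ℂ} (hx : x ≠ 0) :
    jTheta x⁻¹ q = -x⁻¹ * jTheta x q := by
  rw [← jTheta_mul_left hq0 hq hx, ← jTheta_div hq0, div_inv_eq_mul]

theorem jTheta_one (q : ℂ) (hq : ‖q‖ < 1) : jTheta 1 q = 0 := by
  rw [jTheta, qPochInf_eq_mul 1 hq]; simp

theorem jTheta_zpow {q : ℂ} (hq0 : q ≠ 0) (hq : ‖q‖ < 1) (k : ℤ) : jTheta (q ^ k) q = 0 := by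
  have := jTheta_zpow_mul hq0 hq one_ne_zero k
  rwa [mul_one, jTheta_one q hq, mul_zero] at this

/-- `j(x;q)` vanishes only at the integral powers of `q`. -/
theorem jTheta_ne_zero {q : ℂ} (hq0 : q ≠ 0) (hq : ‖q‖ < 1) {x : ℂ} (hx : x ≠ 0)
    (h : ∀ k : ℤ, x ≠ q ^ k) : jTheta x q ≠ 0 := by
  refine mul_ne_zero (mul_ne_zero (qPochInf_ne_zero hq fun k h0 => ?_)
    (qPochInf_ne_zero hq fun k h0 => ?_)) (qPochInf_self_ne_zero hq)
  · refine h (-k) ?_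
    rw [zpow_neg, zpow_natCast]
    exact eq_inv_of_mul_eq_one_left (sub_eq_zero.1 h0).symm
  · refine h (k + 1) ?_
    rw [sub_eq_zero, div_mul_eq_mul_div, eq_div_iff hx, one_mul] at h0
    rw [zpow_add₀ hq0, zpow_natCast, zpow_one, h0, mul_comm]

/-! ### The `q`-Gauss sum and Kronecker's identity -/

/-- The product `∏_{k=0}^{n-1} (t - q^k)`, that is `t^n (1/t;q)_n` extended to `t = 0`.  It lets
the parameters `ρ = 1/t` of a basic hypergeometric series become infinite. -/
def revPoch (t q : ℂ) (n : ℕ) : ℂ := ∏ k ∈ range n, (t - q ^ k)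

@[simp] theorem revPoch_zero (t q : ℂ) : revPoch t q 0 = 1 := by simp [revPoch]

theorem revPoch_succ (t q : ℂ) (n : ℕ) : revPoch t q (n + 1) = revPoch t q n * (t - q ^ n) := by
  simp [revPoch, prod_range_succ]

theorem revPoch_add {q : ℂ} (hq0 : q ≠ 0) (t : ℂ) (r m : ℕ) :
    revPoch t q (r + m) = revPoch t q r * ((q ^ r) ^ m * revPoch (t / q ^ r) q m) := by
  simp only [revPoch, prod_range_add]
  congr 1
  rw [← card_range m, ← prod_const, card_range, ← prod_mul_distrib]
  refine prod_congr rfl fun k _ => ?_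
  rw [mul_sub, mul_div_cancel₀ _ (pow_ne_zero _ hq0), pow_add]

theorem revPoch_mul_pow {t c x q : ℂ} (h : c * t = x) (n : ℕ) :
    revPoch t q n * c ^ n = ∏ k ∈ range n, (x - c * q ^ k) := by
  rw [revPoch, ← card_range n, ← prod_const, card_range, ← prod_mul_distrib]
  refine prod_congr rfl fun k _ => ?_
  rw [← h]; ring

theorem summable_norm_revPoch {s t c q : ℂ} (hq : ‖q‖ < 1) (h : ‖c * s * t‖ < 1) :
    Summable fun n => ‖revPoch s q n * revPoch t q n * c ^ n‖ := by
  obtain ⟨r, hr1, hr2⟩ := exists_between h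
  refine summable_of_ratio_norm_eventually_le hr2 ?_
  have h0 := tendsto_pow_atTop_nhds_zero_of_norm_lt_one hq
  have h1 : Tendsto (fun n => ‖(s - q ^ n) * (t - q ^ n) * c‖) atTop
      (𝓝 ‖(s - 0) * (t - 0) * c‖) :=
    (((h0.const_sub s).mul (h0.const_sub t)).mul_const c).norm
  rw [sub_zero, sub_zero, show s * t * c = c * s * t by ring] at h1
  filter_upwards [h1.eventually (gt_mem_nhds hr1)] with n hn
  rw [norm_norm, norm_norm, revPoch_succ, revPoch_succ, pow_succ,
    show revPoch s q n * (s - q ^ n) * (revPoch t q n * (t - q ^ n)) * (c ^ n * c) =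
      (s - q ^ n) * (t - q ^ n) * c * (revPoch s q n * revPoch t q n * c ^ n) by ring, norm_mul]
  exact mul_le_mul_of_nonneg_right hn.le (norm_nonneg _)

/-- The general term of the `q`-Gauss series with parameters `1/s`, `1/t` and denominator `c`. -/
noncomputable def gaussTerm (s t q c : ℂ) (n : ℕ) : ℂ :=
  revPoch s q n * revPoch t q n * c ^ n / (qPoch q q n * qPoch c q n)

theorem summable_norm_gaussTerm {s t c q : ℂ} (hq : ‖q‖ < 1) (h : ‖c * s * t‖ < 1)
    (hc : ∀ k : ℕ, 1 - c * q ^ k ≠ 0) : Summable fun n => ‖gaussTerm s t q c n‖ := by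
  obtain ⟨M, hM0, hM⟩ := exists_norm_inv_qPoch_le hq (one_sub_q_pow_ne_zero hq)
  obtain ⟨M', hM0', hM'⟩ := exists_norm_inv_qPoch_le hq hc
  refine Summable.of_nonneg_of_le (fun _ => norm_nonneg _) (fun n => ?_)
    ((summable_norm_revPoch hq h).mul_right (M * M'))
  rw [gaussTerm, div_eq_mul_inv, mul_inv, norm_mul]
  refine mul_le_mul_of_nonneg_left ?_ (norm_nonneg _)
  rw [norm_mul]
  exact mul_le_mul (hM n) (hM' n) (norm_nonneg _) hM0.le

/-- The contiguous relation `c → cq` for the `q`-Gauss series. It is the whole content of the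
`q`-Gauss sum: the difference of the two sides telescopes term by term. -/
theorem gaussTerm_contiguous {s t c q : ℂ} (hq : ‖q‖ < 1) (h : ‖c * s * t‖ < 1)
    (hc : ∀ k : ℕ, 1 - c * q ^ k ≠ 0) :
    (1 - c) * (1 - c * s * t) * ∑' n, gaussTerm s t q c n =
      (1 - c * s) * (1 - c * t) * ∑' n, gaussTerm s t q (c * q) n := by
  have hc' : ∀ k : ℕ, 1 - c * q * q ^ k ≠ 0 := fun k => by
    have := hc (k + 1)
    rwa [pow_succ', ← mul_assoc] at this
  have h' : ‖c * q * s * t‖ < 1 := by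
    rw [show c * q * s * t = q * (c * s * t) by ring, norm_mul]
    exact mul_lt_one_of_nonneg_of_lt_one_left (norm_nonneg _) hq h.le
  have su := (summable_norm_gaussTerm hq h hc).of_norm
  have sv := (summable_norm_gaussTerm hq h' hc').of_norm
  -- `G n - G (n + 1)` is the difference of the two summands, and `G 0 = 0`.
  set G : ℕ → ℂ := fun n => (1 - c) * (gaussTerm s t q c n * (1 - q ^ n)) with hG
  have sG : Summable G := by
    refine Summable.mul_left _ ?_
    refine Summable.of_norm_bounded (g := fun n => ‖gaussTerm s t q c n‖ * 2)
      ((summable_norm_gaussTerm hq h hc).mul_right 2) fun n => ?_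
    rw [norm_mul]
    refine mul_le_mul_of_nonneg_left ((norm_sub_le _ _).trans ?_) (norm_nonneg _)
    rw [norm_one, norm_pow]
    linarith [pow_le_one₀ (n := n) (norm_nonneg q) hq.le]
  have e : ∑' n, ((1 - c) * (1 - c * s * t) * gaussTerm s t q c n -
      (1 - c * s) * (1 - c * t) * gaussTerm s t q (c * q) n) = ∑' n, (G n - G (n + 1)) := by
    refine tsum_congr fun n => ?_
    have a1 := qPoch_ne_zero (one_sub_q_pow_ne_zero hq) n
    have a2 := qPoch_ne_zero hc n
    have a3 := one_sub_q_pow_ne_zero hq n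
    have a4 := hc n
    have a5 : 1 - c ≠ 0 := by simpa using hc 0
    have a6 := qPoch_ne_zero hc' n
    have a7 : qPoch (c * q) q n = qPoch c q n * (1 - c * q ^ n) / (1 - c) := by
      rw [eq_div_iff a5, ← qPoch_succ, qPoch_succ', mul_comm]
    simp only [hG, gaussTerm]
    rw [a7, revPoch_succ, revPoch_succ, qPoch_succ, qPoch_succ, pow_succ' q, pow_succ c, mul_pow]
    generalize q ^ n = y at *
    have a8 : 1 - y * q ≠ 0 := by rwa [mul_comm]
    field_simp
    ring
  rw [(su.mul_left _).tsum_sub (sv.mul_left _), tsum_mul_left, tsum_mul_left,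
    sG.tsum_sub ((summable_nat_add_iff 1).2 sG), sG.tsum_eq_zero_add] at e
  have hG0 : G 0 = 0 := by simp [hG]
  rw [hG0, zero_add, sub_self] at e
  exact sub_eq_zero.1 e

theorem continuous_qPoch (q : ℂ) (n : ℕ) : Continuous fun x => qPoch x q n := by
  unfold qPoch; fun_prop

/-- The `q`-Gauss sum. -/
theorem hasSum_gaussTerm {s t c q : ℂ} (hq : ‖q‖ < 1) (h : ‖c * s * t‖ < 1)
    (hc : ∀ k : ℕ, 1 - c * q ^ k ≠ 0) :
    HasSum (gaussTerm s t q c) (qPochInf (c * s) q * qPochInf (c * t) q /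
      (qPochInf c q * qPochInf (c * s * t) q)) := by
  have hqN : ∀ N : ℕ, ‖q ^ N‖ ≤ 1 := fun N => by
    rw [norm_pow]; exact pow_le_one₀ (norm_nonneg _) hq.le
  have hcN : ∀ N k : ℕ, 1 - c * q ^ N * q ^ k ≠ 0 := fun N k => by
    rw [mul_assoc, ← pow_add]; exact hc _
  have hN : ∀ N : ℕ, ‖c * q ^ N * s * t‖ < 1 := fun N => by
    rw [show c * q ^ N * s * t = q ^ N * (c * s * t) by ring, norm_mul]
    exact mul_lt_one_of_nonneg_of_lt_one_right (hqN N) (norm_nonneg _) h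
  -- The contiguous relation moves `c` to `c q^N`; as `N → ∞` the series tends to the one with
  -- `c = 0`, of which only the term `n = 0` survives.
  set F : ℕ → ℂ := fun N => ∑' n, gaussTerm s t q (c * q ^ N) n with hF
  have hit : ∀ N, qPoch c q N * qPoch (c * s * t) q N * F 0 =
      qPoch (c * s) q N * qPoch (c * t) q N * F N := by
    intro N
    induction N with
    | zero => simp
    | succ N ih =>
      have hstep := gaussTerm_contiguous hq (hN N) (hcN N)
      rw [show c * q ^ N * q = c * q ^ (N + 1) by ring] at hstep
      simp only [qPoch_succ]
      simp only [hF] at ih ⊢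
      linear_combination (1 - c * q ^ N) * (1 - c * s * t * q ^ N) * ih +
        qPoch (c * s) q N * qPoch (c * t) q N * hstep
  have hlim : Tendsto F atTop (𝓝 (∑' n, gaussTerm s t q 0 n)) := by
    obtain ⟨M, hM0, hM⟩ := exists_norm_inv_qPoch_le hq (one_sub_q_pow_ne_zero hq)
    obtain ⟨M', hM0', hM'⟩ := exists_norm_inv_qPoch_le hq hc
    obtain ⟨K, hK0, hK⟩ := exists_norm_qPoch_le c hq
    have hc0 : Tendsto (fun N : ℕ => c * q ^ N) atTop (𝓝 0) := by
      simpa using (tendsto_pow_atTop_nhds_zero_of_norm_lt_one hq).const_mul c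
    refine tendsto_tsum_of_dominated_convergence
      (bound := fun n => ‖revPoch s q n * revPoch t q n * c ^ n‖ * (M * (K * M')))
      ((summable_norm_revPoch hq h).mul_right _) (fun n => ?_) (Eventually.of_forall fun N n => ?_)
    · have h1 := ((continuous_qPoch q n).tendsto 0).comp hc0
      have h2 := ((continuous_pow n).tendsto (0 : ℂ)).comp hc0
      refine (h2.const_mul (revPoch s q n * revPoch t q n)).div (h1.const_mul (qPoch q q n)) ?_
      refine mul_ne_zero (qPoch_ne_zero (one_sub_q_pow_ne_zero hq) n) ?_
      simp [qPoch]
    · have e1 : (qPoch (c * q ^ N) q n)⁻¹ = qPoch c q N * (qPoch c q (N + n))⁻¹ := by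
        rw [qPoch_add, mul_inv, ← mul_assoc, mul_inv_cancel₀ (qPoch_ne_zero hc N), one_mul]
      rw [gaussTerm, div_eq_mul_inv, mul_inv, e1]
      generalize revPoch s q n * revPoch t q n = A
      have e2 : ‖(c * q ^ N) ^ n‖ ≤ ‖c ^ n‖ := by
        rw [norm_pow, norm_pow, norm_mul]
        exact pow_le_pow_left₀ (by positivity) (mul_le_of_le_one_right (norm_nonneg _) (hqN N)) _
      simp only [norm_mul]
      have e3 := hM n
      have e4 := hM' (N + n)
      have e5 := hK N
      gcongr
  have h0 : ∑' n, gaussTerm s t q 0 n = 1 := by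
    rw [tsum_eq_single 0 (fun n hn => by simp [gaussTerm, hn])]
    simp [gaussTerm]
  rw [h0] at hlim
  have t1 := ((tendsto_qPoch c hq).mul (tendsto_qPoch (c * s * t) hq)).mul_const (F 0)
  have t2 := ((tendsto_qPoch (c * s) hq).mul (tendsto_qPoch (c * t) hq)).mul hlim
  have e := tendsto_nhds_unique t1 (t2.congr fun N => (hit N).symm)
  have n1 := qPochInf_ne_zero hq hc
  have n2 : qPochInf (c * s * t) q ≠ 0 := qPochInf_ne_zero hq fun k => by
    refine one_sub_ne_zero_of_norm_lt ?_
    rw [norm_mul]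
    exact mul_lt_one_of_nonneg_of_lt_one_left (norm_nonneg _) h (hqN k)
  have h4 := (summable_norm_gaussTerm hq h hc).of_norm.hasSum
  have e2 : ∑' n, gaussTerm s t q c n = F 0 := by simp [hF]
  rw [e2] at h4
  have e3 : qPochInf (c * s) q * qPochInf (c * t) q / (qPochInf c q * qPochInf (c * s * t) q) =
      F 0 := by
    rw [div_eq_iff (mul_ne_zero n1 n2)]
    linear_combination -e
  rwa [e3]

theorem exists_norm_inv_one_sub_le {q : ℂ} (hq : ‖q‖ < 1) (b : ℂ) :
    ∃ C : ℝ, 0 < C ∧ ∀ n : ℕ, ‖(1 - b * q ^ n)⁻¹‖ ≤ C := by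
  have h1 : Tendsto (fun n : ℕ => (1 - b * q ^ n)⁻¹) atTop (𝓝 (1 - b * 0)⁻¹) :=
    (((tendsto_pow_atTop_nhds_zero_of_norm_lt_one hq).const_mul b).const_sub 1).inv₀ (by simp)
  obtain ⟨M, hM⟩ := (Metric.isBounded_range_of_tendsto _ h1).exists_norm_le
  exact ⟨max M 1, by positivity, fun n => (hM _ ⟨n, rfl⟩).trans (le_max_left _ _)⟩

/-- Summability of `c r / (1 - b q^r)` over `ℤ`: the denominator tends to `1` as `r → ∞` and grows
like `q^r` as `r → -∞`, so that negative indices gain a factor `q^|r|`. -/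
theorem summable_norm_div_one_sub {q : ℂ} (hq0 : q ≠ 0) (hq : ‖q‖ < 1) {b : ℂ} (hb : b ≠ 0)
    {c : ℤ → ℂ} (h1 : Summable fun n : ℕ => ‖c n‖)
    (h2 : Summable fun n : ℕ => ‖c (-((n : ℤ) + 1)) * q ^ n‖) :
    Summable fun r : ℤ => ‖c r / (1 - b * q ^ r)‖ := by
  refine Summable.of_nat_of_neg_add_one ?_ ?_
  · obtain ⟨C, hC0, hC⟩ := exists_norm_inv_one_sub_le hq b
    refine Summable.of_nonneg_of_le (fun _ => norm_nonneg _) (fun n => ?_) (h1.mul_right C)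
    rw [div_eq_mul_inv, norm_mul, zpow_natCast]
    exact mul_le_mul_of_nonneg_left (hC n) (norm_nonneg _)
  · obtain ⟨C, hC0, hC⟩ := exists_norm_inv_one_sub_le hq (q / b)
    refine Summable.of_nonneg_of_le (fun _ => norm_nonneg _) (fun n => ?_)
      (h2.mul_right (‖q / b‖ * C))
    have e : (1 - b * q ^ (-((n : ℤ) + 1))) = -(q ^ n)⁻¹ * (q / b)⁻¹ * (1 - q / b * q ^ n) := by
      rw [zpow_neg, zpow_add_one₀ hq0, zpow_natCast]
      field_simp
      ring
    rw [e, div_eq_mul_inv, mul_inv, mul_inv, inv_neg, inv_inv, inv_inv, norm_mul, norm_mul,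
      norm_mul, norm_neg, norm_mul]
    have := hC n
    calc _ = ‖c (-((n : ℤ) + 1))‖ * ‖q ^ n‖ * (‖q / b‖ * ‖(1 - q / b * q ^ n)⁻¹‖) := by ring
      _ ≤ _ := by gcongr

theorem summable_norm_kronecker {q a b : ℂ} (hq0 : q ≠ 0) (hqa : ‖q‖ < ‖a‖) (ha : ‖a‖ < 1)
    (hb : b ≠ 0) : Summable fun r : ℤ => ‖a ^ r / (1 - b * q ^ r)‖ := by
  have ha0 : a ≠ 0 := norm_pos_iff.1 ((norm_nonneg q).trans_lt hqa)
  refine summable_norm_div_one_sub (c := fun r => a ^ r) hq0 (hqa.trans ha) hb ?_ ?_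
  · simpa using summable_geometric_of_lt_one (norm_nonneg a) ha
  · have h : ‖q / a‖ < 1 := by
      rw [norm_div]; exact (div_lt_one (norm_pos_iff.2 ha0)).2 hqa
    have := (summable_geometric_of_lt_one (norm_nonneg _) h).mul_right ‖a‖⁻¹
    refine this.congr fun n => ?_
    rw [← norm_pow, ← norm_inv, ← norm_mul, zpow_neg, zpow_add_one₀ ha0, zpow_natCast, div_pow]
    congr 1
    field_simp

/-- Kronecker's identity, in the form of a partial fraction expansion. -/
theorem hasSum_kronecker {q a b : ℂ} (hq0 : q ≠ 0) (hqa : ‖q‖ < ‖a‖) (ha : ‖a‖ < 1)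
    (hb : b ≠ 0) (hbq : ∀ k : ℤ, b ≠ q ^ k) :
    HasSum (fun r : ℤ => a ^ r / (1 - b * q ^ r))
      (qPochInf q q ^ 3 * jTheta (a * b) q / (jTheta a q * jTheta b q)) := by
  have hq := hqa.trans ha
  have ha0 : a ≠ 0 := norm_pos_iff.1 ((norm_nonneg q).trans_lt hqa)
  have hs := summable_norm_kronecker hq0 hqa ha hb
  have hqi := qPochInf_self_ne_zero hq
  have hb1 : ∀ k : ℤ, 1 - b * q ^ k ≠ 0 := fun k h0 => hbq (-k) (by
    rw [zpow_neg]; exact eq_inv_of_mul_eq_one_left (sub_eq_zero.1 h0).symm)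
  have hbN : ∀ N : ℕ, ∀ k : ℕ, 1 - b / q ^ N * q ^ k ≠ 0 := fun N k => by
    have := hb1 (k - N)
    rw [zpow_sub₀ hq0, zpow_natCast, zpow_natCast] at this
    rwa [div_mul_eq_mul_div, mul_div_assoc]
  have hqb : ∀ k : ℕ, 1 - q / b * q ^ k ≠ 0 := fun k h0 => by
    rw [sub_eq_zero, div_mul_eq_mul_div, eq_div_iff hb, one_mul] at h0
    exact hbq (k + 1) (by rw [zpow_add_one₀ hq0, zpow_natCast, h0, mul_comm])
  have hna : ∀ k : ℕ, 1 - a * q ^ k ≠ 0 := fun k => by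
    refine one_sub_ne_zero_of_norm_lt ?_
    rw [norm_mul, norm_pow]
    exact mul_lt_one_of_nonneg_of_lt_one_left (norm_nonneg _) ha (pow_le_one₀ (norm_nonneg _) hq.le)
  have hqa' : ∀ k : ℕ, 1 - q / a * q ^ k ≠ 0 := fun k => by
    refine one_sub_ne_zero_of_norm_lt ?_
    rw [norm_mul, norm_pow, norm_div]
    exact mul_lt_one_of_nonneg_of_lt_one_left (by positivity)
      ((div_lt_one (norm_pos_iff.2 ha0)).2 hqa) (pow_le_one₀ (norm_nonneg _) hq.le)
  have na := qPochInf_ne_zero hq hna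
  have nb : qPochInf b q ≠ 0 := qPochInf_ne_zero hq fun k => by simpa using hb1 k
  have nqb := qPochInf_ne_zero hq hqb
  have nqa := qPochInf_ne_zero hq hqa'
  have hd : Tendsto (fun n => qPoch (q / a) q n * (qPoch q q n)⁻¹) atTop
      (𝓝 (qPochInf (q / a) q * (qPochInf q q)⁻¹)) :=
    (tendsto_qPoch _ hq).mul ((tendsto_qPoch q hq).inv₀ hqi)
  -- The shifted one-sided series below are `q`-Gauss series with `1/s = b q^{-N}`, `1/t = q/a` and
  -- `c = b q^{1-N}`; their limit is the two-sided series.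
  have h1 := tendsto_tsum_shift hs hd
  have h2 : ∀ N : ℕ, ∑' n : ℕ, a ^ ((n : ℤ) - N) / (1 - b * q ^ ((n : ℤ) - N)) *
      (qPoch (q / a) q n * (qPoch q q n)⁻¹) = qPochInf q q * (qPoch (q / (a * b)) q N *
      qPochInf (a * b) q) / (qPoch (q / b) q N * qPochInf b q * qPochInf a q) := by
    intro N
    have hqN : q ^ N ≠ 0 := pow_ne_zero _ hq0
    have haN : a ^ N ≠ 0 := pow_ne_zero _ ha0
    have hc : ∀ k : ℕ, 1 - b / q ^ N * q * q ^ k ≠ 0 := fun k => by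
      have := hbN N (k + 1)
      rwa [pow_succ', ← mul_assoc] at this
    have c1 : b / q ^ N * q * (q ^ N / b) = q := by field_simp
    have c2 : b / q ^ N * q * (a / q) = a * b / q ^ N := by field_simp
    have c3 : b / q ^ N * q * (q ^ N / b) * (a / q) = a := by field_simp
    have hg := (hasSum_gaussTerm (s := q ^ N / b) (t := a / q) hq (by rw [c3]; exact ha) hc).tsum_eq
    rw [c3, c1, c2] at hg
    have hb0 : 1 - b / q ^ N ≠ 0 := by simpa using hbN N 0
    have e1 : qPochInf (b / q ^ N) q = (1 - b / q ^ N) * qPochInf (b / q ^ N * q) q :=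
      qPochInf_eq_mul _ hq
    have e2 := qPochInf_eq_qPoch_mul (b / q ^ N) hq N
    have e3 := qPochInf_eq_qPoch_mul (a * b / q ^ N) hq N
    rw [div_mul_cancel₀ _ hqN, qPoch_div_pow hq0 hb] at e2
    rw [div_mul_cancel₀ _ hqN, qPoch_div_pow hq0 (mul_ne_zero ha0 hb), mul_pow] at e3
    have ni := qPochInf_ne_zero hq hc
    have nbN : qPoch (q / b) q N ≠ 0 := qPoch_ne_zero hqb N
    have hl : ∑' n : ℕ, a ^ ((n : ℤ) - N) / (1 - b * q ^ ((n : ℤ) - N)) *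
        (qPoch (q / a) q n * (qPoch q q n)⁻¹) = (a ^ N)⁻¹ * (1 - b / q ^ N)⁻¹ *
        ∑' n, gaussTerm (q ^ N / b) (a / q) q (b / q ^ N * q) n := by
      rw [← tsum_mul_left]
      refine tsum_congr fun n => ?_
      have f1 : revPoch (q ^ N / b) q n * (b / q ^ N) ^ n = qPoch (b / q ^ N) q n := by
        rw [revPoch_mul_pow (x := 1) (by field_simp)]; rfl
      have f2 : revPoch (a / q) q n * q ^ n = a ^ n * qPoch (q / a) q n := by
        rw [revPoch_mul_pow (x := a) (by field_simp), qPoch, ← card_range n, ← prod_const,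
          card_range, ← prod_mul_distrib]
        exact prod_congr rfl fun k _ => by field_simp
      have f3 : qPoch (b / q ^ N) q n * (1 - b / q ^ N * q ^ n) =
          (1 - b / q ^ N) * qPoch (b / q ^ N * q) q n := by
        rw [← qPoch_succ, qPoch_succ']
      have g1 := hbN N n
      have g2 := qPoch_ne_zero hc n
      have g3 := qPoch_ne_zero (one_sub_q_pow_ne_zero hq) n
      rw [gaussTerm, mul_pow, show revPoch (q ^ N / b) q n * revPoch (a / q) q n *
        ((b / q ^ N) ^ n * q ^ n) = (revPoch (q ^ N / b) q n * (b / q ^ N) ^ n) *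
        (revPoch (a / q) q n * q ^ n) by ring, f1, f2, zpow_sub₀ ha0, zpow_sub₀ hq0,
        ← mul_div_assoc b, ← div_mul_eq_mul_div b]
      simp only [zpow_natCast]
      have f4 : qPoch (b / q ^ N) q n =
          (1 - b / q ^ N) * qPoch (b / q ^ N * q) q n / (1 - b / q ^ N * q ^ n) := by
        rw [eq_div_iff g1, f3]
      rw [f4]
      generalize qPoch (b / q ^ N * q) q n = C at g2 ⊢
      generalize 1 - b / q ^ N * q ^ n = A at g1 ⊢
      generalize 1 - b / q ^ N = B at hb0 ⊢
      field_simp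
    rw [hl, hg]
    have hK : (-1 : ℂ) ^ N ≠ 0 := by simp
    have hch := zpow_ne_zero (choose2 ((N : ℤ) + 1)) hq0
    have e4 : (1 - b / q ^ N) * qPochInf (b / q ^ N * q) q =
      (-1) ^ N * b ^ N / q ^ choose2 (N + 1) * qPoch (q / b) q N * qPochInf b q := by
      rw [← e1, e2]
    rw [e3]
    have e5 : qPochInf (b / q ^ N * q) q = (1 - b / q ^ N)⁻¹ * ((-1) ^ N * b ^ N /
        q ^ choose2 (N + 1) * qPoch (q / b) q N * qPochInf b q) := by
      rw [← e4, inv_mul_cancel_left₀ hb0]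
    rw [e5]
    generalize 1 - b / q ^ N = B at *
    generalize q ^ choose2 ((N : ℤ) + 1) = D at *
    field_simp
  simp only [h2] at h1
  have h4 : Tendsto (fun N => qPochInf q q * (qPoch (q / (a * b)) q N *
      qPochInf (a * b) q) / (qPoch (q / b) q N * qPochInf b q * qPochInf a q)) atTop
      (𝓝 (qPochInf q q * (qPochInf (q / (a * b)) q *
      qPochInf (a * b) q) / (qPochInf (q / b) q * qPochInf b q * qPochInf a q))) :=
    (((tendsto_qPoch _ hq).mul_const _).const_mul _).div
      (((tendsto_qPoch _ hq).mul_const _).mul_const _) (by simp [*])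
  have h5 := tendsto_nhds_unique h1 h4
  have h6 := hs.of_norm.hasSum
  have h7 : ∑' r : ℤ, a ^ r / (1 - b * q ^ r) =
      qPochInf q q ^ 3 * jTheta (a * b) q / (jTheta a q * jTheta b q) := by
    rw [← mul_left_inj' (mul_ne_zero nqa (inv_ne_zero hqi)), h5]
    unfold jTheta
    field_simp
  rwa [h7] at h6

/-! ### Bailey's lemma -/

theorem hasSum_congr' {ι : Type*} {f g : ι → ℂ} {a : ℂ} (h : ∀ i, f i = g i) :
    HasSum f a ↔ HasSum g a := by rw [funext h]

theorem hasSum_antidiagonal {f : ℕ × ℕ → ℂ} {S : ℂ} (h : HasSum f S) :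
    HasSum (fun n => ∑ p ∈ antidiagonal n, f p) S := by
  have h1 := (HasAntidiagonal.sigmaAntidiagonalEquivProd (A := ℕ)).hasSum_iff.2 h
  refine h1.sigma fun n => ?_
  have := hasSum_fintype fun p : antidiagonal n => f p
  rwa [univ_eq_attach, sum_attach _ f] at this

theorem summable_norm_mul_norm_add {α D : ℕ → ℂ} (hα : Summable fun r => ‖α r‖)
    (hD : Summable fun n => ‖D n‖) :
    Summable fun p : ℕ × ℕ => ‖α p.1‖ * ‖D (p.1 + p.2)‖ := by
  have h1 : ∀ r, Summable fun m => ‖D (r + m)‖ := fun r =>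
    hD.comp_injective (add_right_injective r)
  have h2 : ∀ r, ∑' m, ‖D (r + m)‖ ≤ ∑' n, ‖D n‖ := fun r =>
    tsum_comp_le_tsum_of_inj hD (fun _ => norm_nonneg _) (add_right_injective r)
  have h0 : 0 ≤ fun p : ℕ × ℕ => ‖α p.1‖ * ‖D (p.1 + p.2)‖ := fun p =>
    mul_nonneg (norm_nonneg _) (norm_nonneg _)
  rw [summable_prod_of_nonneg h0]
  constructor
  · intro r
    exact (h1 r).mul_left ‖α r‖
  · have h3 : ∀ r, ∑' m, ‖α r‖ * ‖D (r + m)‖ ≤ ‖α r‖ * ∑' n, ‖D n‖ := fun r => by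
      rw [tsum_mul_left]
      exact mul_le_mul_of_nonneg_left (h2 r) (norm_nonneg _)
    exact Summable.of_nonneg_of_le (fun r => tsum_nonneg fun m => h0 (r, m)) h3
      (hα.mul_right (∑' n, ‖D n‖))

theorem one_sub_mul_pow_ne_zero {q z : ℂ} (hq : ‖q‖ < 1) (hz : ‖z‖ < 1) (k : ℕ) :
    1 - z * q ^ k ≠ 0 := by
  refine one_sub_ne_zero_of_norm_lt ?_
  rw [norm_mul, norm_pow]
  exact mul_lt_one_of_nonneg_of_lt_one_left (norm_nonneg _) hz (pow_le_one₀ (norm_nonneg _) hq.le)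

/-- The `q`-Gauss sum with `s`, `t`, `c` replaced by `s q^{-r}`, `t q^{-r}`, `a q^{2r+1}`: the
coefficient of `α_r` in the series `∑ (1/s)_n (1/t)_n (aqst)^n β_n`. -/
theorem hasSum_bailey_fiber {s t a q : ℂ} (hq0 : q ≠ 0) (hq : ‖q‖ < 1) (h : ‖a * q * s * t‖ < 1)
    (hs : ‖a * q * s‖ < 1) (ht : ‖a * q * t‖ < 1) (ha : ∀ k : ℕ, 1 - a * q * q ^ k ≠ 0)
    (α : ℕ → ℂ) (r : ℕ) :
    HasSum (fun m => α r * (revPoch s q (r + m) * revPoch t q (r + m) * (a * q) ^ (r + m)) /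
      (qPoch q q m * qPoch (a * q) q (2 * r + m)))
      (qPochInf (a * q * s) q * qPochInf (a * q * t) q /
        (qPochInf (a * q) q * qPochInf (a * q * s * t) q) *
        (revPoch s q r * revPoch t q r * (a * q) ^ r *
          α r / (qPoch (a * q * s) q r * qPoch (a * q * t) q r))) := by
  have hz : ∀ z : ℂ, ‖z‖ < 1 → ∀ k : ℕ, 1 - z * q ^ k ≠ 0 := fun z hz =>
    one_sub_mul_pow_ne_zero hq hz
  have hqr : q ^ r ≠ 0 := pow_ne_zero _ hq0
  have c0 : a * q * q ^ (2 * r) * (s / q ^ r) * (t / q ^ r) = a * q * s * t := by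
    rw [pow_mul', sq]; field_simp
  have c1 : a * q * q ^ (2 * r) * (s / q ^ r) = a * q * s * q ^ r := by
    rw [pow_mul', sq]; field_simp
  have c2 : a * q * q ^ (2 * r) * (t / q ^ r) = a * q * t * q ^ r := by
    rw [pow_mul', sq]; field_simp
  have hc : ∀ k : ℕ, 1 - a * q * q ^ (2 * r) * q ^ k ≠ 0 := fun k => by
    rw [mul_assoc, ← pow_add]; exact ha _
  have hg := hasSum_gaussTerm (s := s / q ^ r) (t := t / q ^ r) (c := a * q * q ^ (2 * r)) hq
    (by rw [c0]; exact h) hc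
  rw [c0, c1, c2] at hg
  have hg2 := hg.mul_left (α r * (revPoch s q r * revPoch t q r * (a * q) ^ r) /
    qPoch (a * q) q (2 * r))
  have n1 := qPoch_ne_zero ha (2 * r)
  have n2 := qPoch_ne_zero (hz _ hs) r
  have n3 := qPoch_ne_zero (hz _ ht) r
  have n4 := qPochInf_ne_zero hq hc
  have n5 := qPochInf_ne_zero hq (hz _ h)
  have e1 : (qPochInf (a * q * s) q * qPochInf (a * q * t) q /
      (qPochInf (a * q) q * qPochInf (a * q * s * t) q)) *
      (revPoch s q r * revPoch t q r * (a * q) ^ r * α r /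
      (qPoch (a * q * s) q r * qPoch (a * q * t) q r)) =
      α r * (revPoch s q r * revPoch t q r * (a * q) ^ r) / qPoch (a * q) q (2 * r) *
      (qPochInf (a * q * s * q ^ r) q *
      qPochInf (a * q * t * q ^ r) q / (qPochInf (a * q * q ^ (2 * r)) q *
      qPochInf (a * q * s * t) q)) := by
    rw [qPochInf_eq_qPoch_mul (a * q * s) hq r, qPochInf_eq_qPoch_mul (a * q * t) hq r,
      qPochInf_eq_qPoch_mul (a * q) hq (2 * r)]
    field_simp
  rw [e1]
  refine (hasSum_congr' fun m => ?_).2 hg2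
  simp only [gaussTerm]
  rw [qPoch_add, revPoch_add hq0, revPoch_add hq0, pow_add, mul_pow (a * q) (q ^ (2 * r)),
    pow_mul' q 2 r, sq (q ^ r), mul_pow (q ^ r) (q ^ r) m]
  ring

/-- Bailey's lemma: if `β_n = ∑_{r ≤ n} α_r / ((q)_{n-r} (aq)_{n+r})`, then the series of the
`β_n` with weights `(1/s)_n (1/t)_n (aqst)^n` is a multiple of a series in the `α_r`. -/
theorem bailey_lemma {s t a q : ℂ} (hq0 : q ≠ 0) (hq : ‖q‖ < 1) (h : ‖a * q * s * t‖ < 1)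
    (hs : ‖a * q * s‖ < 1) (ht : ‖a * q * t‖ < 1) (ha : ∀ k : ℕ, 1 - a * q * q ^ k ≠ 0)
    {α β : ℕ → ℂ} (hα : Summable fun r => ‖α r‖)
    (hβ : ∀ n, β n = ∑ r ∈ range (n + 1), α r / (qPoch q q (n - r) * qPoch (a * q) q (n + r))) :
    (Summable fun r => revPoch s q r * revPoch t q r * (a * q) ^ r * α r /
      (qPoch (a * q * s) q r * qPoch (a * q * t) q r)) ∧
    HasSum (fun n => revPoch s q n * revPoch t q n * (a * q) ^ n * β n)
      (qPochInf (a * q * s) q * qPochInf (a * q * t) q /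
        (qPochInf (a * q) q * qPochInf (a * q * s * t) q) *
        ∑' r, revPoch s q r * revPoch t q r * (a * q) ^ r * α r /
          (qPoch (a * q * s) q r * qPoch (a * q * t) q r)) := by
  have hz : ∀ z : ℂ, ‖z‖ < 1 → ∀ k : ℕ, 1 - z * q ^ k ≠ 0 := fun z hz =>
    one_sub_mul_pow_ne_zero hq hz
  set D : ℕ → ℂ := fun n => revPoch s q n * revPoch t q n * (a * q) ^ n with hD
  have hDs : Summable fun n => ‖D n‖ := summable_norm_revPoch hq h
  set F : ℕ × ℕ → ℂ := fun p =>
    α p.1 * D (p.1 + p.2) / (qPoch q q p.2 * qPoch (a * q) q (2 * p.1 + p.2)) with hF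
  have hFs : Summable F := by
    obtain ⟨M, hM0, hM⟩ := exists_norm_inv_qPoch_le hq (one_sub_q_pow_ne_zero hq)
    obtain ⟨M', hM0', hM'⟩ := exists_norm_inv_qPoch_le hq ha
    have hb := summable_norm_mul_norm_add hα hDs
    refine Summable.of_norm_bounded (hb.mul_right (M * M')) fun p => ?_
    rw [hF]
    simp only
    rw [div_eq_mul_inv, mul_inv, norm_mul, norm_mul, norm_mul (qPoch q q p.2)⁻¹]
    have e3 := hM p.2
    have e4 := hM' (2 * p.1 + p.2)
    gcongr
  have hFS := hFs.hasSum
  set S := ∑' p, F p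
  set C : ℂ := qPochInf (a * q * s) q * qPochInf (a * q * t) q /
        (qPochInf (a * q) q * qPochInf (a * q * s * t) q) with hC
  have hfib : ∀ r, HasSum (fun m => F (r, m)) (C * (revPoch s q r * revPoch t q r * (a * q) ^ r *
      α r / (qPoch (a * q * s) q r * qPoch (a * q * t) q r))) := by
    exact hasSum_bailey_fiber hq0 hq h hs ht ha α
  -- Summing the double series by rows uses the `q`-Gauss sum; by antidiagonals it gives the
  -- definition of `β_n`.
  have hrow := hFS.prod_fiberwise hfib
  have hdiag := hasSum_antidiagonal hFS
  have hC0 : C ≠ 0 := by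
    refine div_ne_zero (mul_ne_zero ?_ ?_) (mul_ne_zero ?_ ?_)
    exacts [qPochInf_ne_zero hq (hz _ hs), qPochInf_ne_zero hq (hz _ ht), qPochInf_ne_zero hq ha,
      qPochInf_ne_zero hq (hz _ h)]
  refine ⟨(summable_mul_left_iff hC0).1 hrow.summable, ?_⟩
  rw [← tsum_mul_left, hrow.tsum_eq]
  refine (hasSum_congr' fun n => ?_).2 hdiag
  rw [Nat.sum_antidiagonal_eq_sum_range_succ_mk, hβ, mul_sum]
  refine sum_congr rfl fun r hr => ?_
  have hr' : r ≤ n := by simpa [Nat.lt_succ_iff] using hr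
  simp only [hF, hD]
  rw [Nat.add_sub_cancel' hr', show 2 * r + (n - r) = n + r by omega]
  ring

/-! ### Two Bailey pairs -/

/-- The reciprocal `1 / (q;q)_k`, with the value `0` for negative `k`. -/
noncomputable def rPoch (q : ℂ) (k : ℤ) : ℂ := if k < 0 then 0 else (qPoch q q k.toNat)⁻¹

theorem rPoch_natCast (q : ℂ) (k : ℕ) : rPoch q k = (qPoch q q k)⁻¹ := by simp [rPoch]

theorem rPoch_of_neg (q : ℂ) {k : ℤ} (h : k < 0) : rPoch q k = 0 := by simp [rPoch, h]

theorem rPoch_sub_one {q : ℂ} (hq : ‖q‖ < 1) (k : ℤ) :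
    rPoch q (k - 1) = (1 - q ^ k) * rPoch q k := by
  rcases lt_trichotomy k 0 with h | h | h
  · rw [rPoch_of_neg q h, rPoch_of_neg q (by omega), mul_zero]
  · subst h; simp [rPoch_of_neg]
  · obtain ⟨n, rfl⟩ : ∃ n : ℕ, k = (n + 1 : ℕ) := ⟨(k - 1).toNat, by omega⟩
    rw [rPoch_natCast, show ((n + 1 : ℕ) : ℤ) - 1 = n by push_cast; ring, rPoch_natCast,
      qPoch_succ, zpow_natCast, pow_succ', mul_inv, mul_comm, mul_assoc,
      inv_mul_cancel₀ (one_sub_q_pow_ne_zero hq n), mul_one]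

/-- The unit Bailey pair relative to `q`: its `β_n` vanishes for `n ≠ 0`. -/
theorem sum_unit_bailey {q : ℂ} (hq0 : q ≠ 0) (hq : ‖q‖ < 1) {n : ℕ} (hn : n ≠ 0) :
    ∑ r ∈ range (n + 1), (-1) ^ r * q ^ choose2 r * (1 - q ^ (2 * r + 1)) *
      (rPoch q (n - r) * rPoch q (n + r + 1)) = 0 := by
  have h1 : 1 - q ^ n ≠ 0 := by
    apply one_sub_ne_zero_of_norm_lt
    rw [norm_pow]
    exact pow_lt_one₀ (norm_nonneg _) hq hn
  refine (mul_eq_zero_iff_left h1).1 ?_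
  -- After multiplication by `1 - q^n` the sum telescopes, and `W 0 = 0` while `W (n + 1) = 0`
  -- because `1/(q;q)_{-1} = 0`.
  set W : ℕ → ℂ := fun r => (-1) ^ r * q ^ choose2 r * (1 - q ^ r) *
    (rPoch q (n - r) * rPoch q (n + r)) with hW
  have h2 : ∀ r : ℕ, (1 - q ^ n) * ((-1) ^ r * q ^ choose2 r * (1 - q ^ (2 * r + 1)) *
      (rPoch q (n - r) * rPoch q (n + r + 1))) = W r - W (r + 1) := by
    intro r
    simp only [hW]
    have a1 := rPoch_sub_one hq ((n : ℤ) - r)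
    have a2 := rPoch_sub_one hq ((n : ℤ) + r + 1)
    rw [add_sub_cancel_right] at a2
    have e : q ^ ((n : ℤ) - r) = q ^ n * (q ^ r)⁻¹ := by
      rw [zpow_sub₀ hq0, zpow_natCast, zpow_natCast, div_eq_mul_inv]
    have e' : q ^ ((n : ℤ) + r + 1) = q ^ n * q ^ r * q := by
      rw [zpow_add_one₀ hq0, zpow_add₀ hq0, zpow_natCast, zpow_natCast]
    rw [e] at a1
    rw [e'] at a2
    push_cast
    rw [show (n : ℤ) - (r + 1) = n - r - 1 by ring, show (n : ℤ) + (r + 1) = n + r + 1 by ring,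
      a1, a2, choose2_add_one, zpow_add₀ hq0, zpow_natCast, pow_succ, pow_succ, pow_succ, pow_mul']
    have := pow_ne_zero r hq0
    generalize q ^ r = y at *
    generalize q ^ n = z at *
    field_simp
    ring
  rw [mul_sum, sum_congr rfl fun r _ => h2 r, sum_range_sub']
  simp [hW, rPoch_of_neg]

/-- Summation by parts against a telescoping sequence. -/
theorem sum_mul_sub_eq (t V : ℕ → ℂ) (m : ℕ) :
    ∑ r ∈ range m, (∑ j ∈ range (r + 1), t j) * (V r - V (r + 1)) =
      ∑ r ∈ range m, t r * V r - (∑ j ∈ range m, t j) * V m := by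
  induction m with
  | zero => simp
  | succ m ih =>
    rw [sum_range_succ, ih, sum_range_succ (fun r => t r * V r), sum_range_succ t m]; ring

theorem one_sub_odd_ne_zero {q : ℂ} (hq : ‖q‖ < 1) (k : ℕ) : 1 - q * (q ^ 2) ^ k ≠ 0 := by
  apply one_sub_ne_zero_of_norm_lt
  rw [← pow_mul, ← pow_succ', norm_pow]
  exact pow_lt_one₀ (norm_nonneg _) hq (by omega)

theorem zpow_choose2_natCast_add_one (q : ℂ) (r : ℕ) :
    q ^ choose2 ((r : ℤ) + 1) = q ^ (r * (r + 1) / 2) := by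
  rw [← zpow_natCast]
  congr 1
  simp only [choose2]
  push_cast
  rw [add_sub_cancel_right, mul_comm]

/-- The Bailey pair relative to `q^2` with `β_n` proportional to `1 / (q;q^2)_{n+1}`. -/
theorem bailey_pair_innerSum {q : ℂ} (hq0 : q ≠ 0) (hq : ‖q‖ < 1) (n : ℕ) :
    ∑ r ∈ range (n + 1), (-1) ^ r * (1 - q ^ (2 * r + 2)) * q ^ (r ^ 2 + r) * innerSum q r *
      (rPoch q (n - r) * rPoch q (n + r + 2)) = (qPoch q (q ^ 2) (n + 1))⁻¹ := by
  induction n with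
  | zero =>
    have h1 := one_sub_q_pow_ne_zero hq 0
    have h2 := one_sub_q_pow_ne_zero hq 1
    have e : rPoch q 2 = (qPoch q q 2)⁻¹ := rPoch_natCast q 2
    have e' : rPoch q 0 = 1 := by simpa using rPoch_natCast q 0
    simp only [zero_add, sum_range_one, innerSum]
    simp [e, e', qPoch, prod_range_succ] at *
    rw [← sq] at *
    field_simp
  | succ n ih =>
    -- The recurrence `(1 - q^{2n+3}) β_{n+1} = β_n`: the difference of the two sides is a sum of
    -- `innerSum` against a telescoping sequence. Summation by parts removes `innerSum` and leaves
    -- the unit Bailey pair.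
    have hk := one_sub_odd_ne_zero hq (n + 1)
    rw [qPoch_succ _ _ (n + 1), mul_inv, ← ih, eq_mul_inv_iff_mul_eq₀ hk]
    set U : ℕ → ℂ := fun r => q ^ (r ^ 2) * (1 - q ^ (2 * r + 1)) with hU
    set V : ℕ → ℂ := fun r => (-1) ^ r * U r *
      (rPoch q ((n + 1 : ℕ) - r) * rPoch q ((n + 1 : ℕ) + r + 1)) with hV
    have key : ∀ r : ℕ, (-1) ^ r * (1 - q ^ (2 * r + 2)) * q ^ (r ^ 2 + r) * innerSum q r *
        (rPoch q ((n + 1 : ℕ) - r) * rPoch q ((n + 1 : ℕ) + r + 2)) * (1 - q * (q ^ 2) ^ (n + 1)) -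
        (-1) ^ r * (1 - q ^ (2 * r + 2)) * q ^ (r ^ 2 + r) * innerSum q r *
        (rPoch q (n - r) * rPoch q (n + r + 2)) =
        q ^ (n + 1) * (innerSum q r * (V r - V (r + 1))) := by
      intro r
      have a1 := rPoch_sub_one hq (((n + 1 : ℕ) : ℤ) - r)
      have a2 := rPoch_sub_one hq (((n + 1 : ℕ) : ℤ) + r + 2)
      have e : q ^ (((n + 1 : ℕ) : ℤ) - r) = q ^ (n + 1) * (q ^ r)⁻¹ := by
        rw [zpow_sub₀ hq0, zpow_natCast, zpow_natCast, div_eq_mul_inv]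
      have e' : q ^ (((n + 1 : ℕ) : ℤ) + r + 2) = q ^ (n + 1) * q ^ r * q ^ 2 := by
        rw [zpow_add₀ hq0, zpow_add₀ hq0, zpow_natCast, zpow_natCast]; norm_cast
      rw [e] at a1
      rw [e'] at a2
      have b1 : (((n + 1 : ℕ) : ℤ) - r - 1) = n - r := by push_cast; ring
      have b2 : (((n + 1 : ℕ) : ℤ) + r + 2 - 1) = ((n + 1 : ℕ) : ℤ) + r + 1 := by ring
      have b3 : (n : ℤ) + r + 2 = ((n + 1 : ℕ) : ℤ) + r + 1 := by push_cast; ring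
      have b4 : (((n + 1 : ℕ) : ℤ) - (r + 1 : ℕ)) = n - r := by push_cast; ring
      have b5 : ((n + 1 : ℕ) : ℤ) + (r + 1 : ℕ) + 1 = ((n + 1 : ℕ) : ℤ) + r + 2 := by
        push_cast; ring
      rw [b1] at a1
      rw [b2] at a2
      simp only [hV, hU]
      rw [b3, b4, b5, a1, a2]
      have := pow_ne_zero r hq0
      have c1 : q ^ ((r + 1) ^ 2) = q ^ (r ^ 2) * (q ^ r) ^ 2 * q := by ring
      have c2 : q ^ (2 * r + 2) = (q ^ r) ^ 2 * q ^ 2 := by ring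
      have c3 : q ^ (2 * r + 1) = (q ^ r) ^ 2 * q := by ring
      have c4 : q ^ (2 * (r + 1) + 1) = (q ^ r) ^ 2 * q ^ 3 := by ring
      have c5 : q ^ (r ^ 2 + r) = q ^ (r ^ 2) * q ^ r := by ring
      have c6 : (q ^ 2) ^ (n + 1) = (q ^ (n + 1)) ^ 2 := by ring
      rw [c1, c2, c3, c4, c5, c6, pow_succ (-1 : ℂ)]
      generalize q ^ r = y at *
      generalize q ^ (r ^ 2) = w
      generalize q ^ (n + 1) = z at *
      field_simp
      ring
    have hlast : rPoch q ((n : ℤ) - (n + 1 : ℕ)) = 0 := rPoch_of_neg _ (by push_cast; omega)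
    have hext : ∑ r ∈ range (n + 1 + 1), (-1) ^ r * (1 - q ^ (2 * r + 2)) * q ^ (r ^ 2 + r) *
        innerSum q r * (rPoch q (n - r) * rPoch q (n + r + 2)) =
        ∑ r ∈ range (n + 1), (-1) ^ r * (1 - q ^ (2 * r + 2)) * q ^ (r ^ 2 + r) *
        innerSum q r * (rPoch q (n - r) * rPoch q (n + r + 2)) := by
      rw [sum_range_succ _ (n + 1), hlast]; simp
    rw [← hext, ← sub_eq_zero, sum_mul, ← sum_sub_distrib, sum_congr rfl fun r _ => key r,
      ← mul_sum]
    refine mul_eq_zero_of_right _ ?_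
    simp only [innerSum]
    rw [sum_mul_sub_eq]
    have hV0 : V (n + 1 + 1) = 0 := by
      simp only [hV]
      rw [rPoch_of_neg q (by push_cast; omega)]; simp
    rw [hV0, mul_zero, sub_zero, ← sum_unit_bailey hq0 hq (Nat.succ_ne_zero n)]
    refine sum_congr rfl fun r _ => ?_
    simp only [hV, hU]
    have c : q ^ (r ^ 2) = q ^ choose2 (r : ℤ) * q ^ (r * (r + 1) / 2) := by
      rw [← zpow_choose2_natCast_add_one, ← zpow_add₀ hq0, ← zpow_natCast]
      congr 1
      have := two_mul_choose2 (r : ℤ)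
      have := two_mul_choose2 ((r : ℤ) + 1)
      push_cast
      linarith
    have := pow_ne_zero (r * (r + 1) / 2) hq0
    rw [c]
    field_simp

/-- The Bailey pair relative to `q` with `β_n` proportional to `1 / ((x)_{n+1} (q/x)_{n+1})`. -/
theorem bailey_pair_universal {q x : ℂ} (hq0 : q ≠ 0) (hq : ‖q‖ < 1) (hx0 : x ≠ 0)
    (hx : ∀ k : ℕ, 1 - x * q ^ k ≠ 0) (hx' : ∀ k : ℕ, 1 - q / x * q ^ k ≠ 0) (n : ℕ) :
    ∑ r ∈ range (n + 1), (-1) ^ r * q ^ choose2 (r + 1) * (1 - q ^ (2 * r + 1)) /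
      ((1 - x * q ^ r) * (1 - q / x * q ^ r)) * (rPoch q (n - r) * rPoch q (n + r + 1)) =
      (qPoch x q (n + 1) * qPoch (q / x) q (n + 1))⁻¹ := by
  induction n with
  | zero =>
    have h1 := one_sub_q_pow_ne_zero hq 0
    have h2 := hx 0
    have h3 := hx' 0
    have e : rPoch q 1 = (qPoch q q 1)⁻¹ := rPoch_natCast q 1
    have e' : rPoch q 0 = 1 := by simpa using rPoch_natCast q 0
    simp [e, e', qPoch, choose2] at *
    field_simp
  | succ n ih =>
    -- The recurrence `(1 - x q^{n+1}) (1 - q^{n+2}/x) β_{n+1} = β_n`: the denominators depending on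
    -- `r` cancel from the difference, which is a multiple of the unit Bailey pair.
    have k1 := hx (n + 1)
    have k2 := hx' (n + 1)
    rw [qPoch_succ _ _ (n + 1), qPoch_succ _ _ (n + 1), mul_mul_mul_comm, mul_inv, ← ih,
      eq_mul_inv_iff_mul_eq₀ (mul_ne_zero k1 k2)]
    have key : ∀ r : ℕ, (-1) ^ r * q ^ choose2 (r + 1) * (1 - q ^ (2 * r + 1)) /
        ((1 - x * q ^ r) * (1 - q / x * q ^ r)) * (rPoch q ((n + 1 : ℕ) - r) *
        rPoch q ((n + 1 : ℕ) + r + 1)) * ((1 - x * q ^ (n + 1)) * (1 - q / x * q ^ (n + 1))) -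
        (-1) ^ r * q ^ choose2 (r + 1) * (1 - q ^ (2 * r + 1)) /
        ((1 - x * q ^ r) * (1 - q / x * q ^ r)) * (rPoch q (n - r) * rPoch q (n + r + 1)) =
        q ^ (n + 1) * ((-1) ^ r * q ^ choose2 r * (1 - q ^ (2 * r + 1)) *
        (rPoch q ((n + 1 : ℕ) - r) * rPoch q ((n + 1 : ℕ) + r + 1))) := by
      intro r
      have a1 := rPoch_sub_one hq (((n + 1 : ℕ) : ℤ) - r)
      have a2 := rPoch_sub_one hq (((n + 1 : ℕ) : ℤ) + r + 1)
      have e : q ^ (((n + 1 : ℕ) : ℤ) - r) = q ^ (n + 1) * (q ^ r)⁻¹ := by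
        rw [zpow_sub₀ hq0, zpow_natCast, zpow_natCast, div_eq_mul_inv]
      have e' : q ^ (((n + 1 : ℕ) : ℤ) + r + 1) = q ^ (n + 1) * q ^ r * q := by
        rw [zpow_add_one₀ hq0, zpow_add₀ hq0, zpow_natCast, zpow_natCast]
      rw [e] at a1
      rw [e'] at a2
      have b1 : (((n + 1 : ℕ) : ℤ) - r - 1) = n - r := by push_cast; ring
      have b2 : (((n + 1 : ℕ) : ℤ) + r + 1 - 1) = (n : ℤ) + r + 1 := by push_cast; ring
      rw [b1] at a1
      rw [b2] at a2
      rw [a1, a2]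
      have := pow_ne_zero r hq0
      have y1 := hx r
      have y2 := hx' r
      have c3 : q ^ (2 * r + 1) = (q ^ r) ^ 2 * q := by ring
      rw [choose2_add_one, zpow_add₀ hq0, zpow_natCast, c3]
      generalize q ^ r = y at *
      generalize q ^ (n + 1) = z at *
      have y3 : x - q * y ≠ 0 := fun h0 => y2 (by field_simp; simpa using h0)
      have y4 : x - y * q ≠ 0 := by rwa [mul_comm]
      have y5 : 1 - y * x ≠ 0 := by rwa [mul_comm]
      field_simp
      ring
    have hlast : rPoch q ((n : ℤ) - (n + 1 : ℕ)) = 0 := rPoch_of_neg _ (by push_cast; omega)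
    have hext : ∑ r ∈ range (n + 1 + 1), (-1) ^ r * q ^ choose2 (r + 1) * (1 - q ^ (2 * r + 1)) /
        ((1 - x * q ^ r) * (1 - q / x * q ^ r)) * (rPoch q (n - r) * rPoch q (n + r + 1)) =
        ∑ r ∈ range (n + 1), (-1) ^ r * q ^ choose2 (r + 1) * (1 - q ^ (2 * r + 1)) /
        ((1 - x * q ^ r) * (1 - q / x * q ^ r)) * (rPoch q (n - r) * rPoch q (n + r + 1)) := by
      rw [sum_range_succ _ (n + 1), hlast]; simp
    rw [← hext, ← sub_eq_zero, sum_mul, ← sum_sub_distrib, sum_congr rfl fun r _ => key r,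
      ← mul_sum, sum_unit_bailey hq0 hq (Nat.succ_ne_zero n), mul_zero]

/-! ### The Bailey pair applied to the four mock theta series -/

theorem pow_half_eq_zpow (q : ℂ) {k : ℕ} {z : ℤ} (h : (k : ℤ) = 2 * z) : q ^ (k / 2) = q ^ z := by
  rw [← zpow_natCast]
  congr 1
  omega

/-- The last term of `innerSum` is the largest in absolute value, and there are at most `2 ^ n`
terms. -/
theorem norm_innerSum_le {q : ℂ} (hq0 : q ≠ 0) (hq : ‖q‖ < 1) (n : ℕ) :
    ‖innerSum q n‖ ≤ 2 ^ n * ‖(q ^ (n * (n + 1) / 2))⁻¹‖ := by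
  have h1 : ∀ j ∈ range (n + 1), ‖(q ^ (j * (j + 1) / 2))⁻¹‖ ≤ ‖(q ^ (n * (n + 1) / 2))⁻¹‖ := by
    intro j hj
    have hj' : j ≤ n := by simpa [Nat.lt_succ_iff] using hj
    rw [norm_inv, norm_inv, norm_pow, norm_pow]
    refine inv_anti₀ (by positivity) (pow_le_pow_of_le_one (norm_nonneg _) hq.le ?_)
    exact Nat.div_le_div_right (Nat.mul_le_mul hj' (by omega))
  refine (norm_sum_le_of_le _ h1).trans ?_
  rw [sum_const, card_range, nsmul_eq_mul]
  refine mul_le_mul_of_nonneg_right ?_ (norm_nonneg _)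
  exact_mod_cast Nat.lt_two_pow_self

/-- The sequence `α_r` of the Bailey pair relative to `q^2`, up to the factor `(1-q)(1-q^2)`. -/
noncomputable def alphaInner (q : ℂ) (r : ℕ) : ℂ :=
  (-1) ^ r * (1 - q ^ (2 * r + 2)) * q ^ (r ^ 2 + r) * innerSum q r

theorem summable_norm_alphaInner {q : ℂ} (hq0 : q ≠ 0) (hq : ‖q‖ < 1) :
    Summable fun r => ‖alphaInner q r‖ := by
  have h := (summable_norm_theta hq0 hq (x := 2 * q) (by simp [hq0])).comp_injective
    (Nat.cast_injective (R := ℤ))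
  refine Summable.of_nonneg_of_le (fun _ => norm_nonneg _) (fun r => ?_) (h.mul_left 2)
  have e : q ^ choose2 (r : ℤ) * (2 * q) ^ (r : ℤ) = 2 ^ r * q ^ (r * (r + 1) / 2) := by
    rw [← zpow_choose2_natCast_add_one, choose2_add_one, zpow_add₀ hq0]
    simp only [zpow_natCast]
    ring
  simp only [Function.comp_apply]
  rw [e, alphaInner, norm_mul, norm_mul, norm_mul, norm_pow, norm_neg, norm_one, one_pow, one_mul,
    norm_mul]
  have e2 : q ^ (r ^ 2 + r) = q ^ (r * (r + 1) / 2) * q ^ (r * (r + 1) / 2) := by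
    rw [← pow_add]
    congr 1
    have : 2 ∣ r * (r + 1) := (Nat.even_mul_succ_self r).two_dvd
    rw [← two_mul, Nat.mul_div_cancel' this]
    ring
  have h1 : ‖1 - q ^ (2 * r + 2)‖ ≤ 2 := by
    refine (norm_sub_le _ _).trans ?_
    rw [norm_one, norm_pow]
    linarith [pow_le_one₀ (n := 2 * r + 2) (norm_nonneg q) hq.le]
  have h2 := norm_innerSum_le hq0 hq r
  have h3 : ‖q ^ (r * (r + 1) / 2)‖ ≠ 0 := norm_ne_zero_iff.2 (pow_ne_zero _ hq0)
  rw [e2, norm_mul]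
  rw [norm_inv] at h2
  have h4 : ‖(2 : ℂ) ^ r‖ = 2 ^ r := by simp
  rw [h4]
  set w := ‖q ^ (r * (r + 1) / 2)‖
  calc _ ≤ 2 * (w * w) * (2 ^ r * w⁻¹) := by gcongr
    _ = _ := by field_simp

/-- Bailey's lemma for the pair with `β_n = 1/(q;q^2)_{n+1}`, with the parameters `ρ = 1/s`, `1/t`
left free. The four series of the theorem are specializations. -/
theorem bailey_innerSum {s t q : ℂ} (hq0 : q ≠ 0) (hq : ‖q‖ < 1) (h : ‖q ^ 3 * s * t‖ < 1)
    (hs : ‖q ^ 3 * s‖ < 1) (ht : ‖q ^ 3 * t‖ < 1) :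
    (Summable fun r => revPoch s q r * revPoch t q r * (q ^ 3) ^ r * alphaInner q r /
      (qPoch (q ^ 3 * s) q r * qPoch (q ^ 3 * t) q r)) ∧
    HasSum (fun n => revPoch s q n * revPoch t q n * (q ^ 3) ^ n * (qPoch q (q ^ 2) (n + 1))⁻¹)
      (qPochInf (q ^ 3 * s) q * qPochInf (q ^ 3 * t) q /
        (qPochInf q q * qPochInf (q ^ 3 * s * t) q) *
        ∑' r, revPoch s q r * revPoch t q r * (q ^ 3) ^ r * alphaInner q r /
          (qPoch (q ^ 3 * s) q r * qPoch (q ^ 3 * t) q r)) := by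
  have e3 : q ^ 2 * q = q ^ 3 := by ring
  have n1 := one_sub_q_pow_ne_zero hq 0
  have n2 := one_sub_q_pow_ne_zero hq 1
  set d : ℂ := (1 - q) * (1 - q * q) with hd
  have hd0 : d ≠ 0 := mul_ne_zero (by simpa using n1) (by simpa using n2)
  have hf : ∀ n, qPoch q q (n + 2) = d * qPoch (q ^ 3) q n := fun n => by
    rw [add_comm, qPoch_add, ← pow_succ']; simp [qPoch, prod_range_succ, hd]
  have hinf : qPochInf q q = d * qPochInf (q ^ 3) q := by
    rw [qPochInf_eq_qPoch_mul q hq 2, ← pow_succ']; simp [qPoch, prod_range_succ, hd]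
  have ha : ∀ k : ℕ, 1 - q ^ 3 * q ^ k ≠ 0 := fun k =>
    one_sub_mul_pow_ne_zero hq (by rw [norm_pow]; exact pow_lt_one₀ (norm_nonneg _) hq (by simp)) k
  have H := bailey_lemma (a := q ^ 2) (α := fun r => alphaInner q r * d⁻¹)
    (β := fun n => (qPoch q (q ^ 2) (n + 1))⁻¹) hq0 hq (by rwa [e3]) (by rwa [e3]) (by rwa [e3])
    (by rwa [e3]) (by simpa [norm_mul] using (summable_norm_alphaInner hq0 hq).mul_right ‖d‖⁻¹) (by
      intro n
      rw [e3, ← bailey_pair_innerSum hq0 hq n]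
      refine sum_congr rfl fun r hr => ?_
      have hr' : r ≤ n := by simpa [Nat.lt_succ_iff] using hr
      have c1 : (n : ℤ) - r = (n - r : ℕ) := by omega
      have c2 : (n : ℤ) + r + 2 = (n + r + 2 : ℕ) := by push_cast; ring
      rw [c1, c2, rPoch_natCast, rPoch_natCast, hf, alphaInner]
      rw [div_eq_mul_inv, mul_inv, mul_inv]
      ring)
  rw [e3] at H
  have e4 : ∀ r, revPoch s q r * revPoch t q r * (q ^ 3) ^ r * (alphaInner q r * d⁻¹) /
      (qPoch (q ^ 3 * s) q r * qPoch (q ^ 3 * t) q r) = revPoch s q r * revPoch t q r *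
      (q ^ 3) ^ r * alphaInner q r / (qPoch (q ^ 3 * s) q r * qPoch (q ^ 3 * t) q r) * d⁻¹ :=
    fun r => by ring
  simp only [e4] at H
  refine ⟨(summable_mul_right_iff (inv_ne_zero hd0)).1 H.1, ?_⟩
  convert H.2 using 1
  rw [tsum_mul_right, hinf, mul_assoc d, ← div_div, ← div_div]
  field_simp

/-- At `t = 0`, where the parameter `1/t` is infinite, the factor is a power of `q`. -/
theorem revPoch_zero_left {q : ℂ} (hq0 : q ≠ 0) (n : ℕ) :
    revPoch 0 q n = (-1) ^ n * q ^ choose2 n := by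
  induction n with
  | zero => simp [choose2]
  | succ n ih =>
    rw [revPoch_succ, ih]; push_cast
    rw [choose2_add_one, zpow_add₀ hq0, zpow_natCast]; ring

theorem zpow_two_mul_choose2 (q : ℂ) (n : ℕ) :
    q ^ choose2 (n : ℤ) * q ^ choose2 (n : ℤ) * q ^ n = q ^ (n ^ 2) := by
  by_cases hq0 : q = 0
  · subst hq0
    rcases n with _ | _ | n
    · simp [choose2]
    · simp [choose2]
    · simp
  rw [← zpow_natCast q n, ← zpow_natCast q (n ^ 2), ← zpow_add₀ hq0, ← zpow_add₀ hq0]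
  congr 1
  have := two_mul_choose2 (n : ℤ)
  push_cast
  linarith

@[simp] theorem qPoch_zero_left (q : ℂ) (n : ℕ) : qPoch 0 q n = 1 := by simp [qPoch]

@[simp] theorem qPochInf_zero_left (q : ℂ) : qPochInf 0 q = 1 := by simp [qPochInf]

/-- The choice `s = t = 0`: both parameters of Bailey's lemma infinite. -/
theorem psi_bailey {q : ℂ} (hq0 : q ≠ 0) (hq : ‖q‖ < 1) :
    Summable (psiOuterTerm q) ∧
      HasSum (psiTerm q) (1 / qPochInf q q * ∑' n, psiOuterTerm q n) := by
  have H := bailey_innerSum (s := 0) (t := 0) hq0 hq (by simp) (by simp) (by simp)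
  have e1 : ∀ r, revPoch 0 q r * revPoch 0 q r * (q ^ 3) ^ r = q ^ (r ^ 2 + 2 * r) := fun r => by
    have h : ((-1 : ℂ)) ^ r * (-1) ^ r = 1 := by rw [← mul_pow]; simp
    rw [revPoch_zero_left hq0, pow_add, ← zpow_two_mul_choose2]
    linear_combination (q ^ choose2 (r : ℤ) * q ^ choose2 (r : ℤ) * (q ^ 3) ^ r) * h
  have e2 : ∀ r, q ^ (r ^ 2 + 2 * r) * alphaInner q r = psiOuterTerm q r := fun r => by
    rw [alphaInner, psiOuterTerm]; ring
  simp only [mul_zero, qPoch_zero_left, qPochInf_zero_left, mul_one, div_one, e1, e2] at H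
  refine ⟨H.1, (hasSum_congr' fun n => ?_).2 H.2⟩
  rw [psiTerm, div_eq_mul_inv]

theorem revPoch_inv_mul_pow {q : ℂ} (hq0 : q ≠ 0) (n : ℕ) :
    revPoch q⁻¹ q n * q ^ n = qPoch q q n := by
  rw [revPoch_mul_pow (x := 1) (by field_simp)]; rfl

theorem revPoch_neg_inv_mul_pow {q : ℂ} (hq0 : q ≠ 0) (n : ℕ) :
    revPoch (-q⁻¹) q n * q ^ n = (-1) ^ n * qPoch (-q) q n := by
  rw [revPoch_mul_pow (x := -1) (by field_simp), qPoch]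
  nth_rw 2 [← card_range n]
  rw [← prod_const, ← prod_mul_distrib]
  exact prod_congr rfl fun k _ => by ring

theorem qPoch_mul_one_sub (x q : ℂ) (r : ℕ) :
    qPoch x q r * (1 - x * q ^ r) = (1 - x) * qPoch (x * q) q r := by
  rw [← qPoch_succ, qPoch_succ']

theorem norm_q_pow_lt {q : ℂ} (hq : ‖q‖ < 1) {k : ℕ} (hk : k ≠ 0) : ‖q ^ k‖ < 1 := by
  rw [norm_pow]; exact pow_lt_one₀ (norm_nonneg _) hq hk

/-- The choice `s = 1/q`, `t = 0`, for which `(1/s;q)_n = (q;q)_n`. -/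
theorem false_bailey {q : ℂ} (hq0 : q ≠ 0) (hq : ‖q‖ < 1) :
    Summable (falseOuterTerm q) ∧ HasSum (falseTerm q) (∑' n, falseOuterTerm q n) := by
  have c : q ^ 3 * q⁻¹ = q ^ 2 := by field_simp
  have hc : ‖q ^ 2‖ < 1 := norm_q_pow_lt hq two_ne_zero
  have H := bailey_innerSum (s := q⁻¹) (t := 0) hq0 hq (by simp) (by rwa [c]) (by simp)
  have n1 : 1 - q ≠ 0 := one_sub_ne_zero_of_norm_lt hq
  have e1 : ∀ r : ℕ, q ^ (r * (r + 3) / 2) = q ^ choose2 (r : ℤ) * q ^ r * q ^ r := fun r => by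
    rw [pow_half_eq_zpow q (z := choose2 r + r + r) (by
      have := two_mul_choose2 (r : ℤ); push_cast; linarith), zpow_add₀ hq0, zpow_add₀ hq0,
      zpow_natCast]
  have e2 : ∀ r : ℕ, q ^ ((3 * r ^ 2 + 5 * r) / 2) =
      q ^ choose2 (r : ℤ) * q ^ r * q ^ r * q ^ (r ^ 2 + r) := fun r => by
    rw [pow_half_eq_zpow q (z := choose2 r + r + r + (r ^ 2 + r : ℕ)) (by
      have := two_mul_choose2 (r : ℤ); push_cast; linarith), zpow_add₀ hq0, zpow_add₀ hq0,
      zpow_add₀ hq0, zpow_natCast, zpow_natCast]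
  have e3 : ∀ r, revPoch q⁻¹ q r * revPoch 0 q r * (q ^ 3) ^ r =
      (-1) ^ r * q ^ (r * (r + 3) / 2) * qPoch q q r := fun r => by
    rw [← revPoch_inv_mul_pow hq0, revPoch_zero_left hq0, e1, ← pow_mul, mul_comm 3 r, pow_mul]
    ring
  have e4 : ∀ r, revPoch q⁻¹ q r * revPoch 0 q r * (q ^ 3) ^ r * alphaInner q r /
      (qPoch (q ^ 2) q r * qPoch 0 q r) = (1 - q) * falseOuterTerm q r := fun r => by
    have h1 := qPoch_mul_one_sub q q r
    rw [← sq] at h1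
    have h2 := qPoch_ne_zero (one_sub_mul_pow_ne_zero hq hc) r
    have h3 : ((-1 : ℂ)) ^ r * (-1) ^ r = 1 := by rw [← mul_pow]; simp
    rw [e3, qPoch_zero_left, mul_one, div_eq_iff h2, alphaInner, falseOuterTerm, e1, e2]
    have c1 : q ^ (2 * r + 2) = (q * q ^ r) ^ 2 := by ring
    rw [c1, pow_succ' q r]
    generalize q ^ (r ^ 2 + r) = w
    generalize q ^ choose2 (r : ℤ) = u
    linear_combination (u * q ^ r * q ^ r * w * innerSum q r * (1 + q * q ^ r) *
      qPoch q q r * (1 - q * q ^ r)) * h3 +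
      (u * q ^ r * q ^ r * w * innerSum q r * (1 + q * q ^ r)) * h1
  have n2 : qPochInf q q = (1 - q) * qPochInf (q ^ 2) q := by
    rw [qPochInf_eq_mul q hq, ← sq]
  have n3 := qPochInf_ne_zero hq (one_sub_mul_pow_ne_zero hq hc)
  simp only [mul_zero, c, e4, qPochInf_zero_left, mul_one] at H
  refine ⟨(summable_mul_left_iff n1).1 H.1, ?_⟩
  have H2 := H.2
  rw [tsum_mul_left, n2, ← mul_assoc, show qPochInf (q ^ 2) q / ((1 - q) * qPochInf (q ^ 2) q) *
    (1 - q) = 1 by field_simp, one_mul] at H2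
  refine (hasSum_congr' fun n => ?_).2 H2
  rw [e3, falseTerm, div_eq_mul_inv]

/-- The choice `s = -1/q`, `t = 0`, for which `(1/s;q)_n = (-q;q)_n`. -/
theorem sigma_bailey {q : ℂ} (hq0 : q ≠ 0) (hq : ‖q‖ < 1) :
    Summable (sigmaOuterTerm q) ∧
      HasSum (sigmaTerm q) (qPochInf (-q) q / qPochInf q q * ∑' n, sigmaOuterTerm q n) := by
  have c : q ^ 3 * -q⁻¹ = -q ^ 2 := by field_simp
  have hc : ‖-q ^ 2‖ < 1 := by rw [norm_neg]; exact norm_q_pow_lt hq two_ne_zero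
  have H := bailey_innerSum (s := -q⁻¹) (t := 0) hq0 hq (by simp) (by rwa [c]) (by simp)
  have n1 : 1 - -q ≠ 0 := one_sub_ne_zero_of_norm_lt (by rwa [norm_neg])
  have e1 : ∀ r : ℕ, q ^ ((r ^ 2 + 3 * r) / 2) = q ^ choose2 (r : ℤ) * q ^ r * q ^ r := fun r => by
    rw [pow_half_eq_zpow q (z := choose2 r + r + r) (by
      have := two_mul_choose2 (r : ℤ); push_cast; linarith), zpow_add₀ hq0, zpow_add₀ hq0,
      zpow_natCast]
  have e2 : ∀ r : ℕ, q ^ ((3 * r ^ 2 + 5 * r) / 2) =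
      q ^ choose2 (r : ℤ) * q ^ r * q ^ r * q ^ (r ^ 2 + r) := fun r => by
    rw [pow_half_eq_zpow q (z := choose2 r + r + r + (r ^ 2 + r : ℕ)) (by
      have := two_mul_choose2 (r : ℤ); push_cast; linarith), zpow_add₀ hq0, zpow_add₀ hq0,
      zpow_add₀ hq0, zpow_natCast, zpow_natCast]
  have h3 : ∀ r : ℕ, ((-1 : ℂ)) ^ r * (-1) ^ r = 1 := fun r => by rw [← mul_pow]; simp
  have e3 : ∀ r, revPoch (-q⁻¹) q r * revPoch 0 q r * (q ^ 3) ^ r =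
      q ^ ((r ^ 2 + 3 * r) / 2) * qPoch (-q) q r := fun r => by
    rw [show revPoch (-q⁻¹) q r * revPoch 0 q r * (q ^ 3) ^ r =
      revPoch (-q⁻¹) q r * q ^ r * revPoch 0 q r * q ^ r * q ^ r by
        rw [← pow_mul, mul_comm 3 r, pow_mul]; ring,
      revPoch_neg_inv_mul_pow hq0, revPoch_zero_left hq0, e1]
    linear_combination (qPoch (-q) q r * q ^ choose2 (r : ℤ) * q ^ r * q ^ r) * h3 r
  have e4 : ∀ r, revPoch (-q⁻¹) q r * revPoch 0 q r * (q ^ 3) ^ r * alphaInner q r /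
      (qPoch (-q ^ 2) q r * qPoch 0 q r) = (1 - -q) * sigmaOuterTerm q r := fun r => by
    have h1 := qPoch_mul_one_sub (-q) q r
    rw [show -q * q = -q ^ 2 by ring] at h1
    have h2 := qPoch_ne_zero (one_sub_mul_pow_ne_zero hq hc) r
    rw [e3, qPoch_zero_left, mul_one, div_eq_iff h2, alphaInner, sigmaOuterTerm, e1, e2]
    have c1 : q ^ (2 * r + 2) = (q * q ^ r) ^ 2 := by ring
    rw [c1, pow_succ' q r]
    generalize q ^ (r ^ 2 + r) = w
    generalize q ^ choose2 (r : ℤ) = u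
    linear_combination ((-1) ^ r * u * q ^ r * q ^ r * w * innerSum q r * (1 - q * q ^ r)) * h1
  have n2 : qPochInf (-q) q = (1 - -q) * qPochInf (-q ^ 2) q := by
    rw [qPochInf_eq_mul (-q) hq, show -q * q = -q ^ 2 by ring]
  have n3 := qPochInf_ne_zero hq (one_sub_mul_pow_ne_zero hq hc)
  simp only [mul_zero, c, e4, qPochInf_zero_left, mul_one] at H
  refine ⟨(summable_mul_left_iff n1).1 H.1, ?_⟩
  have H2 := H.2
  rw [tsum_mul_left, ← mul_assoc, show qPochInf (-q ^ 2) q / qPochInf q q * (1 - -q) =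
    qPochInf (-q) q / qPochInf q q by rw [n2]; ring] at H2
  refine (hasSum_congr' fun n => ?_).2 H2
  rw [e3, sigmaTerm, div_eq_mul_inv]

theorem qPoch_mul_qPoch_neg (x q : ℂ) (n : ℕ) :
    qPoch x q n * qPoch (-x) q n = qPoch (x ^ 2) (q ^ 2) n := by
  simp only [qPoch, ← prod_mul_distrib]
  exact prod_congr rfl fun k _ => by ring

theorem qPochInf_mul_qPochInf_neg (x : ℂ) {q : ℂ} (hq : ‖q‖ < 1) :
    qPochInf x q * qPochInf (-x) q = qPochInf (x ^ 2) (q ^ 2) := by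
  refine tendsto_nhds_unique ((tendsto_qPoch x hq).mul (tendsto_qPoch (-x) hq)) ?_
  simp only [qPoch_mul_qPoch_neg]
  exact tendsto_qPoch _ (norm_q_pow_lt hq two_ne_zero)

/-- The choice `s = 1/(iq)`, `t = -s`, for which `(1/s;q)_n (1/t;q)_n = (-q^2;q^2)_n`. -/
theorem A2_bailey {q : ℂ} (hq0 : q ≠ 0) (hq : ‖q‖ < 1) :
    Summable (A2OuterTerm q) ∧ HasSum (A2Term q)
      (q * (qPochInf (-q ^ 2) (q ^ 2) / qPochInf q q ^ 2) * ∑' n, A2OuterTerm q n) := by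
  have hI := Complex.I_ne_zero
  have hI2 := Complex.I_sq
  have hI3 : Complex.I⁻¹ ^ 2 = -1 := by rw [inv_pow, hI2]; norm_num
  set s : ℂ := Complex.I⁻¹ * q⁻¹ with hs
  have hs2 : s ^ 2 = -(q ^ 2)⁻¹ := by rw [hs, mul_pow, hI3]; simp
  have c1 : q ^ 3 * s * -s = q := by
    rw [show q ^ 3 * s * -s = -(q ^ 3 * s ^ 2) by ring, hs2]; field_simp
  have c2 : ‖q ^ 3 * s‖ < 1 := by
    rw [show q ^ 3 * s = Complex.I⁻¹ * q ^ 2 by rw [hs]; field_simp, norm_mul, norm_inv,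
      Complex.norm_I, inv_one, one_mul]
    exact norm_q_pow_lt hq two_ne_zero
  have c3 : q ^ 3 * -s = -(q ^ 3 * s) := by ring
  have c4 : (q ^ 3 * s) ^ 2 = -q ^ 2 * q ^ 2 := by rw [mul_pow, hs2]; field_simp
  have H := bailey_innerSum (s := s) (t := -s) hq0 hq (by rwa [c1]) c2 (by rwa [c3, norm_neg])
  have hq2 : ‖q ^ 2‖ < 1 := norm_q_pow_lt hq two_ne_zero
  have hc : ‖-q ^ 2‖ < 1 := by rwa [norm_neg]
  have hc' : ‖-q ^ 2 * q ^ 2‖ < 1 := by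
    rw [norm_mul]; exact mul_lt_one_of_nonneg_of_lt_one_left (norm_nonneg _) hc hq2.le
  have n1 : 1 - -q ^ 2 ≠ 0 := one_sub_ne_zero_of_norm_lt hc
  have e3 : ∀ r, revPoch s q r * revPoch (-s) q r * (q ^ 3) ^ r =
      q ^ r * qPoch (-q ^ 2) (q ^ 2) r := fun r => by
    have : revPoch s q r * revPoch (-s) q r * (q ^ 2) ^ r = qPoch (-q ^ 2) (q ^ 2) r := by
      simp only [revPoch, qPoch]
      rw [← prod_mul_distrib]
      nth_rw 2 [← card_range r]
      rw [← prod_const, ← prod_mul_distrib]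
      refine prod_congr rfl fun k _ => ?_
      rw [show (s - q ^ k) * (-s - q ^ k) * q ^ 2 = (q ^ k * q ^ k - s ^ 2) * q ^ 2 by ring, hs2]
      field_simp
      ring
    rw [← this]
    ring
  have e4 : ∀ r, revPoch s q r * revPoch (-s) q r * (q ^ 3) ^ r * alphaInner q r /
      (qPoch (q ^ 3 * s) q r * qPoch (q ^ 3 * -s) q r) =
        (1 - -q ^ 2) * A2OuterTerm q r := fun r => by
    have h1 := qPoch_mul_one_sub (-q ^ 2) (q ^ 2) r
    have h2 := qPoch_ne_zero (one_sub_mul_pow_ne_zero hq2 hc') r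
    have h4 : 1 + q ^ (2 * r + 2) ≠ 0 := by
      have := one_sub_mul_pow_ne_zero hq2 hc r
      intro h0
      refine this ?_
      rw [← h0]; ring
    rw [e3, c3, qPoch_mul_qPoch_neg, c4, div_eq_iff h2, alphaInner, A2OuterTerm]
    have c1 : q ^ (2 * r + 2) = q ^ 2 * (q ^ 2) ^ r := by ring
    rw [c1] at h4 ⊢
    have c5 : q ^ (r ^ 2 + 2 * r) = q ^ (r ^ 2 + r) * q ^ r := by ring
    rw [c5]
    generalize q ^ (r ^ 2 + r) = w
    generalize (q ^ 2) ^ r = v at *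
    rw [mul_assoc (1 - -q ^ 2), div_mul_eq_mul_div, div_mul_eq_mul_div, div_mul_eq_mul_div,
      div_mul_eq_mul_div, mul_div_assoc', eq_div_iff h4]
    linear_combination ((-1) ^ r * q ^ r * w * innerSum q r * (1 - q ^ 2 * v)) * h1
  have n2 : qPochInf (-q ^ 2) (q ^ 2) = (1 - -q ^ 2) * qPochInf (-q ^ 2 * q ^ 2) (q ^ 2) :=
    qPochInf_eq_mul _ hq2
  simp only [c1, e4] at H
  refine ⟨(summable_mul_left_iff n1).1 H.1, ?_⟩
  have H2 := H.2.mul_left q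
  rw [tsum_mul_left, c3, qPochInf_mul_qPochInf_neg _ hq, c4, ← mul_assoc, ← mul_assoc,
    show q * (qPochInf (-q ^ 2 * q ^ 2) (q ^ 2) / (qPochInf q q * qPochInf q q)) * (1 - -q ^ 2) =
    q * (qPochInf (-q ^ 2) (q ^ 2) / qPochInf q q ^ 2) by rw [n2]; ring] at H2
  refine (hasSum_congr' fun n => ?_).2 H2
  rw [e3, A2Term, div_eq_mul_inv]
  ring

/-! ### Sums over cones and the change of the theta parameter in `m(x,q,z)` -/

/-- The weight `(sg r + sg s) / 2` of a pair of integers: it is `sg r` if the signs agree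
and `0` otherwise.  Being a sum of a function of `r` and a function of `s`, it turns identities
between indefinite theta series into identities between their weights. -/
noncomputable def coneWt (r s : ℤ) : ℂ := (sg r + sg s) / 2

theorem sg_of_nonneg {r : ℤ} (h : 0 ≤ r) : sg r = 1 := by simp [sg, h]

theorem sg_of_neg {r : ℤ} (h : r < 0) : sg r = -1 := by simp [sg, h]

theorem sg_neg_sub_one (r : ℤ) : sg (-r - 1) = -sg r := by
  unfold sg; split_ifs <;> omega

theorem ne_zpow_of_norm {q b : ℂ} (hb1 : ‖q‖ < ‖b‖) (hb2 : ‖b‖ < 1) (k : ℤ) : b ≠ q ^ k := by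
  rintro rfl
  rw [norm_zpow] at hb1 hb2
  rcases eq_or_ne q 0 with rfl | hq0
  · rcases eq_or_ne k 0 with rfl | hk
    · simp at hb2
    · simp [zero_zpow _ hk] at hb1
  have h0 : 0 < ‖q‖ := norm_pos_iff.2 hq0
  have h1 : ‖q‖ < 1 := hb1.trans hb2
  have k1 : 0 < k := by
    by_contra hk
    exact absurd hb2 (not_lt.2 (one_le_zpow_of_nonpos₀ h0 h1.le (not_lt.1 hk)))
  have : ‖q‖ ^ k ≤ ‖q‖ ^ (1 : ℤ) := zpow_le_zpow_right_of_le_one₀ h0 h1.le (by omega)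
  rw [zpow_one] at this
  exact absurd hb1 (not_lt.2 this)

/-- Both one-sided expansions of `1 / (1 - Y)` as a weighted two-sided geometric series. -/
theorem hasSum_coneWt_geometric {Y : ℂ} {r : ℤ} (hY0 : Y ≠ 0) (h1 : 0 ≤ r → ‖Y‖ < 1)
    (h2 : r < 0 → 1 < ‖Y‖) :
    HasSum (fun k : ℤ => coneWt r k * Y ^ k) (1 - Y)⁻¹ ∧
    HasSum (fun k : ℤ => ‖coneWt r k * Y ^ k‖) |1 - ‖Y‖|⁻¹ := by
  have hk : ∀ n : ℕ, sg (-((n : ℤ) + 1)) = -1 := fun n => sg_of_neg (by omega)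
  have hk' : ∀ n : ℕ, sg (n : ℤ) = 1 := fun n => sg_of_nonneg (by omega)
  rcases lt_or_ge r 0 with hr | hr
  · have hY := h2 hr
    have hYi : ‖Y⁻¹‖ < 1 := by rw [norm_inv]; exact inv_lt_one_of_one_lt₀ hY
    have w1 : ∀ n : ℕ, coneWt r n = 0 := fun n => by simp [coneWt, sg_of_neg hr, hk']
    have w2 : ∀ n : ℕ, coneWt r (-((n : ℤ) + 1)) = -1 := fun n => by
      rw [coneWt, sg_of_neg hr, hk]; norm_num
    have hY1 : Y - 1 ≠ 0 := by
      intro h0; rw [sub_eq_zero] at h0; rw [h0] at hY; simp at hY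
    constructor
    · have e : (1 - Y)⁻¹ = 0 + -Y⁻¹ * (1 - Y⁻¹)⁻¹ := by
        have : 1 - Y ≠ 0 := by rw [← neg_sub]; exact neg_ne_zero.2 hY1
        field_simp
        ring
      rw [e]
      refine HasSum.of_nat_of_neg_add_one ?_ ?_
      · simpa only [w1, zero_mul] using hasSum_zero (α := ℂ) (β := ℕ)
      · refine (hasSum_congr' fun n => ?_).2
          ((hasSum_geometric_of_norm_lt_one hYi).mul_left (-Y⁻¹))
        rw [w2, zpow_neg, zpow_add_one₀ hY0, zpow_natCast, inv_pow, mul_inv]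
        ring
    · have e : |1 - ‖Y‖|⁻¹ = 0 + ‖Y‖⁻¹ * (1 - ‖Y‖⁻¹)⁻¹ := by
        have : ‖Y‖ ≠ 0 := by simpa using hY0
        have h1' : ‖Y‖ - 1 ≠ 0 := by linarith
        have h2' : -(1 - ‖Y‖) ≠ 0 := by linarith
        rw [abs_of_neg (by linarith), zero_add, ← mul_inv, mul_sub, mul_one, mul_inv_cancel₀ this,
          neg_sub]
      rw [e]
      refine HasSum.of_nat_of_neg_add_one ?_ ?_
      · simpa only [w1, zero_mul, norm_zero] using hasSum_zero (α := ℝ) (β := ℕ)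
      · have := (hasSum_geometric_of_lt_one (r := ‖Y‖⁻¹) (by positivity)
          (by rwa [norm_inv] at hYi)).mul_left
          (‖Y‖⁻¹)
        have e2 : (fun n : ℕ => ‖coneWt r (-((n : ℤ) + 1)) * Y ^ (-((n : ℤ) + 1))‖) =
            fun n => ‖Y‖⁻¹ * ‖Y‖⁻¹ ^ n := by
          funext n
          rw [w2, zpow_neg, zpow_add_one₀ hY0, zpow_natCast]
          simp [mul_comm]
        rwa [e2]
  · have hY := h1 hr
    have w1 : ∀ n : ℕ, coneWt r n = 1 := fun n => by simp [coneWt, sg_of_nonneg hr, hk']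
    have w2 : ∀ n : ℕ, coneWt r (-((n : ℤ) + 1)) = 0 := fun n => by
      rw [coneWt, sg_of_nonneg hr, hk]; norm_num
    constructor
    · rw [← add_zero (1 - Y)⁻¹]
      refine HasSum.of_nat_of_neg_add_one ?_ ?_
      · simpa [w1] using hasSum_geometric_of_norm_lt_one hY
      · simpa only [w2, zero_mul] using hasSum_zero (α := ℂ) (β := ℕ)
    · rw [← add_zero |1 - ‖Y‖|⁻¹, abs_of_pos (by linarith)]
      refine HasSum.of_nat_of_neg_add_one ?_ ?_
      · simpa [w1] using hasSum_geometric_of_lt_one (norm_nonneg _) hY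
      · simpa only [w2, zero_mul, norm_zero] using hasSum_zero (α := ℝ) (β := ℕ)

/-- A Lambert type series over `ℤ` as a double series over the cone `sg r = sg k`. -/
theorem hasSum_cone {q X : ℂ} (hq0 : q ≠ 0) (hX1 : ‖q‖ < ‖X‖) (hX2 : ‖X‖ < 1) {c : ℤ → ℂ}
    (hc : Summable fun r => c r / (1 - X * q ^ r)) :
    HasSum (fun p : ℤ × ℤ => coneWt p.1 p.2 * (c p.1 * X ^ p.2 * q ^ (p.1 * p.2)))
      (∑' r, c r / (1 - X * q ^ r)) := by
  have hX0 : X ≠ 0 := norm_pos_iff.1 ((norm_nonneg q).trans_lt hX1)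
  have hqn : 0 < ‖q‖ := norm_pos_iff.2 hq0
  have hq1 : ‖q‖ < 1 := hX1.trans hX2
  have hY0 : ∀ r : ℤ, X * q ^ r ≠ 0 := fun r => mul_ne_zero hX0 (zpow_ne_zero _ hq0)
  have h1 : ∀ r : ℤ, 0 ≤ r → ‖X * q ^ r‖ ≤ ‖X‖ := fun r hr => by
    rw [norm_mul, norm_zpow]
    exact mul_le_of_le_one_right (norm_nonneg _) (zpow_le_one₀ hqn hq1.le hr)
  have h2 : ∀ r : ℤ, r < 0 → ‖X‖ / ‖q‖ ≤ ‖X * q ^ r‖ := fun r hr => by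
    rw [norm_mul, norm_zpow, div_eq_mul_inv, ← zpow_neg_one]
    exact mul_le_mul_of_nonneg_left
      (zpow_le_zpow_right_of_le_one₀ hqn hq1.le (by omega)) (norm_nonneg _)
  have hL : 1 < ‖X‖ / ‖q‖ := (one_lt_div hqn).2 hX1
  have hg := fun r : ℤ => hasSum_coneWt_geometric (r := r) (hY0 r)
    (fun h => (h1 r h).trans_lt hX2) (fun h => hL.trans_le (h2 r h))
  have ee : ∀ r k : ℤ, coneWt r k * (c r * X ^ k * q ^ (r * k)) =
      c r * (coneWt r k * (X * q ^ r) ^ k) := fun r k => by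
    rw [mul_zpow, ← zpow_mul]; ring
  have hrow : ∀ r : ℤ, HasSum (fun k => coneWt r k * (c r * X ^ k * q ^ (r * k)))
      (c r / (1 - X * q ^ r)) := fun r => by
    rw [div_eq_mul_inv]
    exact (hasSum_congr' fun k => ee r k).2 ((hg r).1.mul_left _)
  have hs : Summable fun p : ℤ × ℤ => coneWt p.1 p.2 * (c p.1 * X ^ p.2 * q ^ (p.1 * p.2)) := by
    refine Summable.of_norm ?_
    have hrown : ∀ r : ℤ, HasSum (fun k => ‖coneWt r k * (c r * X ^ k * q ^ (r * k))‖)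
        (‖c r‖ * |1 - ‖X * q ^ r‖|⁻¹) := fun r => by
      have e : (fun k => ‖coneWt r k * (c r * X ^ k * q ^ (r * k))‖) =
          fun k => ‖c r‖ * ‖coneWt r k * (X * q ^ r) ^ k‖ := by
        funext k; rw [ee, norm_mul]
      rw [e]
      exact (hg r).2.mul_left _
    rw [summable_prod_of_nonneg fun p => norm_nonneg _]
    refine ⟨fun r => (hrown r).summable, ?_⟩
    -- The series of absolute values of row `r` is `‖c r‖ / |1 - ‖X q^r‖|`. As `‖X q^r‖` stays away
    -- from `1`, this is at most a constant multiple of `‖c r / (1 - X q^r)‖`.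
    set K : ℝ := 2 / (1 - ‖X‖) + (1 + 2 / (‖X‖ / ‖q‖ - 1)) with hK
    have a1 : 0 < 1 - ‖X‖ := by linarith
    have a2 : 0 < ‖X‖ / ‖q‖ - 1 := by linarith
    have hb : ∀ r : ℤ, ‖c r‖ * |1 - ‖X * q ^ r‖|⁻¹ ≤ K * ‖c r / (1 - X * q ^ r)‖ := fun r => by
      have b3 : ‖1 - X * q ^ r‖ ≤ 1 + ‖X * q ^ r‖ := by
        simpa using norm_sub_le 1 (X * q ^ r)
      have key : 0 < |1 - ‖X * q ^ r‖| ∧ 1 + ‖X * q ^ r‖ ≤ K * |1 - ‖X * q ^ r‖| := by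
        set y := ‖X * q ^ r‖
        have t1 : 0 < 2 / (1 - ‖X‖) := by positivity
        have t2 : 0 < 2 / (‖X‖ / ‖q‖ - 1) := by positivity
        rcases lt_or_ge r 0 with hr | hr
        · have hy : ‖X‖ / ‖q‖ ≤ y := h2 r hr
          rw [abs_of_neg (by linarith)]
          refine ⟨by linarith, ?_⟩
          have e1 : 2 ≤ 2 / (‖X‖ / ‖q‖ - 1) * (y - 1) := by
            rw [div_mul_eq_mul_div, le_div_iff₀ a2]; linarith
          have e2 : 0 ≤ 2 / (1 - ‖X‖) * (y - 1) := mul_nonneg t1.le (by linarith)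
          rw [hK]; linarith
        · have hy : y ≤ ‖X‖ := h1 r hr
          rw [abs_of_pos (by linarith)]
          refine ⟨by linarith, ?_⟩
          have e1 : 2 ≤ 2 / (1 - ‖X‖) * (1 - y) := by
            rw [div_mul_eq_mul_div, le_div_iff₀ a1]; linarith
          have e2 : 0 ≤ (1 + 2 / (‖X‖ / ‖q‖ - 1)) * (1 - y) :=
            mul_nonneg (by linarith) (by linarith)
          rw [hK]; linarith
      have hne : 0 < ‖1 - X * q ^ r‖ := norm_pos_iff.2 (by
        intro h0
        rw [sub_eq_zero] at h0
        have := key.1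
        rw [← h0] at this
        simp at this)
      rw [norm_div, ← div_eq_mul_inv, mul_div_assoc', div_le_div_iff₀ key.1 hne]
      calc ‖c r‖ * ‖1 - X * q ^ r‖ ≤ ‖c r‖ * (K * |1 - ‖X * q ^ r‖|) :=
            mul_le_mul_of_nonneg_left (b3.trans key.2) (norm_nonneg _)
        _ = _ := by ring
    have hrt : ∀ r : ℤ, ∑' k, ‖coneWt r k * (c r * X ^ k * q ^ (r * k))‖ =
        ‖c r‖ * |1 - ‖X * q ^ r‖|⁻¹ := fun r => (hrown r).tsum_eq
    refine Summable.of_nonneg_of_le (fun r => tsum_nonneg fun k => norm_nonneg _)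
      (fun r => (hrt r).le.trans (hb r)) (hc.norm.mul_left K)
  have h3 := hs.hasSum.prod_fiberwise hrow
  rw [h3.tsum_eq]
  exact hs.hasSum

/-- Kronecker's identity as a double sum over the cone `sg r = sg s`. -/
theorem hasSum_cone_kronecker {q a b : ℂ} (hq0 : q ≠ 0) (ha1 : ‖q‖ < ‖a‖) (ha2 : ‖a‖ < 1)
    (hb1 : ‖q‖ < ‖b‖) (hb2 : ‖b‖ < 1) :
    HasSum (fun p : ℤ × ℤ => coneWt p.1 p.2 * (a ^ p.1 * b ^ p.2 * q ^ (p.1 * p.2)))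
      (qPochInf q q ^ 3 * jTheta (a * b) q / (jTheta a q * jTheta b q)) := by
  have hb0 : b ≠ 0 := norm_pos_iff.1 ((norm_nonneg q).trans_lt hb1)
  have h := hasSum_kronecker hq0 ha1 ha2 hb0 (ne_zpow_of_norm hb1 hb2)
  rw [← h.tsum_eq]
  exact hasSum_cone hq0 hb1 hb2 h.summable

theorem summable_appellTerm {q x z : ℂ} (hq0 : q ≠ 0) (hq : ‖q‖ < 1) (hx : x ≠ 0) (hz : z ≠ 0) :
    Summable (appellTerm x q z) := by
  have h1 := summable_norm_theta hq0 hq hz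
  have h2 : Summable fun r : ℤ => ‖(-1) ^ r * q ^ choose2 r * z ^ r‖ := by
    simpa [mul_assoc] using h1
  have h := summable_norm_div_one_sub (c := fun r => (-1) ^ r * q ^ choose2 r * z ^ r)
    (b := q⁻¹ * x * z) hq0 hq (by simp [hq0, hx, hz])
    (h2.comp_injective (Nat.cast_injective (R := ℤ))) (by
      refine Summable.of_nonneg_of_le (fun _ => norm_nonneg _) (fun n => ?_)
        (h2.comp_injective (i := fun n : ℕ => -((n : ℤ) + 1)) (fun a b h => by
          simp only at h; omega))
      rw [norm_mul, norm_pow]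
      exact mul_le_of_le_one_right (norm_nonneg _) (pow_le_one₀ (norm_nonneg _) hq.le))
  refine (Summable.of_norm h).congr fun r => ?_
  rw [appellTerm, zpow_sub_one₀ hq0]
  ring_nf

/-- The Appell-Lerch series as a double sum over a cone, with the summation index of `appellTerm`
lowered by one so that its denominator is `1 - xz q^r`. -/
theorem hasSum_cone_appell {q x z : ℂ} (hq0 : q ≠ 0) (h1 : ‖q‖ < ‖x * z‖) (h2 : ‖x * z‖ < 1) :
    HasSum (fun p : ℤ × ℤ => coneWt p.1 p.2 * ((-1) ^ (p.1 + 1) * q ^ choose2 (p.1 + 1) *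
      z ^ (p.1 + 1) * (x * z) ^ p.2 * q ^ (p.1 * p.2))) (∑' r, appellTerm x q z r) := by
  have h0 : x * z ≠ 0 := norm_pos_iff.1 ((norm_nonneg q).trans_lt h1)
  have hs := summable_appellTerm hq0 (h1.trans h2) (left_ne_zero_of_mul h0)
    (right_ne_zero_of_mul h0)
  have e : ∀ r : ℤ, (-1) ^ (r + 1) * q ^ choose2 (r + 1) * z ^ (r + 1) / (1 - x * z * q ^ r) =
      appellTerm x q z (Equiv.addRight 1 r) := fun r => by
    simp only [appellTerm, Equiv.coe_addRight, add_sub_cancel_right]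
    ring_nf
  have hs2 := ((Equiv.addRight (1 : ℤ)).summable_iff.2 hs)
  have h3 := hasSum_cone (c := fun r => (-1) ^ (r + 1) * q ^ choose2 (r + 1) * z ^ (r + 1))
    hq0 h1 h2 (hs2.congr fun r => (e r).symm)
  simp only [e] at h3
  rwa [(Equiv.addRight (1 : ℤ)).tsum_eq (appellTerm x q z)] at h3

theorem hasSum_mul_complex {ι κ : Type*} {f : ι → ℂ} {g : κ → ℂ} {a b : ℂ} (hf : HasSum f a)
    (hg : HasSum g b) : HasSum (fun p : ι × κ => f p.1 * g p.2) (a * b) :=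
  hf.mul hg (summable_mul_of_summable_norm hf.summable.norm hg.summable.norm)

theorem neg_one_zpow_two_mul (k : ℤ) : (-1 : ℂ) ^ (2 * k) = 1 := by
  rw [zpow_mul]; norm_num

/-- The dependence of the Appell-Lerch series on its theta parameter, in a form without
denominators `j(z;q)`. -/
theorem appell_change_z {q x z₀ z₁ : ℂ} (hq0 : q ≠ 0) (h1 : ‖q‖ < ‖x * z₀‖) (h2 : ‖x * z₀‖ < 1)
    (h3 : ‖q‖ < ‖x * z₁‖) (h4 : ‖x * z₁‖ < 1) :
    jTheta z₀ q * ∑' r, appellTerm x q z₁ r - jTheta z₁ q * ∑' r, appellTerm x q z₀ r =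
      z₀ * (qPochInf q q ^ 3 * jTheta (z₁ / z₀) q / (jTheta (x * z₀) q * jTheta (x * z₁) q)) *
        jTheta (x * z₀ * z₁) q := by
  have hq := h1.trans h2
  have n0 : x * z₀ ≠ 0 := norm_pos_iff.1 ((norm_nonneg q).trans_lt h1)
  have n1 : x * z₁ ≠ 0 := norm_pos_iff.1 ((norm_nonneg q).trans_lt h3)
  have hx := left_ne_zero_of_mul n0
  have hz0 := right_ne_zero_of_mul n0
  have hz1 := right_ne_zero_of_mul n1
  have hm1 : (-1 : ℂ) ≠ 0 := by norm_num
  have hqn : 0 < ‖q‖ := norm_pos_iff.2 hq0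
  have hp1 : 0 < ‖x * z₁‖ := norm_pos_iff.2 n1
  -- Each of the three products is a series over `ℤ³`, and suitable substitutions give all of them
  -- the same general term `±T (r, s, t)`, up to the weights `coneWt r s`, `coneWt (-r - 1) k` and
  -- `coneWt s k` with `k = r - s + t`.
  set T : ℤ × ℤ × ℤ → ℂ := fun p => (-1) ^ p.2.2 * x ^ (p.1 - p.2.1 + p.2.2) *
    z₀ ^ (p.1 + p.2.2 + 1) * z₁ ^ (p.2.2 - p.2.1) * q ^ ((p.1 + 1) * p.2.1 + choose2 p.2.2) with hT
  have H1 := hasSum_mul_complex (hasSum_cone_kronecker hq0 h1 h2 (b := q / (x * z₁))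
    (by rw [norm_div, lt_div_iff₀ hp1]; exact mul_lt_of_lt_one_right hqn h4)
    (by rw [norm_div, div_lt_one hp1]; exact h3))
    (hasSum_jTheta hq0 hq (x := x * z₀ * z₁) (mul_ne_zero n0 hz1))
  have H2 := hasSum_mul_complex (hasSum_cone_appell hq0 h3 h4) (hasSum_jTheta hq0 hq hz0)
  have H3 := hasSum_mul_complex (hasSum_cone_appell hq0 h1 h2) (hasSum_jTheta hq0 hq hz1)
  let e1 : ℤ × ℤ × ℤ ≃ (ℤ × ℤ) × ℤ := (Equiv.prodAssoc ℤ ℤ ℤ).symm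
  let e2 : ℤ × ℤ × ℤ ≃ (ℤ × ℤ) × ℤ :=
    { toFun := fun p => ((-p.1 - 1, p.1 - p.2.1 + p.2.2), p.1 + p.2.2 + 1)
      invFun := fun p => (-p.1.1 - 1, p.2 - 1 - p.1.2, p.2 + p.1.1)
      left_inv := fun p => by ext <;> simp
      right_inv := fun p => by ext <;> simp <;> try ring }
  let e3 : ℤ × ℤ × ℤ ≃ (ℤ × ℤ) × ℤ :=
    { toFun := fun p => ((p.2.1, p.1 - p.2.1 + p.2.2), p.2.2 - p.2.1)
      invFun := fun p => (p.1.2 - p.2, p.1.1, p.2 + p.1.1)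
      left_inv := fun p => by ext <;> simp; ring
      right_inv := fun p => by ext <;> simp }
  have H1' := (e1.hasSum_iff.2 H1).mul_left z₀
  have H2' := (e2.hasSum_iff.2 H2)
  have H3' := (e3.hasSum_iff.2 H3)
  have f1 : ∀ p, z₀ * ((fun p : (ℤ × ℤ) × ℤ => coneWt p.1.1 p.1.2 * ((x * z₀) ^ p.1.1 *
      (q / (x * z₁)) ^ p.1.2 * q ^ (p.1.1 * p.1.2)) * ((-1) ^ p.2 * q ^ choose2 p.2 *
      (x * z₀ * z₁) ^ p.2)) ∘ e1) p = coneWt p.1 p.2.1 * T p := by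
    rintro ⟨r, s, t⟩
    simp only [Function.comp, e1, hT, Equiv.prodAssoc_symm_apply]
    rw [show (r + 1) * s + choose2 t = s + r * s + choose2 t by ring]
    simp only [mul_zpow, div_zpow, zpow_add₀ hq0, zpow_add₀ hx, zpow_add₀ hz0, zpow_sub₀ hx,
      zpow_sub₀ hz1, zpow_one]
    have := zpow_ne_zero s hx
    have := zpow_ne_zero s hz1
    field_simp
  have f2 : ∀ p, ((fun p : (ℤ × ℤ) × ℤ => coneWt p.1.1 p.1.2 * ((-1) ^ (p.1.1 + 1) *
      q ^ choose2 (p.1.1 + 1) * z₁ ^ (p.1.1 + 1) * (x * z₁) ^ p.1.2 * q ^ (p.1.1 * p.1.2)) *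
      ((-1) ^ p.2 * q ^ choose2 p.2 * z₀ ^ p.2)) ∘ e2) p =
      coneWt (-p.1 - 1) (p.1 - p.2.1 + p.2.2) * -T p := by
    rintro ⟨r, s, t⟩
    simp only [Function.comp, e2, hT, Equiv.coe_fn_mk]
    have c1 : choose2 (-r - 1 + 1) + choose2 (r + t + 1) + (-r - 1) * (r - s + t) =
        (r + 1) * s + choose2 t := by
      have a1 := two_mul_choose2 (-r - 1 + 1)
      have a2 := two_mul_choose2 (r + t + 1)
      have a3 := two_mul_choose2 t
      linarith
    have c2 : (-1 : ℂ) ^ (-r - 1 + 1) * (-1) ^ (r + t + 1) = -(-1) ^ t := by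
      rw [← zpow_add₀ hm1, show -r - 1 + 1 + (r + t + 1) = t + 1 by ring, zpow_add₀ hm1]; simp
    have c3 : z₁ ^ (-r - 1 + 1) * z₁ ^ (r - s + t) = z₁ ^ (t - s) := by
      rw [← zpow_add₀ hz1]; congr 1; ring
    rw [← c1, zpow_add₀ hq0, zpow_add₀ hq0, mul_zpow, ← c3]
    linear_combination (coneWt (-r - 1) (r - s + t) * q ^ choose2 (-r - 1 + 1) *
      z₁ ^ (-r - 1 + 1) * x ^ (r - s + t) * z₁ ^ (r - s + t) * q ^ ((-r - 1) * (r - s + t)) *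
      q ^ choose2 (r + t + 1) * z₀ ^ (r + t + 1)) * c2
  have f3 : ∀ p, ((fun p : (ℤ × ℤ) × ℤ => coneWt p.1.1 p.1.2 * ((-1) ^ (p.1.1 + 1) *
      q ^ choose2 (p.1.1 + 1) * z₀ ^ (p.1.1 + 1) * (x * z₀) ^ p.1.2 * q ^ (p.1.1 * p.1.2)) *
      ((-1) ^ p.2 * q ^ choose2 p.2 * z₁ ^ p.2)) ∘ e3) p =
      coneWt p.2.1 (p.1 - p.2.1 + p.2.2) * -T p := by
    rintro ⟨r, s, t⟩
    simp only [Function.comp, e3, hT, Equiv.coe_fn_mk]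
    have c1 : choose2 (s + 1) + choose2 (t - s) + s * (r - s + t) = (r + 1) * s + choose2 t := by
      have a1 := two_mul_choose2 (s + 1)
      have a2 := two_mul_choose2 (t - s)
      have a3 := two_mul_choose2 t
      linarith
    have c2 : (-1 : ℂ) ^ (s + 1) * (-1) ^ (t - s) = -(-1) ^ t := by
      rw [← zpow_add₀ hm1, show s + 1 + (t - s) = t + 1 by ring, zpow_add₀ hm1]; simp
    have c3 : z₀ ^ (s + 1) * z₀ ^ (r - s + t) = z₀ ^ (r + t + 1) := by
      rw [← zpow_add₀ hz0]; congr 1; ring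
    rw [← c1, zpow_add₀ hq0, zpow_add₀ hq0, mul_zpow, ← c3]
    linear_combination (coneWt s (r - s + t) * q ^ choose2 (s + 1) *
      z₀ ^ (s + 1) * x ^ (r - s + t) * z₀ ^ (r - s + t) * q ^ (s * (r - s + t)) *
      q ^ choose2 (t - s) * z₁ ^ (t - s)) * c2
  rw [hasSum_congr' f1] at H1'
  rw [hasSum_congr' f2] at H2'
  rw [hasSum_congr' f3] at H3'
  have H4 := H2'.sub H3'
  -- The identity of weights behind the theorem: as `sg (-r - 1) = -sg r`, the sign of `k` cancels.
  have f4 : ∀ p : ℤ × ℤ × ℤ, coneWt (-p.1 - 1) (p.1 - p.2.1 + p.2.2) * -T p -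
      coneWt p.2.1 (p.1 - p.2.1 + p.2.2) * -T p = coneWt p.1 p.2.1 * T p := fun p => by
    simp only [coneWt, sg_neg_sub_one]
    push_cast
    ring
  rw [hasSum_congr' f4] at H4
  have := H4.unique H1'
  rw [show x * z₀ * (q / (x * z₁)) = q / (z₁ / z₀) by field_simp, jTheta_div hq0,
    jTheta_div hq0] at this
  linear_combination this

/-! ### Hecke-type double sums as single sums over `innerSum` -/

theorem summable_heckeBarTerm {a b c : ℕ} (ha : a ≠ 0) (hc : c ≠ 0) {x y q : ℂ} (hq0 : q ≠ 0)
    (hq : ‖q‖ < 1) (hx : x ≠ 0) (hy : y ≠ 0) : Summable (heckeBarTerm a b c x y q) := by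
  have h := ((summable_norm_theta (pow_ne_zero a hq0) (norm_q_pow_lt hq ha) hx).mul_of_nonneg
    (summable_norm_theta (pow_ne_zero c hq0) (norm_q_pow_lt hq hc) hy)
    (fun _ => norm_nonneg _) (fun _ => norm_nonneg _)).comp_injective
    (Subtype.val_injective (p := fun p : ℤ × ℤ => sg p.1 = sg p.2))
  refine Summable.of_norm (Summable.of_nonneg_of_le (fun _ => norm_nonneg _) (fun p => ?_) h)
  obtain ⟨⟨r, s⟩, hp⟩ := p
  have hrs : 0 ≤ r * s := by
    simp only [sg] at hp
    split_ifs at hp with h1 h2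
    · exact mul_nonneg h1 h2
    · exact mul_nonneg_of_nonpos_of_nonpos (by omega) (by omega)
  have hb : ‖q ^ ((b : ℤ) * r * s)‖ ≤ 1 := by
    rw [norm_zpow]
    exact zpow_le_one₀ (norm_pos_iff.2 hq0) hq.le (by rw [mul_assoc]; positivity)
  simp only [heckeBarTerm, Function.comp, zpow_add₀ hq0, norm_mul]
  have h1 : ‖(-1 : ℂ) ^ (r + s)‖ = 1 := by simp
  rw [h1, ← zpow_natCast q a, ← zpow_natCast q c, ← zpow_mul, ← zpow_mul]
  calc _ = ‖q ^ ((a : ℤ) * choose2 r)‖ * ‖x ^ r‖ * (‖q ^ ((c : ℤ) * choose2 s)‖ * ‖y ^ s‖) *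
        ‖q ^ ((b : ℤ) * r * s)‖ := by ring
    _ ≤ _ := mul_le_of_le_one_right (by positivity) hb

theorem summable_heckeTerm {a b c : ℕ} (ha : a ≠ 0) (hc : c ≠ 0) {x y q : ℂ} (hq0 : q ≠ 0)
    (hq : ‖q‖ < 1) (hx : x ≠ 0) (hy : y ≠ 0) : Summable (heckeTerm a b c x y q) := by
  refine Summable.of_norm ((summable_heckeBarTerm ha hc (b := b) hq0 hq hx hy).norm.congr
    fun p => ?_)
  rw [heckeTerm, norm_mul]
  have : ‖((sg p.1.1 : ℤ) : ℂ)‖ = 1 := by unfold sg; split_ifs <;> simp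
  rw [this, one_mul]

/-- The two quadrants making up the index set of a Hecke-type double sum. -/
def sameSgEquiv : (ℕ × ℕ) ⊕ (ℕ × ℕ) ≃ SameSg where
  toFun := Sum.elim
    (fun p => ⟨(p.1, p.2), by rw [sg_of_nonneg (by simp), sg_of_nonneg (by simp)]⟩)
    (fun p => ⟨(-p.1 - 1, -p.2 - 1), by
      rw [sg_of_neg (by simp only; omega), sg_of_neg (by simp only; omega)]⟩)
  invFun p := if 0 ≤ p.1.1 then .inl (p.1.1.toNat, p.1.2.toNat)
    else .inr ((-p.1.1 - 1).toNat, (-p.1.2 - 1).toNat)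
  left_inv := by
    rintro (⟨r, s⟩ | ⟨r, s⟩)
    · simp
    · have : ¬ (0 : ℤ) ≤ -r - 1 := by omega
      simp only [Sum.elim_inr, this, if_false, Sum.inr.injEq, Prod.mk.injEq]
      omega
  right_inv := by
    rintro ⟨⟨r, s⟩, h⟩
    simp only [sg] at h
    apply Subtype.ext
    by_cases hr : 0 ≤ r
    · have hs : 0 ≤ s := by
        by_contra hs; simp [hr, hs] at h
      simp [hr, hs]
    · have hs : ¬ 0 ≤ s := by
        intro hs; simp [hr, hs] at h
      simp only [hr, if_false, Sum.elim_inr, Prod.mk.injEq]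
      omega

/-- On the antidiagonal `r + s = n` the numbers `r - s` run through `n, n - 2, …, -n`, and the
triangular numbers of `r - s` are those of `0, 1, …, n`, each once. -/
theorem sum_antidiagonal_choose2 (q : ℂ) : ∀ n : ℕ,
    ∑ p ∈ antidiagonal n, (q ^ choose2 ((p.1 : ℤ) - p.2 + 1))⁻¹ = innerSum q n
  | 0 => by simp [innerSum, choose2]
  | 1 => by
    have e : antidiagonal 1 = {(0, 1), (1, 0)} := rfl
    rw [e, sum_pair (by simp)]
    simp [innerSum, choose2, sum_range_succ]
  | n + 2 => by
    rw [Nat.antidiagonal_succ_succ', sum_cons, sum_cons, sum_map]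
    have h := sum_antidiagonal_choose2 q n
    have e : ∀ p : ℕ × ℕ, (q ^ choose2 (((p.1 + 1 : ℕ) : ℤ) - (p.2 + 1 : ℕ) + 1))⁻¹ =
        (q ^ choose2 ((p.1 : ℤ) - p.2 + 1))⁻¹ := fun p => by push_cast; ring_nf
    simp only [Function.Embedding.prodMap, Function.Embedding.coeFn_mk, Prod.map,
      Nat.succ_eq_add_one, e, h]
    have e1 : ∀ k : ℕ, q ^ choose2 ((k : ℤ) + 1) = q ^ (k * (k + 1) / 2) := fun k => by
      rw [pow_half_eq_zpow q (z := choose2 (k + 1)) (by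
        have := two_mul_choose2 ((k : ℤ) + 1); push_cast; linarith)]
    have e2 : choose2 (((0 : ℕ) : ℤ) - ((n + 2 : ℕ) : ℤ) + 1) =
        choose2 (((n + 1 : ℕ) : ℤ) + 1) := by
      have h1 := two_mul_choose2 (((0 : ℕ) : ℤ) - ((n + 2 : ℕ) : ℤ) + 1)
      have h2 := two_mul_choose2 (((n + 1 : ℕ) : ℤ) + 1)
      push_cast at *
      linarith
    have e3 : (((n + 2 : ℕ) : ℤ) - ((0 : ℕ) : ℤ) + 1) = ((n + 2 : ℕ) : ℤ) + 1 := by simp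
    rw [innerSum, innerSum, sum_range_succ _ (n + 2), sum_range_succ _ (n + 1)]
    change (q ^ choose2 (((0 : ℕ) : ℤ) - ((n + 2 : ℕ) : ℤ) + 1))⁻¹ +
      ((q ^ choose2 (((n + 2 : ℕ) : ℤ) - ((0 : ℕ) : ℤ) + 1))⁻¹ + _) = _
    rw [e2, e3, e1, e1]
    ring

theorem sum_antidiagonal_choose2' (q : ℂ) (n : ℕ) :
    ∑ p ∈ antidiagonal n, (q ^ choose2 ((p.2 : ℤ) - p.1 + 1))⁻¹ = innerSum q n := by
  rw [← sum_antidiagonal_choose2, ← Finset.Nat.sum_antidiagonal_swap]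
  rfl

/-- A double sum over the two quadrants whose terms depend on `r + s` up to the factor
`q ^ (-(r - s + 1) (r - s) / 2)` is a pair of single sums over the antidiagonals. -/
theorem tsum_sameSg {q δ : ℂ} {f : SameSg → ℂ} {u : ℤ → ℂ} (hδ : δ ≠ 0) (hf : Summable f)
    (h : ∀ p, f p = (if 0 ≤ p.1.1 then 1 else δ) *
      (u (p.1.1 + p.1.2) * (q ^ choose2 (p.1.1 - p.1.2 + 1))⁻¹)) :
    (Summable fun n : ℕ => u n * innerSum q n) ∧
    (Summable fun n : ℕ => u (-2 - n) * innerSum q n) ∧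
    ∑' p, f p = ∑' n : ℕ, u n * innerSum q n + δ * ∑' n : ℕ, u (-2 - n) * innerSum q n := by
  have h0 := sameSgEquiv.summable_iff.2 hf
  have s1 : Summable fun p => f (sameSgEquiv (Sum.inl p)) := h0.comp_injective Sum.inl_injective
  have s2 : Summable fun p => f (sameSgEquiv (Sum.inr p)) := h0.comp_injective Sum.inr_injective
  have e1 : ∀ n : ℕ, ∑ p ∈ antidiagonal n, f (sameSgEquiv (Sum.inl p)) = u n * innerSum q n :=
    fun n => by
      rw [← sum_antidiagonal_choose2, mul_sum]
      refine sum_congr rfl fun p hp => ?_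
      rw [HasAntidiagonal.mem_antidiagonal] at hp
      rw [h, ← hp]
      simp [sameSgEquiv]
  have e2 : ∀ n : ℕ, ∑ p ∈ antidiagonal n, f (sameSgEquiv (Sum.inr p)) =
      δ * (u (-2 - n) * innerSum q n) := fun n => by
    rw [← sum_antidiagonal_choose2', mul_sum, mul_sum]
    refine sum_congr rfl fun p hp => ?_
    rw [HasAntidiagonal.mem_antidiagonal] at hp
    have hneg : ¬ (0 : ℤ) ≤ -(p.1 : ℤ) - 1 := by omega
    rw [h, ← hp]
    simp only [sameSgEquiv, Equiv.coe_fn_mk, Sum.elim_inr, hneg, if_false]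
    congr 3
    · push_cast; ring
    · congr 2; ring
  have t1 := hasSum_antidiagonal s1.hasSum
  have t2 := hasSum_antidiagonal s2.hasSum
  rw [hasSum_congr' e1] at t1
  rw [hasSum_congr' e2] at t2
  refine ⟨t1.summable, ?_, ?_⟩
  · have := t2.summable.mul_left δ⁻¹
    refine this.congr fun n => ?_
    field_simp
  · rw [← sameSgEquiv.tsum_eq f, Summable.tsum_sum (f := fun p => f (sameSgEquiv p)) s1 s2,
      ← t1.tsum_eq, ← t2.tsum_eq, tsum_mul_left]

theorem innerSum_succ (q : ℂ) (n : ℕ) :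
    innerSum q (n + 1) = innerSum q n + (q ^ choose2 ((n : ℤ) + 2))⁻¹ := by
  rw [innerSum, sum_range_succ, innerSum, pow_half_eq_zpow q (z := choose2 (n + 2))]
  have := two_mul_choose2 ((n : ℤ) + 2)
  push_cast; linarith

/-- Summation by parts against the increments of `innerSum`. -/
theorem tsum_mul_innerSum_shift {q : ℂ} {W : ℕ → ℂ} (h1 : Summable fun n => W n * innerSum q n)
    (h2 : Summable fun n => W (n + 1) * innerSum q n) :
    HasSum (fun n : ℕ => W n * (q ^ choose2 ((n : ℤ) + 1))⁻¹)
      (∑' n, W n * innerSum q n - ∑' n, W (n + 1) * innerSum q n) := by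
  have h3 := ((hasSum_nat_add_iff' (f := fun n => W n * innerSum q n) 1).2 h1.hasSum).sub h2.hasSum
  refine (hasSum_nat_add_iff' 1).1 ?_
  have e0 : ∀ n, W (n + 1) * innerSum q (n + 1) - W (n + 1) * innerSum q n =
      W (n + 1) * (q ^ choose2 (((n + 1 : ℕ) : ℤ) + 1))⁻¹ := fun n => by
    rw [innerSum_succ]; push_cast; ring_nf
  rw [hasSum_congr' e0] at h3
  have e1 : ∑ i ∈ range 1, W i * innerSum q i =
      ∑ i ∈ range 1, W i * (q ^ choose2 ((i : ℤ) + 1))⁻¹ := by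
    simp [innerSum, choose2]
  rw [e1] at h3
  rwa [sub_right_comm]

theorem heckeBarTerm_neg_neg (a b c : ℤ) (x y q : ℂ) (p : SameSg) :
    heckeBarTerm a b c (-x) (-y) q p = (-1) ^ (p.1.1 + p.1.2) * heckeBarTerm a b c x y q p := by
  have h : ∀ (x : ℂ) (r : ℤ), (-x) ^ r = (-1) ^ r * x ^ r := fun x r => by
    rw [← neg_one_mul, mul_zpow]
  rw [heckeBarTerm, heckeBarTerm, h x, h y, zpow_add₀ (by norm_num : (-1 : ℂ) ≠ 0)]
  ring

theorem heckeTerm_eq (a b c : ℤ) (x y q : ℂ) (p : SameSg) :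
    heckeTerm a b c x y q p = (if 0 ≤ p.1.1 then 1 else -1) * heckeBarTerm a b c x y q p := by
  rw [heckeTerm, sg]; split_ifs <;> simp

/-- In terms of `r + s` and `r - s` the quadratic form of `f_{3,5,3}` is diagonal. -/
theorem heckeBarTerm_353 {q : ℂ} (hq0 : q ≠ 0) (m : ℤ) (p : SameSg) :
    heckeBarTerm 3 5 3 (q ^ m) (q ^ (m + 1)) q p = (-1) ^ (p.1.1 + p.1.2) *
      q ^ (4 * choose2 (p.1.1 + p.1.2) + (m + 1) * (p.1.1 + p.1.2)) *
        (q ^ choose2 (p.1.1 - p.1.2 + 1))⁻¹ := by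
  obtain ⟨⟨r, s⟩, hp⟩ := p
  simp only [heckeBarTerm]
  rw [← zpow_neg, ← zpow_mul, ← zpow_mul]
  simp only [mul_assoc, ← zpow_add₀ hq0]
  congr 2
  have h1 := two_mul_choose2 r
  have h2 := two_mul_choose2 s
  have h3 := two_mul_choose2 (r + s)
  have h4 := two_mul_choose2 (r - s + 1)
  linarith

/-- In terms of `r + s` and `r - s` the quadratic form of `f_{1,2,1}` is diagonal. -/
theorem heckeBarTerm_121 {q : ℂ} (hq0 : q ≠ 0) (m : ℤ) (p : SameSg) :
    heckeBarTerm 1 2 1 (q ^ m) (q ^ (m + 1)) (q ^ 2) p = (-1) ^ (p.1.1 + p.1.2) *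
      q ^ (3 * choose2 (p.1.1 + p.1.2) + (m + 1) * (p.1.1 + p.1.2)) *
        (q ^ choose2 (p.1.1 - p.1.2 + 1))⁻¹ := by
  obtain ⟨⟨r, s⟩, hp⟩ := p
  simp only [heckeBarTerm]
  rw [← zpow_neg, ← zpow_mul, ← zpow_mul, ← zpow_natCast q 2, ← zpow_mul]
  simp only [mul_assoc, ← zpow_add₀ hq0]
  congr 2
  have h1 := two_mul_choose2 r
  have h2 := two_mul_choose2 s
  have h3 := two_mul_choose2 (r + s)
  have h4 := two_mul_choose2 (r - s + 1)
  push_cast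
  linarith

/-- Shifting the summation index by one in the single sums relates a Hecke-type double sum to
the one with `x`, `y` replaced by `q ^ K x`, `q ^ K y`, up to a theta function. -/
theorem hecke_shift_signed {q : ℂ} (hq0 : q ≠ 0) (hq : ‖q‖ < 1) {K : ℕ} (hK : 2 ≤ K) (m : ℤ)
    {f₁ f₂ : SameSg → ℂ} (s₁ : Summable f₁) (s₂ : Summable f₂)
    (h₁ : ∀ p, f₁ p = (if 0 ≤ p.1.1 then 1 else -1) * ((-1) ^ (p.1.1 + p.1.2) *
      q ^ (K * choose2 (p.1.1 + p.1.2) + (m + 1) * (p.1.1 + p.1.2)) *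
        (q ^ choose2 (p.1.1 - p.1.2 + 1))⁻¹))
    (h₂ : ∀ p, f₂ p = (if 0 ≤ p.1.1 then 1 else -1) * ((-1) ^ (p.1.1 + p.1.2) *
      q ^ (K * choose2 (p.1.1 + p.1.2) + (m + K + 1) * (p.1.1 + p.1.2)) *
        (q ^ choose2 (p.1.1 - p.1.2 + 1))⁻¹)) :
    ∑' p, f₁ p = ∑' n : ℕ, ((-1) ^ (n : ℤ) * q ^ (K * choose2 n + (m + 1) * n) -
      (-1) ^ (n : ℤ) * q ^ (K * choose2 (-2 - n) + (m + 1) * (-2 - n))) * innerSum q n ∧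
    ∑' p, f₁ p + q ^ (m + 1) * ∑' p, f₂ p = jTheta (q ^ m) (q ^ (K - 1)) := by
  set u : ℤ → ℂ := fun N => (-1) ^ N * q ^ (K * choose2 N + (m + 1) * N) with hu
  set u' : ℤ → ℂ := fun N => (-1) ^ N * q ^ (K * choose2 N + (m + K + 1) * N) with hu'
  have hm1 : (-1 : ℂ) ≠ 0 := by norm_num
  obtain ⟨a1, a2, a3⟩ := tsum_sameSg (u := u) hm1 s₁ h₁
  obtain ⟨b1, b2, b3⟩ := tsum_sameSg (u := u') hm1 s₂ h₂
  have hev : ∀ n : ℤ, (-1 : ℂ) ^ (-2 - n) = (-1) ^ n := fun n => by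
    rw [sub_eq_add_neg, zpow_add₀ hm1, zpow_neg _ n, ← inv_zpow, inv_neg_one,
      show (-1 : ℂ) ^ (-2 : ℤ) = 1 by norm_num, one_mul]
  refine ⟨?_, ?_⟩
  · rw [a3, neg_one_mul, ← sub_eq_add_neg, ← a1.tsum_sub a2]
    refine tsum_congr fun n => ?_
    rw [hu]
    simp only [hev]
    ring
  -- Up to a constant the second sum is the first one with `N` replaced by `N + 1`, so that
  -- summation by parts leaves the series of `u N` times the increments of `innerSum`. On `N ≥ 0`
  -- and on `N < 0` together it is a theta series.
  have hshift : ∀ N : ℤ, u (N + 1) = -q ^ (m + 1) * u' N := fun N => by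
    simp only [hu, hu']
    rw [choose2_add_one, zpow_add₀ hm1, show (K : ℤ) * (choose2 N + N) + (m + 1) * (N + 1) =
      (m + 1) + (K * choose2 N + (m + K + 1) * N) by ring, zpow_add₀ hq0 (m + 1)]
    ring
  have e1 : ∀ n : ℕ, -q ^ (m + 1) * (u' n * innerSum q n) = u (n + 1 : ℕ) * innerSum q n :=
    fun n => by push_cast; rw [hshift]; ring
  have e2 : ∀ n : ℕ, -q ^ (m + 1) * (u' (-2 - n) * innerSum q n) =
      u (-1 - n) * innerSum q n := fun n => by
    rw [show -1 - (n : ℤ) = -2 - n + 1 by ring, hshift]; ring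
  have c1 := (b1.mul_left (-q ^ (m + 1))).congr e1
  have c2 := (b2.mul_left (-q ^ (m + 1))).congr e2
  have d1 := tsum_mul_innerSum_shift (W := fun n : ℕ => u n) a1 c1
  have d2 := tsum_mul_innerSum_shift (W := fun n : ℕ => u (-1 - n)) c2
    (a2.congr fun n => by push_cast; ring_nf)
  have d3 := HasSum.of_nat_of_neg_add_one (f := fun N : ℤ => u N * (q ^ choose2 (N + 1))⁻¹) d1
    ((hasSum_congr' fun n => by
      have : choose2 (-((n : ℤ) + 1) + 1) = choose2 (n + 1) := by
        rw [← choose2_one_sub]; ring_nf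
      rw [this]
      ring_nf).2 d2)
  have hQ := norm_q_pow_lt hq (k := K - 1) (by omega)
  have d4 := hasSum_jTheta (pow_ne_zero (K - 1) hq0) hQ (zpow_ne_zero m hq0)
  have e3 : ∀ N : ℤ, (-1) ^ N * (q ^ (K - 1)) ^ choose2 N * (q ^ m) ^ N =
      u N * (q ^ choose2 (N + 1))⁻¹ := fun N => by
    simp only [hu]
    rw [← zpow_natCast q (K - 1), ← zpow_mul, ← zpow_mul, ← zpow_neg]
    simp only [mul_assoc, ← zpow_add₀ hq0]
    rw [choose2_add_one, Nat.cast_sub (by omega)]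
    push_cast
    ring_nf
  rw [hasSum_congr' e3] at d4
  rw [d4.unique d3, a3, b3]
  have g1 : ∑' n : ℕ, u (n + 1 : ℕ) * innerSum q n =
      -q ^ (m + 1) * ∑' n : ℕ, u' n * innerSum q n := by
    rw [← tsum_mul_left]; exact tsum_congr fun n => (e1 n).symm
  have g2 : ∑' n : ℕ, u (-1 - n) * innerSum q n =
      -q ^ (m + 1) * ∑' n : ℕ, u' (-2 - n) * innerSum q n := by
    rw [← tsum_mul_left]; exact tsum_congr fun n => (e2 n).symm
  have g3 : ∑' n : ℕ, u (-1 - (n + 1 : ℕ)) * innerSum q n =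
      ∑' n : ℕ, u (-2 - n) * innerSum q n := tsum_congr fun n => by push_cast; ring_nf
  rw [g1, g2, g3]
  ring

/-- The double sum `f_{3,5,3}` as the single sum for `ψ`, and its relation to the shifted double
sum. -/
theorem heckeF_353 {q : ℂ} (hq0 : q ≠ 0) (hq : ‖q‖ < 1) :
    Summable (heckeTerm 3 5 3 (q ^ 4) (q ^ 5) q) ∧
    Summable (heckeTerm 3 5 3 (q ^ 8) (q ^ 9) q) ∧
    heckeF 3 5 3 (q ^ 4) (q ^ 5) q = ∑' n, psiOuterTerm q n ∧
    heckeF 3 5 3 (q ^ 4) (q ^ 5) q + q ^ 5 * heckeF 3 5 3 (q ^ 8) (q ^ 9) q =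
      jTheta (q ^ 4) (q ^ 3) := by
  have s1 := summable_heckeTerm (a := 3) (b := 5) (c := 3) (by norm_num) (by norm_num) hq0 hq
    (pow_ne_zero 4 hq0) (pow_ne_zero 5 hq0)
  have s2 := summable_heckeTerm (a := 3) (b := 5) (c := 3) (by norm_num) (by norm_num) hq0 hq
    (pow_ne_zero 8 hq0) (pow_ne_zero 9 hq0)
  obtain ⟨h1, h2⟩ := hecke_shift_signed hq0 hq (K := 4) (by norm_num) 4 s1 s2
    (fun p => by rw [heckeTerm_eq]; congr 1; exact heckeBarTerm_353 hq0 4 p)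
    (fun p => by rw [heckeTerm_eq]; congr 1; exact heckeBarTerm_353 hq0 8 p)
  refine ⟨s1, s2, h1.trans (tsum_congr fun n => ?_), h2⟩
  rw [psiOuterTerm]
  have e1 : (4 : ℤ) * choose2 n + (4 + 1) * n = ((2 * n ^ 2 + 3 * n : ℕ) : ℤ) := by
    have := two_mul_choose2 n
    push_cast; linarith
  have e2 : (4 : ℤ) * choose2 (-2 - n) + (4 + 1) * (-2 - n) =
      ((2 * n ^ 2 + 3 * n + (2 * n + 2) : ℕ) : ℤ) := by
    have := two_mul_choose2 (-2 - n)
    push_cast; linarith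
  simp only [Nat.cast_ofNat]
  rw [e1, e2, zpow_natCast, zpow_natCast, zpow_natCast, pow_add q _ (2 * n + 2)]
  ring

/-- The double sum `f_{1,2,1}` as the single sum for `σ`, and its relation to the shifted double
sum. -/
theorem heckeF_121 {q : ℂ} (hq0 : q ≠ 0) (hq : ‖q‖ < 1) :
    Summable (heckeTerm 1 2 1 (q ^ 3) (q ^ 4) (q ^ 2)) ∧
    Summable (heckeTerm 1 2 1 (q ^ 6) (q ^ 7) (q ^ 2)) ∧
    heckeF 1 2 1 (q ^ 3) (q ^ 4) (q ^ 2) = ∑' n, sigmaOuterTerm q n ∧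
    heckeF 1 2 1 (q ^ 3) (q ^ 4) (q ^ 2) + q ^ 4 * heckeF 1 2 1 (q ^ 6) (q ^ 7) (q ^ 2) =
      jTheta (q ^ 3) (q ^ 2) := by
  have hq2 := norm_q_pow_lt hq two_ne_zero
  have s1 := summable_heckeTerm (a := 1) (b := 2) (c := 1) (by norm_num) (by norm_num)
    (pow_ne_zero 2 hq0) hq2 (pow_ne_zero 3 hq0) (pow_ne_zero 4 hq0)
  have s2 := summable_heckeTerm (a := 1) (b := 2) (c := 1) (by norm_num) (by norm_num)
    (pow_ne_zero 2 hq0) hq2 (pow_ne_zero 6 hq0) (pow_ne_zero 7 hq0)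
  obtain ⟨h1, h2⟩ := hecke_shift_signed hq0 hq (K := 3) (by norm_num) 3 s1 s2
    (fun p => by rw [heckeTerm_eq]; congr 1; exact heckeBarTerm_121 hq0 3 p)
    (fun p => by rw [heckeTerm_eq]; congr 1; exact heckeBarTerm_121 hq0 6 p)
  refine ⟨s1, s2, h1.trans (tsum_congr fun n => ?_), h2⟩
  rw [sigmaOuterTerm]
  have t1 := two_mul_choose2 (n : ℤ)
  have t2 := two_mul_choose2 (-2 - n)
  rw [pow_half_eq_zpow q (k := 3 * n ^ 2 + 5 * n) (z := 3 * choose2 n + 4 * n)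
    (by push_cast; linarith)]
  have e2 : (3 : ℤ) * choose2 (-2 - n) + (3 + 1) * (-2 - n) =
      3 * choose2 n + 4 * n + ((n + 1 : ℕ) : ℤ) := by push_cast; linarith
  simp only [Nat.cast_ofNat]
  rw [e2, zpow_add₀ hq0 _ ((n + 1 : ℕ) : ℤ), zpow_natCast, zpow_natCast]
  ring_nf

/-- The double sum without signs. Here the two quadrants enter with the same sign, so the shift
leaves the difference of two partial theta series, which telescopes to `-q⁻¹`. -/
theorem heckeFbar_121 {q : ℂ} (hq0 : q ≠ 0) (hq : ‖q‖ < 1) :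
    Summable (heckeBarTerm 1 2 1 (-q ^ 3) (-q ^ 4) (q ^ 2)) ∧
    Summable (heckeBarTerm 1 2 1 (-q ^ 6) (-q ^ 7) (q ^ 2)) ∧
    heckeFbar 1 2 1 (-q ^ 3) (-q ^ 4) (q ^ 2) = ∑' n, falseOuterTerm q n ∧
    heckeFbar 1 2 1 (-q ^ 3) (-q ^ 4) (q ^ 2) -
      q ^ 4 * heckeFbar 1 2 1 (-q ^ 6) (-q ^ 7) (q ^ 2) = -q⁻¹ := by
  have hq2 := norm_q_pow_lt hq two_ne_zero
  have s1 : Summable (heckeBarTerm 1 2 1 (-q ^ 3) (-q ^ 4) (q ^ 2)) :=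
    summable_heckeBarTerm (a := 1) (b := 2) (c := 1) (by norm_num) (by norm_num) (pow_ne_zero 2 hq0)
      hq2 (neg_ne_zero.2 (pow_ne_zero 3 hq0)) (neg_ne_zero.2 (pow_ne_zero 4 hq0))
  have s2 : Summable (heckeBarTerm 1 2 1 (-q ^ 6) (-q ^ 7) (q ^ 2)) :=
    summable_heckeBarTerm (a := 1) (b := 2) (c := 1) (by norm_num) (by norm_num) (pow_ne_zero 2 hq0)
      hq2 (neg_ne_zero.2 (pow_ne_zero 6 hq0)) (neg_ne_zero.2 (pow_ne_zero 7 hq0))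
  set u : ℤ → ℂ := fun N => q ^ (3 * choose2 N + 4 * N) with hu
  set u' : ℤ → ℂ := fun N => q ^ (3 * choose2 N + 7 * N) with hu'
  have hh : ∀ k : ℤ, ((-1 : ℂ) ^ k) * (-1) ^ k = 1 := fun k => by
    rw [← mul_zpow]; simp
  obtain ⟨a1, a2, a3⟩ := tsum_sameSg (q := q) (u := u) one_ne_zero s1 fun p => by
    have := heckeBarTerm_121 hq0 3 p
    norm_num only [zpow_ofNat] at this
    rw [heckeBarTerm_neg_neg, this, ite_self, ← mul_assoc, ← mul_assoc, hh, one_mul, one_mul]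
  obtain ⟨b1, b2, b3⟩ := tsum_sameSg (q := q) (u := u') one_ne_zero s2 fun p => by
    have := heckeBarTerm_121 hq0 6 p
    norm_num only [zpow_ofNat] at this
    rw [heckeBarTerm_neg_neg, this, ite_self, ← mul_assoc, ← mul_assoc, hh, one_mul, one_mul]
  refine ⟨s1, s2, ?_, ?_⟩
  · refine a3.trans ?_
    rw [one_mul, ← a1.tsum_add a2]
    refine tsum_congr fun n => ?_
    have t1 := two_mul_choose2 (n : ℤ)
    have t2 := two_mul_choose2 (-2 - n)
    have e2 : (3 : ℤ) * choose2 (-2 - n) + 4 * (-2 - n) =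
        3 * choose2 n + 4 * n + ((n + 1 : ℕ) : ℤ) := by push_cast; linarith
    rw [falseOuterTerm, pow_half_eq_zpow q (k := 3 * n ^ 2 + 5 * n) (z := 3 * choose2 n + 4 * n)
      (by push_cast; linarith), hu]
    simp only [e2]
    rw [zpow_add₀ hq0 _ ((n + 1 : ℕ) : ℤ), zpow_natCast]
    ring
  have hshift : ∀ N : ℤ, u (N + 1) = q ^ 4 * u' N := fun N => by
    simp only [hu, hu']
    rw [choose2_add_one, show (3 : ℤ) * (choose2 N + N) + 4 * (N + 1) =
      (4 : ℕ) + (3 * choose2 N + 7 * N) by push_cast; ring, zpow_add₀ hq0 (4 : ℕ), zpow_natCast]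
  have e1 : ∀ n : ℕ, q ^ 4 * (u' n * innerSum q n) = u (n + 1 : ℕ) * innerSum q n :=
    fun n => by push_cast; rw [hshift]; ring
  have e2 : ∀ n : ℕ, q ^ 4 * (u' (-2 - n) * innerSum q n) =
      u (-1 - n) * innerSum q n := fun n => by
    rw [show -1 - (n : ℤ) = -2 - n + 1 by ring, hshift]; ring
  have c1 := (b1.mul_left (q ^ 4)).congr e1
  have c2 := (b2.mul_left (q ^ 4)).congr e2
  have d1 := tsum_mul_innerSum_shift (W := fun n : ℕ => u n) a1 c1
  have d2 := tsum_mul_innerSum_shift (W := fun n : ℕ => u (-1 - n)) c2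
    (a2.congr fun n => by push_cast; ring_nf)
  have f1 : ∀ n : ℕ, u n * (q ^ choose2 ((n : ℤ) + 1))⁻¹ = q ^ (((n + 1 : ℕ) : ℤ) ^ 2 - 1) :=
    fun n => by
      simp only [hu]
      rw [← zpow_neg, ← zpow_add₀ hq0]
      congr 1
      have t1 := two_mul_choose2 (n : ℤ)
      have t2 := two_mul_choose2 ((n : ℤ) + 1)
      push_cast; linarith
  have f2 : ∀ n : ℕ, u (-1 - n) * (q ^ choose2 ((n : ℤ) + 1))⁻¹ = q ^ ((n : ℤ) ^ 2 - 1) :=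
    fun n => by
      simp only [hu]
      rw [← zpow_neg, ← zpow_add₀ hq0]
      congr 1
      have t1 := two_mul_choose2 (-1 - (n : ℤ))
      have t2 := two_mul_choose2 ((n : ℤ) + 1)
      linarith
  rw [hasSum_congr' f1] at d1
  rw [hasSum_congr' f2] at d2
  -- The partial theta series `∑ q^{(n+1)² - 1}` and `∑ q^{n² - 1}` over `n ≥ 0` differ by the first
  -- term of the latter.
  have d3 := ((hasSum_nat_add_iff' (f := fun n : ℕ => q ^ ((n : ℤ) ^ 2 - 1)) 1).2 d2).unique d1
  have g1 : ∑' n : ℕ, u (n + 1 : ℕ) * innerSum q n =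
      q ^ 4 * ∑' n : ℕ, u' n * innerSum q n := by
    rw [← tsum_mul_left]; exact tsum_congr fun n => (e1 n).symm
  have g2 : ∑' n : ℕ, u (-1 - n) * innerSum q n =
      q ^ 4 * ∑' n : ℕ, u' (-2 - n) * innerSum q n := by
    rw [← tsum_mul_left]; exact tsum_congr fun n => (e2 n).symm
  have g3 : ∑' n : ℕ, u (-1 - (n + 1 : ℕ)) * innerSum q n =
      ∑' n : ℕ, u (-2 - n) * innerSum q n := tsum_congr fun n => by push_cast; ring_nf
  rw [g1, g2, g3] at d3
  simp only [range_one, sum_singleton, Nat.cast_zero] at d3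
  rw [show ((0 : ℤ) ^ 2 - 1) = -1 by norm_num, zpow_neg_one] at d3
  rw [heckeFbar, heckeFbar]
  have a3' : ∑' p, heckeBarTerm 1 2 1 (-q ^ 3) (-q ^ 4) (q ^ 2) p = _ := a3
  have b3' : ∑' p, heckeBarTerm 1 2 1 (-q ^ 6) (-q ^ 7) (q ^ 2) p = _ := b3
  rw [a3', b3']
  linear_combination -d3

theorem neg_qPochInf_div_eq {q : ℂ} (hq : ‖q‖ < 1) :
    qPochInf (-q) q / qPochInf q q = J 2 q / J 1 q ^ 2 := by
  have h := qPochInf_mul_qPochInf_neg q hq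
  have h0 := qPochInf_self_ne_zero hq
  rw [J, J, pow_one, ← h]
  field_simp

/-! ### The universal mock theta function `g₃` and Watson's expansion -/

/-- The series `Σ q^{n(n+1)} / ((x;q)_{n+1} (q/x;q)_{n+1})` as a Lambert type series. -/
theorem hasSum_universal {q x : ℂ} (hq0 : q ≠ 0) (hq : ‖q‖ < 1) (hx0 : x ≠ 0)
    (hx : ∀ k : ℕ, 1 - x * q ^ k ≠ 0) (hx' : ∀ k : ℕ, 1 - q / x * q ^ k ≠ 0) :
    HasSum (fun n => q ^ (n ^ 2 + n) * (qPoch x q (n + 1) * qPoch (q / x) q (n + 1))⁻¹)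
      ((qPochInf q q)⁻¹ * ∑' n : ℤ, (-1) ^ n * q ^ (3 * choose2 (n + 1)) / (1 - x * q ^ n)) := by
  have n1 : 1 - q ≠ 0 := one_sub_ne_zero_of_norm_lt hq
  have e2 : q * q = q ^ 2 := by ring
  have hq2 := norm_q_pow_lt hq two_ne_zero
  have hf : ∀ n, qPoch q q (n + 1) = (1 - q) * qPoch (q ^ 2) q n := fun n => by
    rw [qPoch_succ', e2]
  have hinf : qPochInf q q = (1 - q) * qPochInf (q ^ 2) q := by rw [qPochInf_eq_mul q hq, e2]
  set α : ℕ → ℂ := fun r => (-1) ^ r * q ^ choose2 (r + 1) * (1 - q ^ (2 * r + 1)) /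
      ((1 - x * q ^ r) * (1 - q / x * q ^ r)) with hα
  have hαs : Summable fun r => ‖α r * (1 - q)⁻¹‖ := by
    obtain ⟨C, hC0, hC⟩ := exists_norm_inv_one_sub_le hq x
    obtain ⟨C', hC0', hC'⟩ := exists_norm_inv_one_sub_le hq (q / x)
    have h := (summable_norm_theta hq0 hq (x := q) hq0).comp_injective
      (Nat.cast_injective (R := ℤ))
    refine Summable.of_nonneg_of_le (fun _ => norm_nonneg _) (fun r => ?_)
      (h.mul_right (2 * (C * C') * ‖(1 - q)⁻¹‖))
    have b1 : ‖1 - q ^ (2 * r + 1)‖ ≤ 2 := by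
      refine (norm_sub_le _ _).trans ?_
      rw [norm_one, norm_pow]
      have := pow_le_one₀ (n := 2 * r + 1) (norm_nonneg q) hq.le
      linarith
    rw [hα]
    simp only [Function.comp]
    rw [choose2_add_one, zpow_add₀ hq0, div_eq_mul_inv, mul_inv]
    simp only [norm_mul, norm_pow, norm_neg, norm_one, one_pow, one_mul]
    have b2 := hC r
    have b3 := hC' r
    rw [zpow_natCast q r, norm_pow]
    calc _ ≤ ‖q ^ choose2 (r : ℤ)‖ * ‖q‖ ^ r * 2 * (C * C') * ‖(1 - q)⁻¹‖ := by gcongr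
      _ = _ := by ring
  have H := bailey_lemma (s := 0) (t := 0) (a := q) (α := fun r => α r * (1 - q)⁻¹)
    (β := fun n => (qPoch x q (n + 1) * qPoch (q / x) q (n + 1))⁻¹) hq0 hq (by simp) (by simp)
    (by simp) (fun k => by rw [e2]; exact one_sub_mul_pow_ne_zero hq hq2 k) hαs (by
      intro n
      rw [← bailey_pair_universal hq0 hq hx0 hx hx' n]
      refine sum_congr rfl fun r hr => ?_
      have hr' : r ≤ n := by simpa [Nat.lt_succ_iff] using hr
      have c1 : (n : ℤ) - r = (n - r : ℕ) := by omega
      have c2 : (n : ℤ) + r + 1 = (n + r + 1 : ℕ) := by push_cast; ring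
      rw [c1, c2, rPoch_natCast, rPoch_natCast, hf, e2, hα]
      simp only
      rw [div_eq_mul_inv _ (qPoch q q (n - r) * _), mul_inv, mul_inv]
      ring)
  have e1 : ∀ r : ℕ, revPoch 0 q r * revPoch 0 q r * (q * q) ^ r = q ^ (r ^ 2 + r) := fun r => by
    have h : ((-1 : ℂ)) ^ r * (-1) ^ r = 1 := by rw [← mul_pow]; simp
    rw [revPoch_zero_left hq0, pow_add, ← zpow_two_mul_choose2, mul_pow]
    linear_combination (q ^ choose2 (r : ℤ) * q ^ choose2 (r : ℤ) * (q ^ r * q ^ r)) * h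
  have hs : Summable fun n : ℤ => (-1) ^ n * q ^ (3 * choose2 (n + 1)) / (1 - x * q ^ n) := by
    have h0 := summable_norm_theta (pow_ne_zero 3 hq0) (norm_q_pow_lt hq three_ne_zero)
      (x := q ^ 3) (pow_ne_zero 3 hq0)
    have h1 : Summable fun n : ℤ => ‖(-1) ^ n * q ^ (3 * choose2 (n + 1))‖ := by
      refine h0.congr fun n => ?_
      have h2 : ‖(-1 : ℂ) ^ n‖ = 1 := by simp
      rw [norm_mul ((-1 : ℂ) ^ n), h2, one_mul, choose2_add_one,
        ← zpow_natCast, ← zpow_mul, ← zpow_mul, ← zpow_add₀ hq0]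
      push_cast
      ring_nf
    refine Summable.of_norm (summable_norm_div_one_sub hq0 hq hx0
      (h1.comp_injective (Nat.cast_injective (R := ℤ))) ?_)
    refine Summable.of_nonneg_of_le (fun _ => norm_nonneg _) (fun n => ?_)
        (h1.comp_injective (i := fun n : ℕ => -((n : ℤ) + 1)) (fun a b h => by
          simp only at h; omega))
    rw [norm_mul _ (q ^ n), norm_pow]
    exact mul_le_of_le_one_right (norm_nonneg _) (pow_le_one₀ (norm_nonneg _) hq.le)
  have H2 := H.2
  rw [hasSum_congr' fun n => by rw [e1 n]] at H2
  -- By partial fractions the `r`-th term of the one-sided series is the sum of the terms of indices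
  -- `r` and `-r - 1` of the two-sided one.
  have e3 : ∀ r : ℕ, revPoch 0 q r * revPoch 0 q r * (q * q) ^ r * (α r * (1 - q)⁻¹) /
      (qPoch (q * q * 0) q r * qPoch (q * q * 0) q r) = (1 - q)⁻¹ *
      ((-1) ^ (r : ℤ) * q ^ (3 * choose2 ((r : ℤ) + 1)) / (1 - x * q ^ (r : ℤ)) +
      (-1) ^ (-((r : ℤ) + 1)) * q ^ (3 * choose2 (-((r : ℤ) + 1) + 1)) /
        (1 - x * q ^ (-((r : ℤ) + 1)))) := fun r => by
    rw [e1, mul_zero, qPoch_zero_left, hα]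
    have c1 : choose2 (-((r : ℤ) + 1) + 1) = choose2 (r + 1) := by
      rw [← choose2_one_sub]; ring_nf
    have c2 : q ^ (3 * choose2 ((r : ℤ) + 1)) = q ^ (r ^ 2 + r) * q ^ choose2 ((r : ℤ) + 1) := by
      rw [← zpow_natCast, ← zpow_add₀ hq0]
      congr 1
      have := two_mul_choose2 ((r : ℤ) + 1)
      push_cast; linarith
    have c3 : (-1 : ℂ) ^ (-((r : ℤ) + 1)) = -(-1) ^ r := by
      rw [zpow_neg, ← inv_zpow, inv_neg_one, zpow_add₀ (by norm_num), zpow_natCast]; simp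
    have c4 : q ^ (-((r : ℤ) + 1)) = (q * q ^ r)⁻¹ := by
      rw [zpow_neg, zpow_add_one₀ hq0, zpow_natCast, mul_comm]
    have k1 := hx r
    have k2 := hx' r
    have c5 : q ^ (2 * r + 1) = q ^ r * q ^ r * q := by ring
    simp only
    rw [c1, c2, c3, c4, c5, zpow_natCast, zpow_natCast]
    have k0 : q ^ r ≠ 0 := pow_ne_zero r hq0
    generalize q ^ r = y at *
    have k3 : 1 - x * (q * y)⁻¹ ≠ 0 := by
      intro h0
      apply k2
      have : x = q * y := by field_simp at h0; linear_combination -h0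
      rw [this]; field_simp; ring
    have k4 : x - q * y ≠ 0 := by
      intro h0
      apply k2
      rw [sub_eq_zero.1 h0]; field_simp; ring
    have k5 : q * y - x ≠ 0 := by rw [← neg_sub]; exact neg_ne_zero.2 k4
    have s1 : (1 - q / x * y) = (x - q * y) / x := by field_simp
    have s2 : 1 - x * (q * y)⁻¹ = -(x - q * y) / (q * y) := by field_simp; ring
    have s3 : (1 - y * y * q) / ((1 - x * y) * ((x - q * y) / x)) =
        1 / (1 - x * y) - 1 / (-(x - q * y) / (q * y)) := by
      rw [one_div_div, div_neg, sub_neg_eq_add, div_add_div _ _ k1 k4, mul_div_assoc',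
        div_div_eq_mul_div]
      congr 1
      ring
    rw [s1, s2]
    linear_combination (q ^ (r ^ 2 + r) * (-1) ^ r * q ^ choose2 ((r : ℤ) + 1) * (1 - q)⁻¹) * s3
  have H3 := hs.hasSum.nat_add_neg_add_one
  have H4 : ∑' r : ℕ, revPoch 0 q r * revPoch 0 q r * (q * q) ^ r * (α r * (1 - q)⁻¹) /
      (qPoch (q * q * 0) q r * qPoch (q * q * 0) q r) = (1 - q)⁻¹ *
      ∑' n : ℤ, (-1) ^ n * q ^ (3 * choose2 (n + 1)) / (1 - x * q ^ n) := by
    rw [← H3.tsum_eq, ← tsum_mul_left]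
    exact tsum_congr e3
  rw [H4] at H2
  have e5 : (qPochInf q q)⁻¹ * ∑' n : ℤ, (-1) ^ n * q ^ (3 * choose2 (n + 1)) / (1 - x * q ^ n) =
      qPochInf (q * q * 0) q * qPochInf (q * q * 0) q / (qPochInf (q * q) q *
        qPochInf (q * q * 0 * 0) q) * ((1 - q)⁻¹ *
      ∑' n : ℤ, (-1) ^ n * q ^ (3 * choose2 (n + 1)) / (1 - x * q ^ n)) := by
    rw [mul_zero, zero_mul, qPochInf_zero_left, hinf, mul_inv, e2]
    ring
  rw [e5]
  exact H2

theorem qPoch_bisect (x q : ℂ) (n : ℕ) :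
    qPoch x q (2 * n) = qPoch x (q ^ 2) n * qPoch (x * q) (q ^ 2) n := by
  induction n with
  | zero => simp [qPoch]
  | succ n ih =>
    rw [show 2 * (n + 1) = 2 * n + 1 + 1 by ring, qPoch_succ, qPoch_succ, qPoch_succ x (q ^ 2),
      qPoch_succ (x * q), ih]
    ring

theorem qPochInf_trisect (x : ℂ) {q : ℂ} (hq : ‖q‖ < 1) :
    qPochInf x q =
      qPochInf x (q ^ 3) * qPochInf (x * q) (q ^ 3) * qPochInf (x * q ^ 2) (q ^ 3) := by
  have hq3 := norm_q_pow_lt hq three_ne_zero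
  have h1 : ∀ n : ℕ, qPoch x q (3 * n) =
      qPoch x (q ^ 3) n * qPoch (x * q) (q ^ 3) n * qPoch (x * q ^ 2) (q ^ 3) n := fun n => by
    induction n with
    | zero => simp [qPoch]
    | succ n ih =>
      rw [show 3 * (n + 1) = 3 * n + 1 + 1 + 1 by ring, qPoch_succ, qPoch_succ, qPoch_succ,
        qPoch_succ x (q ^ 3), qPoch_succ (x * q), qPoch_succ (x * q ^ 2), ih]
      ring
  have t := (tendsto_qPoch x hq).comp (tendsto_id.const_mul_atTop' (r := 3) (by norm_num))
  refine tendsto_nhds_unique t ?_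
  refine Tendsto.congr (fun n => (h1 n).symm) ?_
  exact ((tendsto_qPoch _ hq3).mul (tendsto_qPoch _ hq3)).mul (tendsto_qPoch _ hq3)

/-- The sum of the terms of indices `2n` and `2n + 1` of the series for `ψ` has denominator
`(q;q^2)_{2n+2} = (q;q^4)_{n+1} (q^3;q^4)_{n+1}`: it is the `n`-th term of the universal series with
base `q^4` at `x = q`. -/
theorem tsum_psiTerm_eq_lambert {q : ℂ} (hq0 : q ≠ 0) (hq : ‖q‖ < 1) :
    ∑' n, psiTerm q n = (J 4 q)⁻¹ *
      ∑' n : ℤ, (-1) ^ n * (q ^ 4) ^ (3 * choose2 (n + 1)) / (1 - q * (q ^ 4) ^ n) := by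
  have hq4 := norm_q_pow_lt hq four_ne_zero
  have n1 : ∀ k : ℕ, 1 - q * (q ^ 4) ^ k ≠ 0 := one_sub_mul_pow_ne_zero hq4 hq
  have n2 : ∀ k : ℕ, 1 - q ^ 4 / q * (q ^ 4) ^ k ≠ 0 := one_sub_mul_pow_ne_zero hq4 (by
    rw [show q ^ 4 / q = q ^ 3 by field_simp]; exact norm_q_pow_lt hq three_ne_zero)
  have H := hasSum_universal (pow_ne_zero 4 hq0) hq4 hq0 n1 n2
  have hs := (psi_bailey hq0 hq).2.summable
  have hs1 : Summable fun k => psiTerm q (2 * k) :=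
    hs.comp_injective (mul_right_injective₀ two_ne_zero)
  have hs2 : Summable fun k => psiTerm q (2 * k + 1) :=
    hs.comp_injective ((add_left_injective 1).comp (mul_right_injective₀ two_ne_zero))
  rw [← tsum_even_add_odd hs1 hs2, ← hs1.tsum_add hs2]
  change _ = (qPochInf (q ^ 4) (q ^ 4))⁻¹ * _
  rw [← H.tsum_eq]
  refine tsum_congr fun n => ?_
  have b := qPoch_bisect q (q ^ 2) (n + 1)
  rw [show q * q ^ 2 = q ^ 4 / q by field_simp, show (q ^ 2) ^ 2 = q ^ 4 by ring] at b
  rw [← b, psiTerm, psiTerm, show 2 * (n + 1) = 2 * n + 1 + 1 by ring, qPoch_succ _ _ (2 * n + 1)]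
  have m1 : 1 - q * (q ^ 2) ^ (2 * n + 1) ≠ 0 :=
    one_sub_mul_pow_ne_zero (norm_q_pow_lt hq two_ne_zero) hq _
  have m2 : qPoch q (q ^ 2) (2 * n + 1) ≠ 0 :=
    qPoch_ne_zero (one_sub_mul_pow_ne_zero (norm_q_pow_lt hq two_ne_zero) hq) _
  field_simp
  ring

/-! ### Appell-Lerch series: symmetries and bisection -/

/-- The Appell-Lerch series without its theta denominator. -/
noncomputable def appellSum (x q z : ℂ) : ℂ := ∑' r : ℤ, appellTerm x q z r

theorem appellM_eq (x q z : ℂ) : appellM x q z = appellSum x q z / jTheta z q := by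
  rw [appellM, appellSum, one_div_mul_eq_div]

/-- Quasi-periodicity in `z`, with the same factor as for `j(z;q)`; hence `m(x,q,qz) = m(x,q,z)`. -/
theorem appellSum_mul_left {x q z : ℂ} (hq0 : q ≠ 0) (hz : z ≠ 0) :
    appellSum x q (q * z) = -z⁻¹ * appellSum x q z := by
  rw [appellSum, appellSum, ← (Equiv.addRight (1 : ℤ)).tsum_eq (appellTerm x q z), ← tsum_mul_left]
  refine tsum_congr fun r => ?_
  rw [Equiv.coe_addRight, appellTerm, appellTerm, choose2_add_one, add_sub_cancel_right,
    zpow_add₀ hq0, zpow_add_one₀ hz, zpow_add_one₀ (by norm_num : (-1 : ℂ) ≠ 0), mul_zpow,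
    zpow_sub_one₀ hq0, show q ^ r * q⁻¹ * x * (q * z) = q ^ r * x * z by field_simp]
  field_simp

/-- The symmetry `m(x,q,z) = x⁻¹ m(x⁻¹,q,z⁻¹)`, by `r ↦ 1 - r`. -/
theorem appellSum_reflect {x q z : ℂ} (hq0 : q ≠ 0) (hx : x ≠ 0) (hz : z ≠ 0)
    (h : ∀ k : ℤ, x * z * q ^ k ≠ 1) :
    appellSum x q z = x⁻¹ * appellSum x⁻¹ q (q / z) := by
  rw [appellSum, appellSum, ← (Equiv.subLeft (1 : ℤ)).tsum_eq (appellTerm x q z), ← tsum_mul_left]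
  refine tsum_congr fun r => ?_
  have h0 := h (-r)
  have hqr := zpow_ne_zero r hq0
  have hzr := zpow_ne_zero r hz
  have e1 : 1 - q ^ (1 - r - 1) * x * z ≠ 0 := by
    rw [show 1 - r - 1 = -r by ring]
    intro h1
    exact h0 (by linear_combination -h1)
  have e2 : 1 - q ^ (r - 1) * x⁻¹ * (q / z) ≠ 0 := by
    intro h1
    apply h0
    rw [zpow_neg]
    rw [zpow_sub_one₀ hq0] at h1
    field_simp at h1 ⊢
    linear_combination h1
  rw [Equiv.subLeft_apply, appellTerm, appellTerm, choose2_one_sub, mul_div_assoc',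
    div_eq_div_iff e1 e2, show 1 - r - 1 = -r by ring, zpow_sub₀ (by norm_num : (-1 : ℂ) ≠ 0),
    zpow_sub₀ hz, zpow_neg, zpow_sub_one₀ hq0, div_zpow, zpow_one, zpow_one]
  have hm : (-1 : ℂ) ^ r * (-1) ^ r = 1 := by rw [← mul_zpow]; simp
  have hm0 : (-1 : ℂ) ^ r ≠ 0 := zpow_ne_zero _ (by norm_num)
  field_simp
  linear_combination (x * z - q ^ r) * hm

theorem one_sub_inv_eq {Y : ℂ} (h : Y ^ 2 ≠ 1) : 1 / (1 - Y) = (1 + Y) / (1 - Y ^ 2) := by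
  have h1 : 1 - Y ≠ 0 := fun h0 => h (by rw [← sub_eq_zero.1 h0]; norm_num)
  have h2 : 1 - Y ^ 2 ≠ 0 := fun h0 => h (sub_eq_zero.1 h0).symm
  rw [div_eq_div_iff h1 h2]; ring

/-- A series over `ℤ × X` may be summed over the residue classes of the integer modulo `N`. -/
theorem hasSum_residues {X : Type*} {N : ℕ} [NeZero N] {f : ℤ × X → ℂ} {a : Fin N → ℂ}
    (h : ∀ i : Fin N, HasSum (fun p : ℤ × X => f (N * p.1 + (i : ℕ), p.2)) (a i)) :
    HasSum f (∑ i, a i) := by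
  let g : Fin N → ℤ × X → ℤ × X := fun i p => (N * p.1 + (i : ℕ), p.2)
  have hN : (N : ℤ) ≠ 0 := by exact_mod_cast NeZero.ne N
  have hN' : (0 : ℤ) < N := by have := NeZero.pos N; omega
  have hg : ∀ i, Function.Injective (g i) := fun i p p' hp => by
    simp only [g, Prod.mk.injEq, add_left_inj, mul_right_inj' hN] at hp
    exact Prod.ext hp.1 hp.2
  -- The given series are those of the restrictions of `f` to the residue classes, which partition
  -- the index set.
  have h1 : ∀ i ∈ (univ : Finset (Fin N)), HasSum ((Set.range (g i)).indicator f) (a i) :=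
    fun i _ => ((hg i).hasSum_iff fun x hx => Set.indicator_of_notMem hx f).1
      ((hasSum_congr' fun p => (Set.indicator_of_mem (Set.mem_range_self p) f).symm).1 (h i))
  refine (hasSum_congr' fun p => ?_).1 (hasSum_sum h1)
  have hr := Int.emod_nonneg p.1 hN
  have hr' := Int.emod_lt_of_pos p.1 hN'
  rw [sum_eq_single_of_mem (⟨(p.1 % N).toNat, by omega⟩ : Fin N) (mem_univ _)]
  · have hp : g ⟨(p.1 % N).toNat, by omega⟩ (p.1 / N, p.2) = p := by
      simp only [g]
      rw [Int.toNat_of_nonneg hr, Int.mul_ediv_add_emod]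
    exact Set.indicator_of_mem (Set.mem_range.2 ⟨_, hp⟩) f
  · rintro i - hi
    refine Set.indicator_of_notMem ?_ f
    rintro ⟨p', hp'⟩
    apply hi
    have h2 : N * p'.1 + (i : ℕ) = p.1 := congrArg Prod.fst hp'
    apply Fin.ext
    have h3 : p.1 % N = (i : ℕ) := by
      rw [← h2, Int.mul_add_emod_self_left, Int.emod_eq_of_lt (by omega) (by have := i.2; omega)]
    simp [h3]

theorem hasSum_mod_two {X : Type*} {f : ℤ × X → ℂ} {a₀ a₁ : ℂ}
    (h₀ : HasSum (fun p : ℤ × X => f (2 * p.1, p.2)) a₀)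
    (h₁ : HasSum (fun p : ℤ × X => f (2 * p.1 + 1, p.2)) a₁) : HasSum f (a₀ + a₁) := by
  have := hasSum_residues (N := 2) (f := f) (a := ![a₀, a₁]) fun i => by
    fin_cases i
    · simpa using h₀
    · simpa using h₁
  simpa using this

theorem tsum_int_even_add_odd {f : ℤ → ℂ} (hf : Summable f) :
    ∑' k, f k = ∑' k, f (2 * k) + ∑' k, f (2 * k + 1) := by
  have h1 : Summable fun k => f (2 * k) :=
    hf.comp_injective (i := fun k : ℤ => 2 * k) (fun a b h => by simp at h; omega)
  have h2 : Summable fun k => f (2 * k + 1) :=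
    hf.comp_injective (i := fun k : ℤ => 2 * k + 1) (fun a b h => by simp at h; omega)
  have e (g : ℤ → ℂ) (a : ℂ) : HasSum (fun p : ℤ × Unit => g p.1) a ↔ HasSum g a :=
    (Equiv.prodPUnit ℤ).hasSum_iff (f := g)
  have h := hasSum_mod_two (f := fun p : ℤ × Unit => f p.1)
    ((e (fun k => f (2 * k)) _).2 h1.hasSum) ((e (fun k => f (2 * k + 1)) _).2 h2.hasSum)
  exact ((e f _).1 h).tsum_eq

theorem neg_pow_mul_zpow (b z : ℂ) (m : ℕ) (k : ℤ) :
    (-b ^ m * z ^ 2) ^ k = (-1) ^ k * b ^ (m * k) * z ^ (2 * k) := by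
  rw [neg_mul, ← neg_one_mul, mul_zpow, mul_zpow, ← zpow_natCast b, ← zpow_natCast z 2, ← zpow_mul,
    ← zpow_mul]
  push_cast; ring

theorem neg_mul_sq_zpow (b z : ℂ) (k : ℤ) :
    (-b * z ^ 2) ^ k = (-1) ^ k * b ^ k * z ^ (2 * k) := by
  simpa using neg_pow_mul_zpow b z 1 k

/-- Separation of the even and the odd terms of a theta series. -/
theorem jTheta_bisect {b z : ℂ} (hb0 : b ≠ 0) (hb : ‖b‖ < 1) (hz : z ≠ 0) :
    jTheta z b = jTheta (-b * z ^ 2) (b ^ 4) - z * jTheta (-b ^ 3 * z ^ 2) (b ^ 4) := by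
  have hb4 := norm_q_pow_lt hb four_ne_zero
  have h1 := hasSum_jTheta (x := -b * z ^ 2) (pow_ne_zero 4 hb0) hb4 (by simp [hb0, hz])
  have h2 := hasSum_jTheta (x := -b ^ 3 * z ^ 2) (pow_ne_zero 4 hb0) hb4 (by simp [hb0, hz])
  have h := hasSum_jTheta hb0 hb hz
  have hm : ∀ k : ℤ, (-1 : ℂ) ^ k * (-1) ^ k = 1 := fun k => by rw [← mul_zpow]; simp
  rw [← h.tsum_eq, tsum_int_even_add_odd h.summable, ← h1.tsum_eq, ← h2.tsum_eq, sub_eq_add_neg,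
    ← neg_mul, ← tsum_mul_left]
  congr 1
  · refine tsum_congr fun k => ?_
    have e : choose2 (2 * k) = 4 * choose2 k + k := by
      have := two_mul_choose2 k
      have := two_mul_choose2 (2 * k)
      linarith
    rw [neg_one_zpow_two_mul, e, neg_mul_sq_zpow, ← zpow_natCast b 4, ← zpow_mul, zpow_add₀ hb0]
    push_cast
    linear_combination -(b ^ (4 * choose2 k) * b ^ k * z ^ (2 * k)) * hm k
  · refine tsum_congr fun k => ?_
    have e : choose2 (2 * k + 1) = 4 * choose2 k + 3 * k := by
      have := two_mul_choose2 k
      have := two_mul_choose2 (2 * k + 1)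
      linarith
    rw [zpow_add₀ (by norm_num : (-1 : ℂ) ≠ 0), neg_one_zpow_two_mul, e, neg_pow_mul_zpow,
      ← zpow_natCast b 4, zpow_add₀ hz, zpow_one, zpow_one, ← zpow_mul, zpow_add₀ hb0]
    push_cast
    linear_combination (z * b ^ (4 * choose2 k) * b ^ (3 * k) * z ^ (2 * k)) * hm k

/-- Separation of the even and the odd terms of an Appell-Lerch series, the denominators being made
even by `1 / (1 - Y) = (1 + Y) / (1 - Y²)`. -/
theorem appellSum_bisect {x b z : ℂ} (hb0 : b ≠ 0) (hb : ‖b‖ < 1) (hx : x ≠ 0) (hz : z ≠ 0)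
    (h : ∀ k : ℤ, (b ^ k * x * z) ^ 2 ≠ 1) :
    appellSum x b z = appellSum (-b * x ^ 2) (b ^ 4) (-b * z ^ 2) -
      x / b * appellSum (-x ^ 2 / b) (b ^ 4) (-b * z ^ 2) -
      z * appellSum (-b * x ^ 2) (b ^ 4) (-b ^ 3 * z ^ 2) +
      x * z / b * appellSum (-x ^ 2 / b) (b ^ 4) (-b ^ 3 * z ^ 2) := by
  have hb4 := norm_q_pow_lt hb four_ne_zero
  have hb40 := pow_ne_zero 4 hb0
  have hm : ∀ k : ℤ, (-1 : ℂ) ^ k * (-1) ^ k = 1 := fun k => by rw [← mul_zpow]; simp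
  have hz1 : -b * z ^ 2 ≠ 0 := by simp [hb0, hz]
  have hz3 : -b ^ 3 * z ^ 2 ≠ 0 := by simp [hb0, hz]
  have hx1 : -b * x ^ 2 ≠ 0 := by simp [hb0, hx]
  have hx3 : -x ^ 2 / b ≠ 0 := by simp [hb0, hx]
  have hs := summable_appellTerm hb0 hb hx hz
  -- the terms `r = 2 k`
  have E : ∀ k : ℤ, appellTerm x b z (2 * k) =
      appellTerm (-b * x ^ 2) (b ^ 4) (-b * z ^ 2) k +
      x * z / b * appellTerm (-x ^ 2 / b) (b ^ 4) (-b ^ 3 * z ^ 2) k := fun k => by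
    have e : choose2 (2 * k) = 4 * choose2 k + k := by
      have := two_mul_choose2 k
      have := two_mul_choose2 (2 * k)
      linarith
    have e1 : (b ^ 4) ^ (k - 1) * (-b * x ^ 2) * (-b * z ^ 2) = (b ^ (2 * k - 1) * x * z) ^ 2 := by
      rw [mul_pow, mul_pow, ← zpow_natCast (b ^ (2 * k - 1)), ← zpow_natCast b 4, ← zpow_mul,
        ← zpow_mul, show (2 * k - 1) * ((2 : ℕ) : ℤ) = ((4 : ℕ) : ℤ) * (k - 1) + 1 + 1 by
          push_cast; ring, zpow_add_one₀ hb0, zpow_add_one₀ hb0]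
      ring
    have e2 : (b ^ 4) ^ (k - 1) * (-x ^ 2 / b) * (-b ^ 3 * z ^ 2) =
        (b ^ (2 * k - 1) * x * z) ^ 2 := by
      rw [← e1]; field_simp
    have e3 := one_sub_inv_eq (h (2 * k - 1))
    rw [appellTerm, appellTerm, appellTerm, e1, e2, div_eq_mul_one_div, e3,
      neg_one_zpow_two_mul, e, neg_mul_sq_zpow, neg_pow_mul_zpow]
    generalize (1 - (b ^ (2 * k - 1) * x * z) ^ 2 : ℂ) = D
    rw [zpow_sub_one₀ hb0, ← zpow_natCast b 4, ← zpow_mul, zpow_add₀ hb0,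
      show ((3 : ℕ) : ℤ) * k = 2 * k + k by push_cast; ring, zpow_add₀ hb0 (2 * k)]
    push_cast
    linear_combination (-(b ^ (4 * choose2 k) * b ^ k * z ^ (2 * k)) / D -
      x * z / b * (b ^ (4 * choose2 k) * (b ^ (2 * k) * b ^ k) * z ^ (2 * k)) / D) * hm k
  -- the terms `r = 2 k + 1`
  have O : ∀ k : ℤ, appellTerm x b z (2 * k + 1) =
      -z * appellTerm (-b * x ^ 2) (b ^ 4) (-b ^ 3 * z ^ 2) k -
      x * z ^ 2 * appellTerm (-x ^ 2 / b) (b ^ 4) (b ^ 4 * (-b * z ^ 2)) k := fun k => by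
    have e : choose2 (2 * k + 1) = 4 * choose2 k + 3 * k := by
      have := two_mul_choose2 k
      have := two_mul_choose2 (2 * k + 1)
      linarith
    have e1 : (b ^ 4) ^ (k - 1) * (-b * x ^ 2) * (-b ^ 3 * z ^ 2) = (b ^ (2 * k) * x * z) ^ 2 := by
      rw [mul_pow, mul_pow, ← zpow_natCast (b ^ (2 * k)), ← zpow_natCast b 4, ← zpow_mul,
        ← zpow_mul, show (2 * k) * ((2 : ℕ) : ℤ) = ((4 : ℕ) : ℤ) * (k - 1) + 1 + 1 + 1 + 1 by
          push_cast; ring, zpow_add_one₀ hb0, zpow_add_one₀ hb0, zpow_add_one₀ hb0,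
          zpow_add_one₀ hb0]
      ring
    have e2 : (b ^ 4) ^ (k - 1) * (-x ^ 2 / b) * (b ^ 4 * (-b * z ^ 2)) =
        (b ^ (2 * k) * x * z) ^ 2 := by
      rw [← e1]; field_simp
    have e3 := one_sub_inv_eq (h (2 * k))
    rw [appellTerm, appellTerm, appellTerm, add_sub_cancel_right, e1, e2, div_eq_mul_one_div, e3,
      zpow_add₀ (by norm_num : (-1 : ℂ) ≠ 0), neg_one_zpow_two_mul, e,
      show b ^ 4 * (-b * z ^ 2) = -b ^ 5 * z ^ 2 by ring, neg_pow_mul_zpow, neg_pow_mul_zpow]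
    generalize (1 - (b ^ (2 * k) * x * z) ^ 2 : ℂ) = D
    rw [← zpow_natCast b 4, ← zpow_mul, zpow_add₀ hb0, zpow_add_one₀ hz,
      show ((5 : ℕ) : ℤ) * k = 2 * k + 3 * k by push_cast; ring, zpow_add₀ hb0 (2 * k)]
    push_cast
    linear_combination (z * (b ^ (4 * choose2 k) * b ^ (3 * k) * z ^ (2 * k)) / D +
      x * z ^ 2 * (b ^ (4 * choose2 k) * (b ^ (2 * k) * b ^ (3 * k)) * z ^ (2 * k)) / D) * hm k
  have a1 := summable_appellTerm hb40 hb4 hx1 hz1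
  have a2 := summable_appellTerm hb40 hb4 hx3 hz3
  have a3 := summable_appellTerm hb40 hb4 hx1 hz3
  have a4 := summable_appellTerm hb40 hb4 hx3 (mul_ne_zero hb40 hz1)
  have h5 := appellSum_mul_left (x := -x ^ 2 / b) hb40 hz1
  rw [appellSum, tsum_int_even_add_odd hs, tsum_congr E, tsum_congr O,
    a1.tsum_add (a2.mul_left _), (a3.mul_left _).tsum_sub (a4.mul_left _), tsum_mul_left,
    tsum_mul_left, tsum_mul_left]
  change appellSum _ _ _ + x * z / b * appellSum _ _ _ + (-z * appellSum _ _ _ -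
    x * z ^ 2 * appellSum _ _ _) = _
  rw [h5]
  have : x * z ^ 2 * (-b * z ^ 2)⁻¹ = -(x / b) := by field_simp
  linear_combination (appellSum (-x ^ 2 / b) (b ^ 4) (-b * z ^ 2)) * this

theorem zpow_ne_one_of_norm_lt {q : ℂ} (hq : ‖q‖ < 1) {k : ℤ} (hk : k ≠ 0) :
    q ^ k ≠ 1 := by
  intro h
  have h1 : ‖q‖ ^ k = 1 := by rw [← norm_zpow, h, norm_one]
  exact hk ((zpow_eq_one_iff_right₀ (norm_nonneg q) hq.ne).1 h1)

theorem jTheta_zpow_ne_zero {q : ℂ} (hq0 : q ≠ 0) (hq : ‖q‖ < 1) {M : ℕ} (hM : M ≠ 0) {k : ℤ}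
    (hk : ¬ (M : ℤ) ∣ k) : jTheta (q ^ k) (q ^ M) ≠ 0 := by
  refine jTheta_ne_zero (pow_ne_zero M hq0) (norm_q_pow_lt hq hM) (zpow_ne_zero k hq0)
    fun l hl => ?_
  have h : q ^ (k - M * l) = 1 := by
    rw [zpow_sub₀ hq0, hl, ← zpow_natCast q M, ← zpow_mul,
      div_self (zpow_ne_zero _ hq0)]
  exact zpow_ne_one_of_norm_lt hq (fun h0 => hk ⟨l, by omega⟩) h

theorem jTheta_pow_ne_zero {q : ℂ} (hq0 : q ≠ 0) (hq : ‖q‖ < 1) {M : ℕ} (hM : M ≠ 0) {k : ℕ}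
    (hk : ¬ M ∣ k) : jTheta (q ^ k) (q ^ M) ≠ 0 := by
  have := jTheta_zpow_ne_zero hq0 hq hM (k := k) (by exact_mod_cast hk)
  rwa [zpow_natCast] at this

theorem norm_pow_lt_norm_pow {q : ℂ} (hq0 : q ≠ 0) (hq : ‖q‖ < 1) {m n : ℕ} (h : m < n) :
    ‖q ^ n‖ < ‖q ^ m‖ := by
  rw [norm_pow, norm_pow]
  exact pow_lt_pow_right_of_lt_one₀ (norm_pos_iff.2 hq0) hq h

/-- Splitting `1 / (1 - X) = (1 + X + X²) / (1 - X³)` in the Lambert series for `ψ`. -/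
theorem J_four_mul_tsum_psiTerm {q : ℂ} (hq0 : q ≠ 0) (hq : ‖q‖ < 1) :
    J 4 q * ∑' n, psiTerm q n = -appellSum (q ^ 3) (q ^ 12) 1 -
      (q ^ 3)⁻¹ * appellSum q⁻¹ (q ^ 12) (q ^ 4) - q⁻¹ * appellSum (q ^ 5) (q ^ 12) (q ^ 4) := by
  have hQ0 := pow_ne_zero 12 hq0
  have hQ := norm_q_pow_lt hq (k := 12) (by norm_num)
  have h4 : J 4 q ≠ 0 := qPochInf_self_ne_zero (norm_q_pow_lt hq four_ne_zero)
  rw [tsum_psiTerm_eq_lambert hq0 hq, mul_inv_cancel_left₀ h4]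
  -- The term with `X²` gives the series with `x = q^{-5}`, `z = q^8`; reflection turns it into the
  -- one with `x = q^5`, `z = q^4`.
  have R := appellSum_reflect (x := (q ^ 5)⁻¹) (q := q ^ 12) (z := q ^ 8) hQ0
    (inv_ne_zero (pow_ne_zero 5 hq0)) (pow_ne_zero 8 hq0) (fun k => by
      have : (q ^ 5)⁻¹ * q ^ 8 * (q ^ 12) ^ k = q ^ (12 * k + 3) := by
        rw [zpow_add₀ hq0, zpow_mul]; norm_cast; field_simp
      rw [this]
      exact zpow_ne_one_of_norm_lt hq (by omega))
  rw [inv_inv, show q ^ 12 / q ^ 8 = q ^ 4 by field_simp] at R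
  have s0 := summable_appellTerm (x := q ^ 3) hQ0 hQ (pow_ne_zero 3 hq0) one_ne_zero
  have s1 := summable_appellTerm (x := q⁻¹) hQ0 hQ (inv_ne_zero hq0) (pow_ne_zero 4 hq0)
  have s2 := summable_appellTerm (x := (q ^ 5)⁻¹) hQ0 hQ (inv_ne_zero (pow_ne_zero 5 hq0))
    (pow_ne_zero 8 hq0)
  have e : ∀ n : ℤ, (-1) ^ n * (q ^ 4) ^ (3 * choose2 (n + 1)) / (1 - q * (q ^ 4) ^ n) =
      -appellTerm (q ^ 3) (q ^ 12) 1 (n + 1) -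
      (q ^ 3)⁻¹ * appellTerm q⁻¹ (q ^ 12) (q ^ 4) (n + 1) -
      (q ^ 6)⁻¹ * appellTerm (q ^ 5)⁻¹ (q ^ 12) (q ^ 8) (n + 1) := fun n => by
    have p1 : (q ^ 12) ^ n = ((q ^ 4) ^ n) ^ 3 := by
      rw [← zpow_natCast ((q ^ 4) ^ n), ← zpow_natCast q, ← zpow_natCast q, ← zpow_mul, ← zpow_mul,
        ← zpow_mul]
      push_cast; ring_nf
    have p2 : (q ^ 4) ^ (3 * choose2 (n + 1)) = (q ^ 12) ^ choose2 (n + 1) := by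
      rw [zpow_mul]; norm_cast; ring_nf
    have p3 : (q ^ 8) ^ n = ((q ^ 4) ^ n) ^ 2 := by
      rw [← zpow_natCast ((q ^ 4) ^ n), ← zpow_natCast q, ← zpow_natCast q, ← zpow_mul, ← zpow_mul,
        ← zpow_mul]
      push_cast; ring_nf
    simp only [appellTerm, add_sub_cancel_right, one_zpow]
    rw [zpow_add_one₀ (pow_ne_zero 4 hq0), zpow_add_one₀ (pow_ne_zero 8 hq0), p1, p2, p3,
      zpow_add_one₀ (by norm_num : (-1 : ℂ) ≠ 0)]
    have hX : (q * (q ^ 4) ^ n) ^ 3 ≠ 1 := by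
      have : (q * (q ^ 4) ^ n) ^ 3 = q ^ (12 * n + 3) := by
        rw [mul_pow, ← p1, zpow_add₀ hq0, zpow_mul]; norm_cast; ring
      rw [this]
      exact zpow_ne_one_of_norm_lt hq (by omega)
    generalize (q ^ 4) ^ n = y at *
    have d1 : 1 - q * y ≠ 0 := fun h0 => hX (by rw [← sub_eq_zero.1 h0]; norm_num)
    have d2 : 1 - (q * y) ^ 3 ≠ 0 := fun h0 => hX (sub_eq_zero.1 h0).symm
    rw [show 1 - y ^ 3 * q ^ 3 * 1 = 1 - (q * y) ^ 3 by ring,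
      show 1 - y ^ 3 * q⁻¹ * q ^ 4 = 1 - (q * y) ^ 3 by field_simp,
      show 1 - y ^ 3 * (q ^ 5)⁻¹ * q ^ 8 = 1 - (q * y) ^ 3 by field_simp]
    have key : 1 / (1 - q * y) = (1 + q * y + (q * y) ^ 2) / (1 - (q * y) ^ 3) := by
      rw [div_eq_div_iff d1 d2]; ring
    rw [div_eq_mul_one_div, key]
    generalize (1 - (q * y) ^ 3) = D
    field_simp
    ring
  have t1 := (s0.neg.hasSum.sub (s1.hasSum.mul_left (q ^ 3)⁻¹)).sub (s2.hasSum.mul_left (q ^ 6)⁻¹)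
  have t2 := ((tsum_congr e).trans ((Equiv.addRight (1 : ℤ)).tsum_eq fun b =>
    -appellTerm (q ^ 3) (q ^ 12) 1 b - (q ^ 3)⁻¹ * appellTerm q⁻¹ (q ^ 12) (q ^ 4) b -
      (q ^ 6)⁻¹ * appellTerm (q ^ 5)⁻¹ (q ^ 12) (q ^ 8) b)).trans t1.tsum_eq
  rw [t2, tsum_neg]
  change -appellSum _ _ _ - _ * appellSum _ _ _ - _ * appellSum _ _ _ = _
  rw [R]
  field_simp

/-- The closed form of the series for `ψ` in terms of `m(q,-q^3,q)`. Both sides are brought to the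
base `Q = q^{12}` and to the series with `x = q^5`, `q⁻¹` and `z = q^4`: the left side by
`J_four_mul_tsum_psiTerm`, the right side by bisection and the change of `z`. -/
theorem psi_appell {q : ℂ} (hq0 : q ≠ 0) (hq : ‖q‖ < 1) :
    ∑' n, psiTerm q n =
      -q⁻¹ * appellM q (-q ^ 3) q + J 12 q ^ 3 / (JJ 3 12 q * JJ 4 12 q) := by
  have hQ0 := pow_ne_zero 12 hq0
  have hQ := norm_q_pow_lt hq (k := 12) (by norm_num)
  have hlt := fun {m n : ℕ} (h : m < n) => norm_pow_lt_norm_pow hq0 hq h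
  have hlt1 := fun {k : ℕ} (h : k ≠ 0) => norm_q_pow_lt hq h
  have hne := fun {k : ℕ} (hk : ¬ 12 ∣ k) =>
    jTheta_pow_ne_zero hq0 hq (M := 12) (by norm_num) hk
  have j1 := hne (k := 1) (by norm_num)
  have j2 := hne (k := 2) (by norm_num)
  have j3 := hne (k := 3) (by norm_num)
  have j4 := hne (k := 4) (by norm_num)
  rw [pow_one] at j1
  set Q := q ^ 12 with hQdef
  have t9 : jTheta (q ^ 9) Q = jTheta (q ^ 3) Q := by
    rw [← jTheta_div hQ0 (x := q ^ 3), hQdef]; congr 1; field_simp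
  have t10 : jTheta (q ^ 10) Q = jTheta (q ^ 2) Q := by
    rw [← jTheta_div hQ0 (x := q ^ 2), hQdef]; congr 1; field_simp
  have t8 : jTheta (q ^ 8) Q = jTheta (q ^ 4) Q := by
    rw [← jTheta_div hQ0 (x := q ^ 4), hQdef]; congr 1; field_simp
  have t7 : jTheta (q ^ 7) Q = jTheta (q ^ 5) Q := by
    rw [← jTheta_div hQ0 (x := q ^ 5), hQdef]; congr 1; field_simp
  have t11 : jTheta (q ^ 11) Q = jTheta q Q := by
    rw [← jTheta_div hQ0 (x := q), hQdef]; congr 1; field_simp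
  have t14 : jTheta (q ^ 14) Q = -(q ^ 2)⁻¹ * jTheta (q ^ 2) Q := by
    rw [← jTheta_mul_left hQ0 hQ (pow_ne_zero 2 hq0), hQdef]; congr 1; ring
  have tm5 : jTheta (q ^ 5)⁻¹ Q = -(q ^ 5)⁻¹ * jTheta (q ^ 5) Q :=
    jTheta_inv hQ0 hQ (pow_ne_zero 5 hq0)
  have tm1 : jTheta q⁻¹ Q = -q⁻¹ * jTheta q Q := jTheta_inv hQ0 hQ hq0
  -- the value at `z = 1`
  have A0 := appell_change_z (x := q ^ 3) (q := Q) (z₀ := 1) (z₁ := q) hQ0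
    (by rw [mul_one]; exact hlt (by norm_num)) (by rw [mul_one]; exact hlt1 (by norm_num))
    (by rw [← pow_succ]; exact hlt (by norm_num)) (by rw [← pow_succ]; exact hlt1 (by norm_num))
  rw [jTheta_one _ hQ, mul_one, div_one, ← pow_succ] at A0
  -- the changes of `z` from `q⁴` to `q⁵` and to `q¹¹`
  have c1 := appell_change_z (x := q ^ 5) (q := Q) (z₀ := q ^ 4) (z₁ := q ^ 5) hQ0
    (by rw [← pow_add]; exact hlt (by norm_num)) (by rw [← pow_add]; exact hlt1 (by norm_num))
    (by rw [← pow_add]; exact hlt (by norm_num)) (by rw [← pow_add]; exact hlt1 (by norm_num))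
  have i4 : q⁻¹ * q ^ 4 = q ^ 3 := by field_simp
  have i5 : q⁻¹ * q ^ 5 = q ^ 4 := by field_simp
  have i11 : q⁻¹ * q ^ 11 = q ^ 10 := by field_simp
  have i55 : q ^ 5 * q⁻¹ = q ^ 4 := by field_simp
  have c2 := appell_change_z (x := q⁻¹) (q := Q) (z₀ := q ^ 4) (z₁ := q ^ 5) hQ0
    (by rw [i4]; exact hlt (by norm_num)) (by rw [i4]; exact hlt1 (by norm_num))
    (by rw [i5]; exact hlt (by norm_num)) (by rw [i5]; exact hlt1 (by norm_num))
  have c3 := appell_change_z (x := q ^ 5) (q := Q) (z₀ := q ^ 4) (z₁ := q⁻¹) hQ0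
    (by rw [← pow_add]; exact hlt (by norm_num)) (by rw [← pow_add]; exact hlt1 (by norm_num))
    (by rw [i55]; exact hlt (by norm_num)) (by rw [i55]; exact hlt1 (by norm_num))
  have c4 := appell_change_z (x := q⁻¹) (q := Q) (z₀ := q ^ 4) (z₁ := q ^ 11) hQ0
    (by rw [i4]; exact hlt (by norm_num)) (by rw [i4]; exact hlt1 (by norm_num))
    (by rw [i11]; exact hlt (by norm_num)) (by rw [i11]; exact hlt1 (by norm_num))
  have p1 : appellSum (q ^ 5) Q (q ^ 11) = -q * appellSum (q ^ 5) Q q⁻¹ := by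
    have := appellSum_mul_left (x := q ^ 5) hQ0 (inv_ne_zero hq0)
    rwa [inv_inv, show Q * q⁻¹ = q ^ 11 by rw [hQdef]; field_simp] at this
  change _ * appellSum _ _ _ - _ * appellSum _ _ _ = _ at A0
  change _ * appellSum _ _ _ - _ * appellSum _ _ _ = _ at c1
  change _ * appellSum _ _ _ - _ * appellSum _ _ _ = _ at c2
  change _ * appellSum _ _ _ - _ * appellSum _ _ _ = _ at c3
  change _ * appellSum _ _ _ - _ * appellSum _ _ _ = _ at c4
  rw [show q ^ 5 / q ^ 4 = q by field_simp, ← pow_add, ← pow_add, ← pow_add, t9, t10, t14] at c1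
  rw [show q ^ 5 / q ^ 4 = q by field_simp, i4, i5, ← pow_add, t8] at c2
  rw [show q⁻¹ / q ^ 4 = (q ^ 5)⁻¹ by field_simp, ← pow_add, i55,
    show q ^ (5 + 4) * q⁻¹ = q ^ 8 by field_simp, t9, t8, tm5, tm1] at c3
  rw [show q ^ 11 / q ^ 4 = q ^ 7 by field_simp, i4, i11, ← pow_add, t7, t10, t14, t11] at c4
  -- the bisection of the Appell-Lerch series and of its denominator
  have hb0 : -q ^ 3 ≠ 0 := neg_ne_zero.2 (pow_ne_zero 3 hq0)
  have hb : ‖-q ^ 3‖ < 1 := by rw [norm_neg]; exact hlt1 (by norm_num)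
  have B := appellSum_bisect hb0 hb hq0 hq0 (fun k => by
    have : ((-q ^ 3) ^ k * q * q) ^ 2 = q ^ (6 * k + 4) := by
      rw [zpow_add₀ hq0, mul_pow, mul_pow, ← zpow_natCast ((-q ^ 3) ^ k), zpow_comm, zpow_mul]
      norm_cast
      ring_nf
    rw [this]
    exact zpow_ne_one_of_norm_lt hq (by omega))
  have T := jTheta_bisect hb0 hb hq0
  have r1 : - -q ^ 3 * q ^ 2 = q ^ 5 := by ring
  have r2 : -q ^ 2 / -q ^ 3 = q⁻¹ := by field_simp
  have r3 : -(-q ^ 3) ^ 3 * q ^ 2 = q ^ 11 := by ring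
  have r4 : (-q ^ 3) ^ 4 = Q := by rw [hQdef]; ring
  have r5 : q / -q ^ 3 = -(q ^ 2)⁻¹ := by field_simp
  have r6 : q * q / -q ^ 3 = -q⁻¹ := by field_simp
  rw [r1, r3, r4, t11] at T
  rw [r1, r2, r3, r4, r5, r6, p1] at B
  have hT : jTheta q (-q ^ 3) ≠ 0 := by
    refine jTheta_ne_zero hb0 hb hq0 fun l hl => ?_
    have : q ^ (2 * (3 * l - 1)) = 1 := by
      have h2 : q ^ 2 = q ^ (6 * l) := by
        have h3 : q ^ 2 = ((-q ^ 3) ^ l) ^ 2 := by rw [← hl]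
        rw [h3, ← zpow_natCast, zpow_comm, show 6 * l = ((6 : ℕ) : ℤ) * l by push_cast; ring,
          zpow_mul, zpow_natCast, zpow_natCast]
        ring_nf
      rw [show 2 * (3 * l - 1) = 6 * l - 2 by ring, zpow_sub₀ hq0, ← h2]
      exact div_self (pow_ne_zero 2 hq0)
    exact zpow_ne_one_of_norm_lt hq (by omega) this
  have hJ4 : J 4 q = jTheta (q ^ 4) Q := by
    rw [J, qPochInf_trisect _ (hlt1 four_ne_zero), jTheta, hQdef]
    rw [show q ^ 12 / q ^ 4 = q ^ 8 by field_simp]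
    ring_nf
  have M := J_four_mul_tsum_psiTerm hq0 hq
  rw [hJ4] at M
  -- The theta quotients produced by the four changes of `z` cancel in pairs.
  have hm : jTheta (q ^ 4) Q * appellSum q (-q ^ 3) q = jTheta q (-q ^ 3) *
      (appellSum (q ^ 5) Q (q ^ 4) + (q ^ 2)⁻¹ * appellSum q⁻¹ Q (q ^ 4)) := by
    have c5 : jTheta (q ^ 4) Q * appellSum (q ^ 5) Q q⁻¹ = _ := sub_eq_iff_eq_add.1 c3
    have c6 := sub_eq_iff_eq_add.1 c1
    have c7 := sub_eq_iff_eq_add.1 c2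
    have c8 := sub_eq_iff_eq_add.1 c4
    rw [B, T, mul_add, mul_sub, mul_sub, mul_left_comm _ (-(q ^ 2)⁻¹), mul_left_comm _ q (_ * _),
      mul_left_comm _ (-q) _, mul_left_comm _ (-q⁻¹) _, c5, c6, c7, c8]
    field_simp
    ring
  rw [appellM_eq, JJ, JJ, J]
  simp only [zpow_ofNat]
  rw [← hQdef]
  -- As `j(1;Q) = 0`, the change of `z` from `1` to `q` evaluates the series at `z = 1`.
  have hA0 : appellSum (q ^ 3) Q 1 = -(qPochInf Q Q ^ 3 / jTheta (q ^ 3) Q) := by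
    apply mul_left_cancel₀ j1
    have j4' : jTheta (q ^ (3 + 1)) Q ≠ 0 := j4
    rw [one_mul, ← div_div, div_mul_cancel₀ _ j4'] at A0
    linear_combination -A0
  rw [← hQdef, hA0] at M
  have e4 : ∑' n, psiTerm q n = (jTheta (q ^ 4) Q)⁻¹ * (jTheta (q ^ 4) Q * ∑' n, psiTerm q n) := by
    field_simp
  have em : appellSum q (-q ^ 3) q / jTheta q (-q ^ 3) = (jTheta (q ^ 4) Q)⁻¹ *
      (appellSum (q ^ 5) Q (q ^ 4) + (q ^ 2)⁻¹ * appellSum q⁻¹ Q (q ^ 4)) := by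
    field_simp at hm ⊢
    linear_combination hm
  rw [e4, M, em]
  field_simp
  ring

/-! ### Weighted triple sums of signed powers of `q` -/

/-- A Hecke-type double sum as a sum over all of `ℤ²` with weight `coneWt`. -/
theorem hasSum_heckeF {a b c : ℤ} {x y q : ℂ} (h : Summable (heckeTerm a b c x y q)) :
    HasSum (fun p : ℤ × ℤ => coneWt p.1 p.2 * ((-1) ^ (p.1 + p.2) * x ^ p.1 * y ^ p.2 *
      q ^ (a * choose2 p.1 + b * p.1 * p.2 + c * choose2 p.2))) (heckeF a b c x y q) := by
  refine (hasSum_subtype_iff_of_support_subset (s := {p : ℤ × ℤ | sg p.1 = sg p.2}) ?_).1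
    ((hasSum_congr' fun p => ?_).1 h.hasSum)
  · intro p hp
    by_contra hne
    apply hp
    simp only [Set.mem_ofPred_eq, sg] at hne
    have : coneWt p.1 p.2 = 0 := by
      simp only [coneWt, sg]
      split_ifs at hne ⊢ <;> simp at hne ⊢
    simp [this]
  · obtain ⟨p, hp⟩ := p
    simp only [heckeTerm, heckeBarTerm, Function.comp, coneWt]
    rw [show sg p.2 = sg p.1 from hp.symm]
    ring

theorem pow_zpow_eq (q : ℂ) (m : ℕ) (k : ℤ) : (q ^ m) ^ k = q ^ (m * k) := by
  rw [← zpow_natCast, ← zpow_mul]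

theorem norm_zpow_lt_norm_zpow {q : ℂ} (hq0 : q ≠ 0) (hq : ‖q‖ < 1) {m n : ℤ} (h : m < n) :
    ‖q ^ n‖ < ‖q ^ m‖ := by
  rw [norm_zpow, norm_zpow]
  exact zpow_lt_zpow_right_of_lt_one₀ (norm_pos_iff.2 hq0) hq h

theorem norm_pow_lt_norm_zpow {q : ℂ} (hq0 : q ≠ 0) (hq : ‖q‖ < 1) {α : ℤ} {M : ℕ} (h : α < M) :
    ‖q ^ M‖ < ‖q ^ α‖ := by
  simpa using norm_zpow_lt_norm_zpow hq0 hq h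

theorem norm_zpow_lt_one {q : ℂ} (hq0 : q ≠ 0) (hq : ‖q‖ < 1) {α : ℤ} (h : 0 < α) :
    ‖q ^ α‖ < 1 := by
  simpa using norm_zpow_lt_norm_zpow hq0 hq h

/-- The signed power `(-1)^n q^N`. With it an identity of terms reduces to a congruence between
exponents of `-1` and a quadratic identity between exponents of `q`. -/
noncomputable def signedPow (q : ℂ) (n N : ℤ) : ℂ := (-1) ^ n * q ^ N

theorem signedPow_zero_left (q : ℂ) (N : ℤ) : signedPow q 0 N = q ^ N := by simp [signedPow]

theorem signedPow_ne_zero {q : ℂ} (hq0 : q ≠ 0) (n N : ℤ) : signedPow q n N ≠ 0 :=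
  mul_ne_zero (zpow_ne_zero _ (by norm_num)) (zpow_ne_zero _ hq0)

theorem signedPow_mul {q : ℂ} (hq0 : q ≠ 0) (n N m M : ℤ) :
    signedPow q n N * signedPow q m M = signedPow q (n + m) (N + M) := by
  simp only [signedPow]
  rw [zpow_add₀ (by norm_num), zpow_add₀ hq0]
  ring

theorem signedPow_zpow (q : ℂ) (n N k : ℤ) : signedPow q n N ^ k = signedPow q (n * k) (N * k) := by
  simp only [signedPow]
  rw [mul_zpow, ← zpow_mul, ← zpow_mul]

theorem signedPow_congr {q : ℂ} {n n' N N' : ℤ} (h : (2 : ℤ) ∣ n - n') (h' : N = N') :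
    signedPow q n N = signedPow q n' N' := by
  obtain ⟨k, hk⟩ := h
  rw [signedPow, signedPow, h', show n = n' + 2 * k by omega, zpow_add₀ (by norm_num),
    neg_one_zpow_two_mul, mul_one]

/-- A two-dimensional cone sum of Kronecker type times a theta function, as a triple sum. -/
theorem hasSum_kronecker_theta {q : ℂ} (hq0 : q ≠ 0) (hq : ‖q‖ < 1) {M K : ℕ} (hK : K ≠ 0)
    {α β : ℤ} (hα : 0 < α) (hαM : α < M) (hβ : 0 < β) (hβM : β < M) (η l : ℤ) :
    HasSum (fun p : (ℤ × ℤ) × ℤ => coneWt p.1.1 p.1.2 * signedPow q ((1 + η) * p.2)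
      (α * p.1.1 + β * p.1.2 + M * (p.1.1 * p.1.2) + K * choose2 p.2 + l * p.2))
      (qPochInf (q ^ M) (q ^ M) ^ 3 * jTheta (q ^ (α + β)) (q ^ M) /
        (jTheta (q ^ α) (q ^ M) * jTheta (q ^ β) (q ^ M)) * jTheta (signedPow q η l) (q ^ K)) := by
  have H := hasSum_mul_complex (hasSum_cone_kronecker (q := q ^ M) (a := q ^ α) (b := q ^ β)
    (pow_ne_zero M hq0) (norm_pow_lt_norm_zpow hq0 hq hαM) (norm_zpow_lt_one hq0 hq hα)
    (norm_pow_lt_norm_zpow hq0 hq hβM) (norm_zpow_lt_one hq0 hq hβ))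
    (hasSum_jTheta (pow_ne_zero K hq0) (norm_q_pow_lt hq hK) (signedPow_ne_zero hq0 η l))
  rw [← zpow_add₀ hq0] at H
  refine (hasSum_congr' fun p => ?_).1 H
  simp only [signedPow_zpow, pow_zpow_eq]
  simp only [signedPow]
  rw [add_mul, one_mul, zpow_add₀ (by norm_num : (-1 : ℂ) ≠ 0), zpow_add₀ hq0, zpow_add₀ hq0,
    zpow_add₀ hq0, zpow_add₀ hq0, ← zpow_mul, ← zpow_mul]
  ring

/-- A cone sum of Appell-Lerch type times a theta function, as a triple sum. -/
theorem hasSum_appell_theta {q : ℂ} (hq0 : q ≠ 0) (hq : ‖q‖ < 1) {M K : ℕ} (hK : K ≠ 0)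
    {α : ℤ} (hα : 0 < α) (hαM : α < M) (ε ζ η l : ℤ) :
    HasSum (fun p : (ℤ × ℤ) × ℤ => coneWt p.1.1 p.1.2 *
      signedPow q ((1 + ε) * (p.1.1 + 1) + (1 + η) * p.2)
        (M * choose2 (p.1.1 + 1) + ζ * (p.1.1 + 1) + α * p.1.2 + M * (p.1.1 * p.1.2) +
          K * choose2 p.2 + l * p.2))
      (appellSum (signedPow q ε (α - ζ)) (q ^ M) (signedPow q ε ζ) *
        jTheta (signedPow q η l) (q ^ K)) := by
  have e : signedPow q ε (α - ζ) * signedPow q ε ζ = q ^ α := by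
    rw [signedPow_mul hq0, signedPow_congr (n' := 0) (N' := α) ⟨ε, by ring⟩ (by ring), signedPow]
    simp
  have H := hasSum_mul_complex (hasSum_cone_appell (q := q ^ M) (x := signedPow q ε (α - ζ))
    (z := signedPow q ε ζ) (pow_ne_zero M hq0)
    (by rw [e]; exact norm_pow_lt_norm_zpow hq0 hq hαM)
    (by rw [e]; exact norm_zpow_lt_one hq0 hq hα))
    (hasSum_jTheta (pow_ne_zero K hq0) (norm_q_pow_lt hq hK) (signedPow_ne_zero hq0 η l))
  rw [e] at H
  refine (hasSum_congr' fun p => ?_).1 H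
  simp only [signedPow_zpow, pow_zpow_eq]
  simp only [signedPow]
  generalize p.1.1 + 1 = n
  rw [add_mul, one_mul, add_mul, one_mul, zpow_add₀ (by norm_num : (-1 : ℂ) ≠ 0),
    zpow_add₀ (by norm_num : (-1 : ℂ) ≠ 0) n, zpow_add₀ (by norm_num : (-1 : ℂ) ≠ 0) p.2,
    zpow_add₀ hq0, zpow_add₀ hq0, zpow_add₀ hq0, zpow_add₀ hq0, zpow_add₀ hq0, ← zpow_mul]
  ring

/-! ### The double sum `f_{1,2,1}` as an Appell-Lerch series -/

/-- The general term of `f_{1,2,1}(q³,q⁴,q²) j(q;q⁶)` without its weight. -/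
noncomputable def tripleTerm121 (q : ℂ) (p : ℤ × ℤ × ℤ) : ℂ :=
  signedPow q (p.1 + p.2.1 + p.2.2) (3 * p.1 + 4 * p.2.1 + p.2.2 + 2 * choose2 p.1 +
    4 * (p.1 * p.2.1) + 2 * choose2 p.2.1 + 6 * choose2 p.2.2)

/-- The triple sum for `f_{1,2,1}(q³,q⁴,q²) j(q;q⁶)` splits into a sum of Kronecker type and two of
Appell-Lerch type, all with theta factors of base `q²`. The factors `j(1;q²)` and `j(q⁴;q²)` vanish,
so that one Appell-Lerch series remains. -/
theorem heckeF_121_mul_jTheta {q : ℂ} (hq0 : q ≠ 0) (hq : ‖q‖ < 1) :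
    heckeF 1 2 1 (q ^ 3) (q ^ 4) (q ^ 2) * jTheta q (q ^ 6) =
      appellSum (q ^ 2) (q ^ 6) q * jTheta (q ^ 3) (q ^ 2) := by
  have hm1 : (-1 : ℂ) ≠ 0 := by norm_num
  have hB0 := pow_ne_zero 6 hq0
  have hB := norm_q_pow_lt hq (k := 6) (by norm_num)
  have hb0 := pow_ne_zero 2 hq0
  have hb := norm_q_pow_lt hq (k := 2) (by norm_num)
  let e1 : ℤ × ℤ × ℤ ≃ (ℤ × ℤ) × ℤ := (Equiv.prodAssoc ℤ ℤ ℤ).symm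
  -- Substitutions under which the general terms of the three pieces become `tripleTerm121`.
  let e2 : ℤ × ℤ × ℤ ≃ (ℤ × ℤ) × ℤ :=
    { toFun := fun p => ((p.2.1 - p.2.2, p.1 + p.2.2), 3 * p.2.2 + p.1 - p.2.1)
      invFun := fun p => (2 * p.1.2 - p.2 - p.1.1, 2 * p.1.1 + p.2 - p.1.2, p.2 - p.1.2 + p.1.1)
      left_inv := fun p => by ext <;> simp <;> ring
      right_inv := fun p => by ext <;> simp <;> ring }
  let e3 : ℤ × ℤ × ℤ ≃ (ℤ × ℤ) × ℤ :=
    { toFun := fun p => ((p.2.2 - p.2.1 - 1, p.2.1), p.1 + 2 * p.2.1)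
      invFun := fun p => (p.2 - 2 * p.1.2, p.1.2, p.1.1 + p.1.2 + 1)
      left_inv := fun p => by ext <;> simp; ring
      right_inv := fun p => by ext <;> simp; ring }
  let e4 : ℤ × ℤ × ℤ ≃ (ℤ × ℤ) × ℤ :=
    { toFun := fun p => ((-1 - p.2.2 - p.1, p.1), p.2.1 + 2 * p.1)
      invFun := fun p => (p.1.2, p.2 - 2 * p.1.2, -1 - p.1.1 - p.1.2)
      left_inv := fun p => by ext <;> simp; ring
      right_inv := fun p => by ext <;> simp; ring }
  have H1 := e1.hasSum_iff.2 (hasSum_mul_complex (hasSum_heckeF (heckeF_121 hq0 hq).1)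
    (hasSum_jTheta hB0 hB hq0))
  have H2 := e2.hasSum_iff.2 (hasSum_kronecker_theta hq0 hq (M := 6) (K := 2) (α := 2) (β := 3)
    (by norm_num) (by norm_num) (by norm_num) (by norm_num) (by norm_num) 0 0)
  have H3 := e3.hasSum_iff.2 (hasSum_appell_theta hq0 hq (M := 6) (K := 2) (α := 3)
    (by norm_num) (by norm_num) (by norm_num) 0 1 0 3)
  have H4 := e4.hasSum_iff.2 (hasSum_appell_theta hq0 hq (M := 6) (K := 2) (α := 4)
    (by norm_num) (by norm_num) (by norm_num) 0 5 0 4)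
  have G1 := (hasSum_congr' (g := fun p : ℤ × ℤ × ℤ => coneWt p.1 p.2.1 * tripleTerm121 q p) (by
    rintro ⟨r, s, t⟩
    simp only [Function.comp, e1, Equiv.prodAssoc_symm_apply, tripleTerm121, pow_zpow_eq, signedPow]
    rw [zpow_add₀ hm1 (r + s) t, show 3 * r + 4 * s + t + 2 * choose2 r + 4 * (r * s) +
      2 * choose2 s + 6 * choose2 t = (3 : ℕ) * r + (4 : ℕ) * s + (2 : ℕ) * (1 * choose2 r +
        2 * r * s + 1 * choose2 s) + (6 : ℕ) * choose2 t + t by push_cast; ring, zpow_add₀ hq0,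
      zpow_add₀ hq0, zpow_add₀ hq0, zpow_add₀ hq0]
    ring)).1 H1
  have G2 := (hasSum_congr' (g := fun p : ℤ × ℤ × ℤ => coneWt (p.2.1 - p.2.2) (p.1 + p.2.2) *
      tripleTerm121 q p) (by
    rintro ⟨r, s, t⟩
    refine congrArg _ (signedPow_congr ⟨t - s, ?_⟩ ?_)
    · simp only [e2, Equiv.coe_fn_mk]; ring
    · have a1 := two_mul_choose2 r
      have a2 := two_mul_choose2 s
      have a3 := two_mul_choose2 t
      have a4 := two_mul_choose2 (3 * t + r - s)
      simp only [e2, Equiv.coe_fn_mk]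
      push_cast
      linarith)).1 H2
  have G3 := (hasSum_congr' (g := fun p : ℤ × ℤ × ℤ => coneWt (p.2.2 - p.2.1 - 1) p.2.1 *
      tripleTerm121 q p) (by
    rintro ⟨r, s, t⟩
    refine congrArg _ (signedPow_congr ⟨0, ?_⟩ ?_)
    · simp only [e3, Equiv.coe_fn_mk]; ring
    · have a1 := two_mul_choose2 r
      have a2 := two_mul_choose2 s
      have a3 := two_mul_choose2 t
      have a4 := two_mul_choose2 (t - s - 1 + 1)
      have a5 := two_mul_choose2 (r + 2 * s)
      simp only [e3, Equiv.coe_fn_mk]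
      push_cast
      linarith)).1 H3
  have G4 := (hasSum_congr' (g := fun p : ℤ × ℤ × ℤ => coneWt (-1 - p.2.2 - p.1) p.1 *
      tripleTerm121 q p) (by
    rintro ⟨r, s, t⟩
    refine congrArg _ (signedPow_congr ⟨-t, ?_⟩ ?_)
    · simp only [e4, Equiv.coe_fn_mk]; ring
    · have a1 := two_mul_choose2 r
      have a2 := two_mul_choose2 s
      have a3 := two_mul_choose2 t
      have a4 := two_mul_choose2 (-1 - t - r + 1)
      have a5 := two_mul_choose2 (s + 2 * r)
      simp only [e4, Equiv.coe_fn_mk]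
      push_cast
      linarith)).1 H4
  have key := (G2.add G3).add G4
  -- The weights of `s - t` and `r + t` cancel between the Kronecker piece and the Appell-Lerch
  -- pieces.
  have hw : ∀ p : ℤ × ℤ × ℤ, coneWt (p.2.1 - p.2.2) (p.1 + p.2.2) * tripleTerm121 q p +
      coneWt (p.2.2 - p.2.1 - 1) p.2.1 * tripleTerm121 q p +
      coneWt (-1 - p.2.2 - p.1) p.1 * tripleTerm121 q p =
      coneWt p.1 p.2.1 * tripleTerm121 q p := fun p => by
    have w1 : sg (p.2.2 - p.2.1 - 1) = -sg (p.2.1 - p.2.2) := by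
      rw [← sg_neg_sub_one]; congr 1; ring
    have w2 : sg (-1 - p.2.2 - p.1) = -sg (p.1 + p.2.2) := by
      rw [← sg_neg_sub_one]; congr 1; ring
    simp only [coneWt, w1, w2]
    push_cast
    ring
  rw [hasSum_congr' hw] at key
  have := G1.unique key
  have z2 : jTheta (signedPow q 0 0) (q ^ 2) = 0 := by simpa [signedPow] using jTheta_one _ hb
  have z4 : jTheta (signedPow q 0 4) (q ^ 2) = 0 := by
    have h0 := jTheta_zpow hb0 hb 2
    rwa [show (q ^ 2) ^ (2 : ℤ) = signedPow q 0 4 by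
      rw [pow_zpow_eq, signedPow_zero_left]; norm_num] at h0
  rw [z2, z4, mul_zero, mul_zero, zero_add, add_zero] at this
  rw [this, signedPow_zero_left, signedPow_zero_left, signedPow_zero_left, zpow_one,
    show (3 - 1 : ℤ) = (2 : ℕ) by norm_num, zpow_natCast, zpow_ofNat]

theorem qPochInf_bisect (x : ℂ) {q : ℂ} (hq : ‖q‖ < 1) :
    qPochInf x q = qPochInf x (q ^ 2) * qPochInf (x * q) (q ^ 2) := by
  have hq2 := norm_q_pow_lt hq two_ne_zero
  refine tendsto_nhds_unique ((tendsto_qPoch x hq).comp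
    (tendsto_id.const_mul_atTop' (r := 2) (by norm_num))) ?_
  exact ((tendsto_qPoch _ hq2).mul (tendsto_qPoch _ hq2)).congr fun n => (qPoch_bisect x q n).symm

theorem J_ne_zero {q : ℂ} (hq : ‖q‖ < 1) {m : ℕ} (hm : m ≠ 0) : J m q ≠ 0 :=
  qPochInf_self_ne_zero (norm_q_pow_lt hq hm)

theorem heckeF_121_eq_appellM {q : ℂ} (hq0 : q ≠ 0) (hq : ‖q‖ < 1) :
    J 2 q / J 1 q ^ 2 * heckeF 1 2 1 (q ^ 3) (q ^ 4) (q ^ 2) =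
      -q⁻¹ * appellM (q ^ 2) (q ^ 6) q := by
  have h := heckeF_121_mul_jTheta hq0 hq
  have h6 : jTheta q (q ^ 6) ≠ 0 := by
    simpa using jTheta_pow_ne_zero hq0 hq (M := 6) (k := 1) (by norm_num) (by norm_num)
  have h3 : jTheta (q ^ 3) (q ^ 2) = -q⁻¹ * jTheta q (q ^ 2) := by
    rw [← jTheta_mul_left (pow_ne_zero 2 hq0) (norm_q_pow_lt hq two_ne_zero) hq0]
    ring_nf
  have h1 : J 1 q ^ 2 = jTheta q (q ^ 2) * J 2 q := by
    have e : q ^ 2 / q = q := by field_simp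
    rw [J, J, pow_one, qPochInf_bisect q hq, jTheta, e, ← pow_two]
    ring
  have n1 := J_ne_zero hq one_ne_zero
  have n2 := J_ne_zero hq two_ne_zero
  have n3 : jTheta q (q ^ 2) ≠ 0 := left_ne_zero_of_mul (h1 ▸ pow_ne_zero 2 n1)
  rw [appellM_eq, h1]
  rw [h3] at h
  field_simp at h ⊢
  linear_combination h

/-- Reduction of the theta quotient to base `q⁶`: all products are expressed through `J_2`, `J_6`
and `(±q^k;q^6)_∞`, which are subject to the relations `r2` and `r6` below. -/
theorem jTheta_quotient_eq_eta {q : ℂ} (hq0 : q ≠ 0) (hq : ‖q‖ < 1) :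
    J 6 q ^ 3 * jTheta (-q) (q ^ 6) * jTheta (-q ^ 3) (q ^ 6) /
      (jTheta (-1) (q ^ 6) * jTheta q (q ^ 6) * jTheta (-q ^ 2) (q ^ 6) * jTheta (q ^ 3) (q ^ 6)) =
    1 / 2 * (J 2 q ^ 4 * J 6 q ^ 5 / (J 1 q ^ 2 * J 3 q ^ 2 * J 4 q ^ 2 * J 12 q ^ 2)) := by
  have hlt := fun {k : ℕ} (h : k ≠ 0) => norm_q_pow_lt hq h
  have n1 := J_ne_zero hq one_ne_zero
  have n2 := J_ne_zero hq two_ne_zero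
  have n3 := J_ne_zero hq three_ne_zero
  have n4 := J_ne_zero hq four_ne_zero
  have n6 := J_ne_zero hq (m := 6) (by norm_num)
  have n12 := J_ne_zero hq (m := 12) (by norm_num)
  have j1 : J 1 q = qPochInf q (q ^ 6) * qPochInf (q ^ 3) (q ^ 6) * qPochInf (q ^ 5) (q ^ 6) *
      J 2 q := by
    rw [J, J, pow_one, qPochInf_bisect q hq, qPochInf_trisect q (hlt two_ne_zero)]
    ring_nf
  have j3 : J 3 q = qPochInf (q ^ 3) (q ^ 6) * J 6 q := by
    rw [J, J, qPochInf_bisect _ (hlt three_ne_zero)]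
    ring_nf
  have j12 : J 12 q = J 6 q * qPochInf (-q ^ 6) (q ^ 6) := by
    rw [J, J, qPochInf_mul_qPochInf_neg _ (hlt (by norm_num))]
    ring_nf
  have j4 : J 4 q = J 2 q * (qPochInf (-q ^ 2) (q ^ 6) * qPochInf (-q ^ 4) (q ^ 6) *
      qPochInf (-q ^ 6) (q ^ 6)) := by
    have t : qPochInf (-q ^ 2) (q ^ 2) = qPochInf (-q ^ 2) (q ^ 6) * qPochInf (-q ^ 4) (q ^ 6) *
      qPochInf (-q ^ 6) (q ^ 6) := by
      rw [qPochInf_trisect _ (hlt two_ne_zero)]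
      ring_nf
    rw [← t, J, J, qPochInf_mul_qPochInf_neg _ (hlt two_ne_zero)]
    ring_nf
  -- Two relations between the products, both of the form `(x;Q)_∞ (-x;Q)_∞ = (x²;Q²)_∞`.
  have r6 : qPochInf (q ^ 3) (q ^ 6) * qPochInf (-q ^ 3) (q ^ 6) * J 12 q = J 6 q := by
    rw [qPochInf_mul_qPochInf_neg _ (hlt (by norm_num)), J, J, qPochInf_bisect (q ^ 6) (hlt _)]
    · ring_nf
    · norm_num
  have r2 : qPochInf q (q ^ 6) * qPochInf (q ^ 3) (q ^ 6) * qPochInf (q ^ 5) (q ^ 6) *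
      (qPochInf (-q) (q ^ 6) * qPochInf (-q ^ 3) (q ^ 6) * qPochInf (-q ^ 5) (q ^ 6)) * J 4 q =
      J 2 q := by
    have t1 : qPochInf q (q ^ 2) = qPochInf q (q ^ 6) * qPochInf (q ^ 3) (q ^ 6) *
        qPochInf (q ^ 5) (q ^ 6) := by
      rw [qPochInf_trisect _ (hlt two_ne_zero)]
      ring_nf
    have t2 : qPochInf (-q) (q ^ 2) = qPochInf (-q) (q ^ 6) * qPochInf (-q ^ 3) (q ^ 6) *
        qPochInf (-q ^ 5) (q ^ 6) := by
      rw [qPochInf_trisect _ (hlt two_ne_zero)]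
      ring_nf
    rw [← t1, ← t2, qPochInf_mul_qPochInf_neg _ (hlt two_ne_zero), J, J,
      qPochInf_bisect (q ^ 2) (hlt two_ne_zero)]
    ring_nf
  have m1 : qPochInf (-1) (q ^ 6) = 2 * qPochInf (-q ^ 6) (q ^ 6) := by
    rw [qPochInf_eq_mul _ (hlt (by norm_num))]
    norm_num
  have t1 : jTheta q (q ^ 6) = qPochInf q (q ^ 6) * qPochInf (q ^ 5) (q ^ 6) * J 6 q := by
    rw [jTheta, J, show q ^ 6 / q = q ^ 5 by field_simp]
  have t2 : jTheta (-q) (q ^ 6) = qPochInf (-q) (q ^ 6) * qPochInf (-q ^ 5) (q ^ 6) * J 6 q := by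
    rw [jTheta, J, show q ^ 6 / -q = -q ^ 5 by field_simp]
  have t3 : jTheta (q ^ 3) (q ^ 6) = qPochInf (q ^ 3) (q ^ 6) ^ 2 * J 6 q := by
    rw [jTheta, J, show q ^ 6 / q ^ 3 = q ^ 3 by field_simp, pow_two]
  have t4 : jTheta (-q ^ 3) (q ^ 6) = qPochInf (-q ^ 3) (q ^ 6) ^ 2 * J 6 q := by
    rw [jTheta, J, show q ^ 6 / -q ^ 3 = -q ^ 3 by field_simp, pow_two (qPochInf _ _)]
  have t5 : jTheta (-q ^ 2) (q ^ 6) = qPochInf (-q ^ 2) (q ^ 6) * qPochInf (-q ^ 4) (q ^ 6) *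
      J 6 q := by
    rw [jTheta, J, show q ^ 6 / -q ^ 2 = -q ^ 4 by field_simp]
  have t6 : jTheta (-1) (q ^ 6) = 2 * qPochInf (-q ^ 6) (q ^ 6) ^ 2 * J 6 q := by
    rw [jTheta, J, show q ^ 6 / -1 = -q ^ 6 by field_simp, m1]
    ring
  rw [t1, t2, t3, t4, t5, t6]
  rw [j12] at r6 n12 ⊢
  rw [j4] at r2 n4 ⊢
  rw [j3] at n3 ⊢
  rw [j1] at n1 ⊢
  generalize J 2 q = F at *
  generalize J 6 q = E at *
  generalize qPochInf q (q ^ 6) = u at *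
  generalize qPochInf (q ^ 3) (q ^ 6) = w at *
  generalize qPochInf (q ^ 5) (q ^ 6) = v at *
  generalize qPochInf (-q) (q ^ 6) = u' at *
  generalize qPochInf (-q ^ 3) (q ^ 6) = w' at *
  generalize qPochInf (-q ^ 5) (q ^ 6) = v' at *
  generalize qPochInf (-q ^ 2) (q ^ 6) = c at *
  generalize qPochInf (-q ^ 4) (q ^ 6) = d at *
  generalize qPochInf (-q ^ 6) (q ^ 6) = e at *
  simp only [mul_ne_zero_iff] at n1 n3 n4 n12
  obtain ⟨⟨⟨hu, hw⟩, hv⟩, -⟩ := n1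
  obtain ⟨-, ⟨hc, hd⟩, he⟩ := n4
  have r6' : e * w * w' = 1 := mul_left_cancel₀ n6 (by linear_combination r6)
  have r2' : c * d * e * u * v * w * u' * v' * w' = 1 :=
    mul_left_cancel₀ n2 (by linear_combination r2)
  have key : u' * v' * w' ^ 2 * u * v * c * d * w ^ 2 * e ^ 2 = 1 := by
    linear_combination e * w * w' * r2' + r6'
  field_simp
  linear_combination key

theorem neg_zpow_ne_one_of_norm_lt {q : ℂ} (hq : ‖q‖ < 1) (k : ℤ) : -q ^ k ≠ 1 := fun h => by
  rcases eq_or_ne k 0 with rfl | hk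
  · norm_num at h
  · refine zpow_ne_one_of_norm_lt hq (k := 2 * k) (by omega) ?_
    rw [mul_comm, zpow_mul, zpow_ofNat, ← neg_sq, h, one_pow]

theorem jTheta_neg_zpow_ne_zero {q : ℂ} (hq0 : q ≠ 0) (hq : ‖q‖ < 1) {M : ℕ} (hM : M ≠ 0) (k : ℤ) :
    jTheta (-q ^ k) (q ^ M) ≠ 0 := by
  refine jTheta_ne_zero (pow_ne_zero M hq0) (norm_q_pow_lt hq hM)
    (neg_ne_zero.2 (zpow_ne_zero k hq0)) fun l hl => ?_
  refine neg_zpow_ne_one_of_norm_lt hq (k - M * l) ?_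
  rw [zpow_sub₀ hq0, ← neg_div, hl, pow_zpow_eq, div_self (zpow_ne_zero _ hq0)]

/-- The change of the theta parameter from `q` to `-1` in `m(q²,q⁶,z)`. -/
theorem appellM_two_six_change_z {q : ℂ} (hq0 : q ≠ 0) (hq : ‖q‖ < 1) :
    -q⁻¹ * appellM (q ^ 2) (q ^ 6) q = -q⁻¹ * appellM (q ^ 2) (q ^ 6) (-1) +
      1 / 2 * q⁻¹ * (J 2 q ^ 4 * J 6 q ^ 5 /
        (J 1 q ^ 2 * J 3 q ^ 2 * J 4 q ^ 2 * J 12 q ^ 2)) := by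
  have hQ0 := pow_ne_zero 6 hq0
  have hQ := norm_q_pow_lt hq (k := 6) (by norm_num)
  have hlt := fun {m n : ℕ} (h : m < n) => norm_pow_lt_norm_pow hq0 hq h
  have hlt1 := fun {k : ℕ} (h : k ≠ 0) => norm_q_pow_lt hq h
  have a0 : q ^ 2 * -1 = -q ^ 2 := by ring
  have a1 : q ^ 2 * q = q ^ 3 := by ring
  have a2 : -q ^ 2 * q = -q ^ 3 := by ring
  have c := appell_change_z (x := q ^ 2) (q := q ^ 6) (z₀ := -1) (z₁ := q) hQ0
    (by rw [a0, norm_neg]; exact hlt (by norm_num))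
    (by rw [a0, norm_neg]; exact hlt1 (by norm_num))
    (by rw [a1]; exact hlt (by norm_num)) (by rw [a1]; exact hlt1 (by norm_num))
  change _ * appellSum _ _ _ - _ * appellSum _ _ _ = _ at c
  rw [a0, a1, a2, div_neg, div_one] at c
  have e := jTheta_quotient_eq_eta hq0 hq
  have n1 : jTheta q (q ^ 6) ≠ 0 := by
    simpa using jTheta_pow_ne_zero hq0 hq (M := 6) (k := 1) (by norm_num) (by norm_num)
  have n2 := jTheta_pow_ne_zero hq0 hq (M := 6) (k := 3) (by norm_num) (by norm_num)
  have m := jTheta_neg_zpow_ne_zero hq0 hq (M := 6) (by norm_num)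
  have n3 : jTheta (-1) (q ^ 6) ≠ 0 := by simpa using m 0
  have n4 : jTheta (-q ^ 2) (q ^ 6) ≠ 0 := by simpa using m 2
  rw [mul_assoc (1 / 2), mul_left_comm (1 / 2), ← e, appellM_eq, appellM_eq]
  have key : appellSum (q ^ 2) (q ^ 6) q / jTheta q (q ^ 6) -
      appellSum (q ^ 2) (q ^ 6) (-1) / jTheta (-1) (q ^ 6) =
      -(J 6 q ^ 3 * jTheta (-q) (q ^ 6) * jTheta (-q ^ 3) (q ^ 6) /
      (jTheta (-1) (q ^ 6) * jTheta q (q ^ 6) * jTheta (-q ^ 2) (q ^ 6) *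
        jTheta (q ^ 3) (q ^ 6))) := by
    rw [div_sub_div _ _ n1 n3, mul_comm (appellSum _ _ q), c, J]
    field_simp
  linear_combination -q⁻¹ * key

/-! ### The double sum `f_{3,5,3}` as a combination of Appell-Lerch series -/

theorem hasSum_mod_two_snd {X : Type*} {f : ℤ × ℤ × X → ℂ} {a₀ a₁ : ℂ}
    (h₀ : HasSum (fun p : ℤ × ℤ × X => f (p.1, 2 * p.2.1, p.2.2)) a₀)
    (h₁ : HasSum (fun p : ℤ × ℤ × X => f (p.1, 2 * p.2.1 + 1, p.2.2)) a₁) :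
    HasSum f (a₀ + a₁) := by
  let e : ℤ × ℤ × X ≃ ℤ × ℤ × X :=
    { toFun := fun p => (p.2.1, p.1, p.2.2)
      invFun := fun p => (p.2.1, p.1, p.2.2)
      left_inv := fun _ => rfl
      right_inv := fun _ => rfl }
  have he : ∀ p, e p = (p.2.1, p.1, p.2.2) := fun _ => rfl
  have k₀ := (e.hasSum_iff (f := fun p => f (p.2.1, 2 * p.1, p.2.2))).1
    (by simpa only [Function.comp_def, he] using h₀)
  have k₁ := (e.hasSum_iff (f := fun p => f (p.2.1, 2 * p.1 + 1, p.2.2))).1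
    (by simpa only [Function.comp_def, he] using h₁)
  have k := e.hasSum_iff.2 (hasSum_mod_two (f := fun p => f (p.2.1, p.1, p.2.2)) k₀ k₁)
  simpa only [Function.comp_def, he] using k

theorem hasSum_mod_three {X : Type*} {f : ℤ × X → ℂ} {a₀ a₁ a₂ : ℂ}
    (h₀ : HasSum (fun p : ℤ × X => f (3 * p.1, p.2)) a₀)
    (h₁ : HasSum (fun p : ℤ × X => f (3 * p.1 + 1, p.2)) a₁)
    (h₂ : HasSum (fun p : ℤ × X => f (3 * p.1 + 2, p.2)) a₂) : HasSum f (a₀ + a₁ + a₂) := by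
  have := hasSum_residues (N := 3) (f := f) (a := ![a₀, a₁, a₂]) fun i => by
    fin_cases i
    · simpa using h₀
    · simpa using h₁
    · simpa using h₂
  simpa [Fin.sum_univ_three] using this

/-- The sign of an integer is that of its quotient by `N`. -/
theorem sg_mul_add {N : ℕ} (m : ℤ) {a : ℤ} (ha : 0 ≤ a) (ha' : a < N) : sg (N * m + a) = sg m := by
  simp only [sg]
  have : 0 ≤ N * m + a ↔ 0 ≤ m := by
    constructor
    · intro h
      by_contra hm
      nlinarith
    · intro h
      positivity
  simp [this]

theorem coneWt_comm (r s : ℤ) : coneWt r s = coneWt s r := by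
  rw [coneWt, coneWt, add_comm]

theorem coneWt_mul_add (N : ℕ) (m l : ℤ) {a b : ℤ} (ha : 0 ≤ a) (ha' : a < N) (hb : 0 ≤ b)
    (hb' : b < N) : coneWt (N * m + a) (N * l + b) = coneWt m l := by
  rw [coneWt, coneWt, sg_mul_add m ha ha', sg_mul_add l hb hb']

/-- The general term of `f_{3,5,3}(q⁴,q⁵,q) j(-1;q⁴⁸)` without its weight. -/
noncomputable def tripleTerm353 (q : ℂ) (p : ℤ × ℤ × ℤ) : ℂ :=
  signedPow q (p.1 + p.2.1) (4 * p.1 + 5 * p.2.1 + 3 * choose2 p.1 + 5 * (p.1 * p.2.1) +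
    3 * choose2 p.2.1 + 48 * choose2 p.2.2)

theorem hasSum_tripleTerm353 {q : ℂ} (hq0 : q ≠ 0) (hq : ‖q‖ < 1) :
    HasSum (fun p : ℤ × ℤ × ℤ => coneWt p.1 p.2.1 * tripleTerm353 q p)
      (heckeF 3 5 3 (q ^ 4) (q ^ 5) q * jTheta (-1) (q ^ 48)) := by
  refine (hasSum_congr' ?_).1 ((Equiv.prodAssoc ℤ ℤ ℤ).symm.hasSum_iff.2
    (hasSum_mul_complex (hasSum_heckeF (heckeF_353 hq0 hq).1)
    (hasSum_jTheta (x := -1) (pow_ne_zero 48 hq0) (norm_q_pow_lt hq (by norm_num)) (by norm_num))))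
  rintro ⟨r, s, t⟩
  simp only [Function.comp, Equiv.prodAssoc_symm_apply, tripleTerm353, pow_zpow_eq, signedPow]
  rw [mul_right_comm ((-1) ^ t), ← mul_zpow, show (-1 : ℂ) * -1 = 1 by norm_num, one_zpow, one_mul,
    show 4 * r + 5 * s + 3 * choose2 r + 5 * (r * s) + 3 * choose2 s + 48 * choose2 t =
      (4 : ℕ) * r + (5 : ℕ) * s + (3 * choose2 r + 5 * r * s + 3 * choose2 s) +
        (48 : ℕ) * choose2 t by push_cast; ring]
  generalize 3 * choose2 r + 5 * r * s + 3 * choose2 s = N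
  rw [zpow_add₀ hq0, zpow_add₀ hq0, zpow_add₀ hq0]
  ring

/-- The summands with `r = 3m + i` of the piece of weight `coneWt r (-r - 3t)`. With `s = v - 5m`
and `t = -k - m - d`, where `d` is `i/3` rounded up, the weight becomes `coneWt k m`, and `h` states
that the exponent of `q` separates into an Appell-Lerch part in `(k, m)` and a theta part in `v`. -/
theorem hasSum_tripleTerm353_fst {q : ℂ} (hq0 : q ≠ 0) (hq : ‖q‖ < 1) {α i d : ℤ} (hα : 0 < α)
    (hα' : α < 48) (hi : 0 ≤ i) (hi' : i < 3) (hd : i ≤ 3 * d) (hd' : 3 * d - i < 3)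
    {ζ l c : ℤ} (h : ∀ k m v : ℤ, 4 * (3 * m + i) + 5 * (v - 5 * m) + 3 * choose2 (3 * m + i) +
      5 * ((3 * m + i) * (v - 5 * m)) + 3 * choose2 (v - 5 * m) + 48 * choose2 (-k - m - d) =
      c + (48 * choose2 (k + 1) + ζ * (k + 1) + α * m + 48 * (k * m) + 3 * choose2 v + l * v)) :
    HasSum (fun p : ℤ × ℤ × ℤ => coneWt (3 * p.1 + i) (-(3 * p.1 + i) - 3 * p.2.2) *
      tripleTerm353 q (3 * p.1 + i, p.2)) (signedPow q i c * (appellSum (signedPow q 1 (α - ζ))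
        (q ^ 48) (signedPow q 1 ζ) *
          jTheta (signedPow q 0 l) (q ^ 3))) := by
  let e : ℤ × ℤ × ℤ ≃ (ℤ × ℤ) × ℤ :=
    { toFun := fun p => ((-p.2.2 - p.1 - d, p.1), p.2.1 + 5 * p.1)
      invFun := fun p => (p.1.2, p.2 - 5 * p.1.2, -p.1.1 - p.1.2 - d)
      left_inv := fun p => by ext <;> simp; ring
      right_inv := fun p => by ext <;> simp; ring }
  refine (hasSum_congr' fun p => ?_).1 (e.hasSum_iff.2 ((hasSum_appell_theta hq0 hq (M := 48)
    (K := 3) (by norm_num) hα (by exact_mod_cast hα') 1 ζ 0 l).mul_left (signedPow q i c)))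
  obtain ⟨⟨⟨k, m⟩, v⟩, rfl⟩ := e.symm.surjective p
  rw [Function.comp, e.apply_symm_apply, mul_left_comm, signedPow_mul hq0]
  change coneWt k m * _ = coneWt (3 * m + i) (-(3 * m + i) - 3 * (-k - m - d)) *
    tripleTerm353 q (3 * m + i, v - 5 * m, -k - m - d)
  rw [show -(3 * m + i) - 3 * (-k - m - d) = (3 : ℕ) * k + (3 * d - i) by push_cast; ring,
    show 3 * m + i = (3 : ℕ) * m + i by rfl,
    coneWt_mul_add 3 m k hi hi' (by linarith) (by exact_mod_cast hd'), coneWt_comm, tripleTerm353]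
  refine congrArg _ (signedPow_congr ⟨k + 1 + m, ?_⟩ ?_)
  · push_cast; ring
  · exact (h k m v).symm

/-- The summands with `s = 3m + i` of the piece of weight `coneWt s (3t - s - 2)`. With `r = v - 5m`
and `t = k + m + d`, where `d` is `(i + 2)/3` rounded up, the weight becomes `coneWt k m`, and `h`
states that the exponent of `q` separates into an Appell-Lerch part in `(k, m)` and a theta part in
`v`. -/
theorem hasSum_tripleTerm353_snd {q : ℂ} (hq0 : q ≠ 0) (hq : ‖q‖ < 1) {α i d : ℤ} (hα : 0 < α)
    (hα' : α < 48) (hi : 0 ≤ i) (hi' : i < 3) (hd : i + 2 ≤ 3 * d) (hd' : 3 * d - i - 2 < 3)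
    {ζ l c : ℤ} (h : ∀ k m v : ℤ, 4 * (v - 5 * m) + 5 * (3 * m + i) + 3 * choose2 (v - 5 * m) +
      5 * ((v - 5 * m) * (3 * m + i)) + 3 * choose2 (3 * m + i) + 48 * choose2 (k + m + d) =
      c + (48 * choose2 (k + 1) + ζ * (k + 1) + α * m + 48 * (k * m) + 3 * choose2 v + l * v)) :
    HasSum (fun p : ℤ × ℤ × ℤ => coneWt (3 * p.1 + i) (3 * p.2.2 - (3 * p.1 + i) - 2) *
      tripleTerm353 q (p.2.1, 3 * p.1 + i, p.2.2)) (signedPow q i c * (appellSum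
        (signedPow q 1 (α - ζ)) (q ^ 48) (signedPow q 1 ζ) *
          jTheta (signedPow q 0 l) (q ^ 3))) := by
  let e : ℤ × ℤ × ℤ ≃ (ℤ × ℤ) × ℤ :=
    { toFun := fun p => ((p.2.2 - p.1 - d, p.1), p.2.1 + 5 * p.1)
      invFun := fun p => (p.1.2, p.2 - 5 * p.1.2, p.1.1 + p.1.2 + d)
      left_inv := fun p => by ext <;> simp; ring
      right_inv := fun p => by ext <;> simp; ring }
  refine (hasSum_congr' fun p => ?_).1 (e.hasSum_iff.2 ((hasSum_appell_theta hq0 hq (M := 48)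
    (K := 3) (by norm_num) hα (by exact_mod_cast hα') 1 ζ 0 l).mul_left (signedPow q i c)))
  obtain ⟨⟨⟨k, m⟩, v⟩, rfl⟩ := e.symm.surjective p
  rw [Function.comp, e.apply_symm_apply, mul_left_comm, signedPow_mul hq0]
  change coneWt k m * _ = coneWt (3 * m + i) (3 * (k + m + d) - (3 * m + i) - 2) *
    tripleTerm353 q (v - 5 * m, 3 * m + i, k + m + d)
  rw [show 3 * (k + m + d) - (3 * m + i) - 2 = (3 : ℕ) * k + (3 * d - i - 2) by push_cast; ring,
    show 3 * m + i = (3 : ℕ) * m + i by rfl,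
    coneWt_mul_add 3 m k hi hi' (by linarith) (by exact_mod_cast hd'), coneWt_comm, tripleTerm353]
  refine congrArg _ (signedPow_congr ⟨k + 1 + m, ?_⟩ ?_)
  · push_cast; ring
  · exact (h k m v).symm

/-- The summands with `s - 3t + 1 = 2R + j` and `r + 3t - 1 = 2S + 1 - i` of the piece that has
these two numbers as arguments of its weight. With `t = 1 - S + i + R - u` the weight becomes
`coneWt R S`, and `h` states that the exponent of `q` separates into a Kronecker part in `(R, S)`
and a theta part in `u`. -/
theorem hasSum_tripleTerm353_theta {q : ℂ} (hq0 : q ≠ 0) (hq : ‖q‖ < 1) {α β i j : ℤ} (hα : 0 < α)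
    (hα' : α < 32) (hβ : 0 < β) (hβ' : β < 32) (hi : 0 ≤ i) (hi' : i < 2) (hj : 0 ≤ j)
    (hj' : j < 2) {l c : ℤ} (h : ∀ R S u : ℤ,
      4 * (2 * S - i + 2 - 3 * (1 - S + i + R - u)) +
      5 * (2 * R + j - 1 + 3 * (1 - S + i + R - u)) +
      3 * choose2 (2 * S - i + 2 - 3 * (1 - S + i + R - u)) +
      5 * ((2 * S - i + 2 - 3 * (1 - S + i + R - u)) * (2 * R + j - 1 + 3 * (1 - S + i + R - u))) +
      3 * choose2 (2 * R + j - 1 + 3 * (1 - S + i + R - u)) + 48 * choose2 (1 - S + i + R - u) =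
      c + (α * R + β * S + 32 * (R * S) + 12 * choose2 u + l * u)) :
    HasSum (fun p : ℤ × ℤ × ℤ => coneWt (2 * p.2.1 + j) (2 * p.1 + i + 1) *
      tripleTerm353 q (2 * p.1 + i + 2 - 3 * p.2.2, 2 * p.2.1 + j - 1 + 3 * p.2.2, p.2.2))
      (signedPow q (1 + i + j) c * (J 32 q ^ 3 * jTheta (q ^ (α + β)) (q ^ 32) /
        (jTheta (q ^ α) (q ^ 32) * jTheta (q ^ β) (q ^ 32)) *
          jTheta (signedPow q 1 l) (q ^ 12))) := by
  let e : ℤ × ℤ × ℤ ≃ (ℤ × ℤ) × ℤ :=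
    { toFun := fun p => ((p.2.1, p.1 + i), 1 - p.1 + p.2.1 - p.2.2)
      invFun := fun p => (p.1.2 - i, p.1.1, 1 - p.1.2 + i + p.1.1 - p.2)
      left_inv := fun p => by ext <;> simp; ring
      right_inv := fun p => by ext <;> simp; ring }
  refine (hasSum_congr' fun p => ?_).1 (e.hasSum_iff.2 ((hasSum_kronecker_theta hq0 hq (M := 32)
    (K := 12) (by norm_num) hα (by exact_mod_cast hα') hβ (by exact_mod_cast hβ') 1 l).mul_left
      (signedPow q (1 + i + j) c)))
  obtain ⟨⟨⟨R, S⟩, u⟩, rfl⟩ := e.symm.surjective p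
  rw [Function.comp, e.apply_symm_apply, mul_left_comm, signedPow_mul hq0]
  change coneWt R S * _ = coneWt (2 * R + j) (2 * (S - i) + i + 1) * tripleTerm353 q
    (2 * (S - i) + i + 2 - 3 * (1 - S + i + R - u), 2 * R + j - 1 + 3 * (1 - S + i + R - u),
      1 - S + i + R - u)
  rw [show 2 * (S - i) + i + 1 = (2 : ℕ) * S + (1 - i) by push_cast; ring,
    show 2 * (S - i) + i + 2 = 2 * S - i + 2 by ring, show 2 * R + j = (2 : ℕ) * R + j by rfl,
    coneWt_mul_add 2 R S hj hj' (by linarith) (by push_cast; linarith), tripleTerm353]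
  refine congrArg _ (signedPow_congr ⟨u + i - S - R, ?_⟩ ?_)
  · push_cast; ring
  · exact (h R S u).symm

theorem J_one_eq_jTheta {q : ℂ} (hq0 : q ≠ 0) (hq : ‖q‖ < 1) : jTheta q (q ^ 3) = J 1 q := by
  rw [J, pow_one, qPochInf_trisect q hq, jTheta, show q ^ 3 / q = q * q by field_simp]
  ring_nf

theorem J_one_eq_jTheta_sq {q : ℂ} (hq0 : q ≠ 0) (hq : ‖q‖ < 1) :
    jTheta (q ^ 2) (q ^ 3) = J 1 q := by
  rw [← J_one_eq_jTheta hq0 hq, ← jTheta_div (x := q) (pow_ne_zero 3 hq0)]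
  congr 1
  field_simp

theorem appellSum_neg_one_of_zero {q : ℂ} (α : ℤ) :
    appellSum (signedPow q 1 (α - 0)) (q ^ 48) (signedPow q 1 0) =
      appellSum (-q ^ α) (q ^ 48) (-1) := by
  simp [signedPow]

/-- The classes with `ζ = 48` give Appell-Lerch series at `z = -q^{48}`, which the reflection moves
to `z = -1`. -/
theorem appellSum_neg_one_of_reflect {q : ℂ} (hq0 : q ≠ 0) (hq : ‖q‖ < 1) {α : ℤ} (hα : 0 < α)
    (hα' : α < 48) :
    appellSum (signedPow q 1 (α - 48)) (q ^ 48) (signedPow q 1 48) =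
      -q ^ (48 - α) * appellSum (-q ^ (48 - α)) (q ^ 48) (-1) := by
  have hQ := pow_ne_zero 48 hq0
  have e1 : signedPow q 1 (α - 48) = (-q ^ (48 - α))⁻¹ := by
    rw [signedPow, ← neg_sub 48 α, zpow_neg, zpow_one, neg_one_mul, inv_neg]
  have e2 : signedPow q 1 48 = -q ^ 48 := by simp [signedPow]
  have n1 := neg_ne_zero.2 (zpow_ne_zero (48 - α) hq0)
  rw [appellSum_reflect hQ (signedPow_ne_zero hq0 _ _) (signedPow_ne_zero hq0 _ _) fun k => ?_, e1,
    e2, inv_inv, div_neg, div_self hQ]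
  rw [signedPow_mul hq0, pow_zpow_eq, signedPow, mul_assoc, ← zpow_add₀ hq0]
  norm_num
  exact zpow_ne_one_of_norm_lt hq (by omega)

/-- The piece of weight `coneWt r (-r - 3t)`: the classes `r ≡ 0, 1` modulo `3` give two of the four
Appell-Lerch series, and the class `r ≡ 2` vanishes because of the factor `j(q^{15};q^3)`. -/
theorem hasSum_tripleTerm353_mod_fst {q : ℂ} (hq0 : q ≠ 0) (hq : ‖q‖ < 1) :
    HasSum (fun p : ℤ × ℤ × ℤ => coneWt p.1 (-p.1 - 3 * p.2.2) * tripleTerm353 q p)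
      (-J 1 q * ((q ^ 2)⁻¹ * appellSum (-q ^ 14) (q ^ 48) (-1) +
        (q ^ 6)⁻¹ * appellSum (-q ^ 2) (q ^ 48) (-1))) := by
  have hb0 := pow_ne_zero 3 hq0
  have hb := norm_q_pow_lt hq three_ne_zero
  have h0 := hasSum_tripleTerm353_fst hq0 hq (α := 14) (i := 0) (d := 0) (ζ := 0) (l := 5) (c := 0)
    (by norm_num) (by norm_num) (by norm_num) (by norm_num) (by norm_num) (by norm_num)
    (fun k m v => by
      have a1 := two_mul_choose2 (3 * m + 0)
      have a2 := two_mul_choose2 (v - 5 * m)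
      have a3 := two_mul_choose2 (-k - m - 0)
      have a4 := two_mul_choose2 (k + 1)
      have a5 := two_mul_choose2 v
      linarith)
  have h1 := hasSum_tripleTerm353_fst hq0 hq (α := 46) (i := 1) (d := 1) (ζ := 48) (l := 10)
    (c := 4) (by norm_num) (by norm_num) (by norm_num) (by norm_num) (by norm_num) (by norm_num)
    (fun k m v => by
      have a1 := two_mul_choose2 (3 * m + 1)
      have a2 := two_mul_choose2 (v - 5 * m)
      have a3 := two_mul_choose2 (-k - m - 1)
      have a4 := two_mul_choose2 (k + 1)
      have a5 := two_mul_choose2 v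
      linarith)
  have h2 := hasSum_tripleTerm353_fst hq0 hq (α := 30) (i := 2) (d := 1) (ζ := 48) (l := 15)
    (c := 11) (by norm_num) (by norm_num) (by norm_num) (by norm_num) (by norm_num) (by norm_num)
    (fun k m v => by
      have a1 := two_mul_choose2 (3 * m + 2)
      have a2 := two_mul_choose2 (v - 5 * m)
      have a3 := two_mul_choose2 (-k - m - 1)
      have a4 := two_mul_choose2 (k + 1)
      have a5 := two_mul_choose2 v
      linarith)
  have t5 : jTheta (signedPow q 0 5) (q ^ 3) = -(q ^ 2)⁻¹ * J 1 q := by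
    rw [← J_one_eq_jTheta_sq hq0 hq, ← jTheta_mul_left hb0 hb (pow_ne_zero 2 hq0), ← pow_add,
      signedPow_zero_left, zpow_ofNat]
  have t10 : jTheta (signedPow q 0 10) (q ^ 3) = -(q ^ 12)⁻¹ * J 1 q := by
    have := jTheta_zpow_mul hb0 hb hq0 3
    rw [J_one_eq_jTheta hq0 hq, show choose2 3 = 3 by rfl] at this
    simp only [zpow_ofNat, ← pow_mul, ← pow_succ] at this
    rw [signedPow_zero_left, zpow_ofNat, this]
    field_simp
  have t15 : jTheta (signedPow q 0 15) (q ^ 3) = 0 := by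
    have := jTheta_zpow hb0 hb 5
    rwa [pow_zpow_eq, ← signedPow_zero_left] at this
  have H := hasSum_mod_three (f := fun p : ℤ × ℤ × ℤ => coneWt p.1 (-p.1 - 3 * p.2.2) *
    tripleTerm353 q p) (by simpa only [add_zero] using h0) h1 h2
  simp only [t5, t10, t15, appellSum_neg_one_of_zero,
    appellSum_neg_one_of_reflect hq0 hq (α := 46) (by norm_num) (by norm_num)] at H
  convert H using 1
  rw [show (48 - 46 : ℤ) = 2 by norm_num]
  simp only [signedPow, zpow_ofNat]
  field_simp
  ring

/-- The piece of weight `coneWt s (3t - s - 2)`: the classes `s ≡ 0, 2` modulo `3` give two of the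
four Appell-Lerch series, and the class `s ≡ 1` vanishes because of the factor `j(q^9;q^3)`. -/
theorem hasSum_tripleTerm353_mod_snd {q : ℂ} (hq0 : q ≠ 0) (hq : ‖q‖ < 1) :
    HasSum (fun p : ℤ × ℤ × ℤ => coneWt p.2.1 (3 * p.2.2 - p.2.1 - 2) * tripleTerm353 q p)
      (-J 1 q * (q⁻¹ * appellSum (-q ^ 22) (q ^ 48) (-1) +
        (q ^ 3)⁻¹ * appellSum (-q ^ 10) (q ^ 48) (-1))) := by
  have hb0 := pow_ne_zero 3 hq0
  have hb := norm_q_pow_lt hq three_ne_zero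
  have h0 := hasSum_tripleTerm353_snd hq0 hq (α := 22) (i := 0) (d := 1) (ζ := 0) (l := 4) (c := 0)
    (by norm_num) (by norm_num) (by norm_num) (by norm_num) (by norm_num) (by norm_num)
    (fun k m v => by
      have a1 := two_mul_choose2 (3 * m + 0)
      have a2 := two_mul_choose2 (v - 5 * m)
      have a3 := two_mul_choose2 (k + m + 1)
      have a4 := two_mul_choose2 (k + 1)
      have a5 := two_mul_choose2 v
      linarith)
  have h1 := hasSum_tripleTerm353_snd hq0 hq (α := 6) (i := 1) (d := 1) (ζ := 0) (l := 9)
    (c := 5) (by norm_num) (by norm_num) (by norm_num) (by norm_num) (by norm_num) (by norm_num)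
    (fun k m v => by
      have a1 := two_mul_choose2 (3 * m + 1)
      have a2 := two_mul_choose2 (v - 5 * m)
      have a3 := two_mul_choose2 (k + m + 1)
      have a4 := two_mul_choose2 (k + 1)
      have a5 := two_mul_choose2 v
      linarith)
  have h2 := hasSum_tripleTerm353_snd hq0 hq (α := 38) (i := 2) (d := 2) (ζ := 48) (l := 14)
    (c := 13) (by norm_num) (by norm_num) (by norm_num) (by norm_num) (by norm_num) (by norm_num)
    (fun k m v => by
      have a1 := two_mul_choose2 (3 * m + 2)
      have a2 := two_mul_choose2 (v - 5 * m)
      have a3 := two_mul_choose2 (k + m + 2)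
      have a4 := two_mul_choose2 (k + 1)
      have a5 := two_mul_choose2 v
      linarith)
  have t4 : jTheta (signedPow q 0 4) (q ^ 3) = -q⁻¹ * J 1 q := by
    rw [← J_one_eq_jTheta hq0 hq, ← jTheta_mul_left hb0 hb hq0, ← pow_succ, signedPow_zero_left,
      zpow_ofNat]
  have t9 : jTheta (signedPow q 0 9) (q ^ 3) = 0 := by
    have := jTheta_zpow hb0 hb 3
    rwa [pow_zpow_eq, ← signedPow_zero_left] at this
  have t14 : jTheta (signedPow q 0 14) (q ^ 3) = (q ^ 26)⁻¹ * J 1 q := by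
    have := jTheta_zpow_mul hb0 hb (pow_ne_zero 2 hq0) 4
    rw [J_one_eq_jTheta_sq hq0 hq, show choose2 4 = 6 by rfl] at this
    simp only [zpow_ofNat, ← pow_mul, ← pow_add] at this
    rw [signedPow_zero_left, zpow_ofNat, this]
    field_simp
    ring
  have H := hasSum_mod_three (f := fun p : ℤ × ℤ × ℤ => coneWt p.1 (3 * p.2.2 - p.1 - 2) *
    tripleTerm353 q (p.2.1, p.1, p.2.2)) (by simpa only [add_zero] using h0) h1 h2
  let e : ℤ × ℤ × ℤ ≃ ℤ × ℤ × ℤ :=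
    { toFun := fun p => (p.2.1, p.1, p.2.2)
      invFun := fun p => (p.2.1, p.1, p.2.2)
      left_inv := fun _ => rfl
      right_inv := fun _ => rfl }
  simp only [t4, t9, t14, appellSum_neg_one_of_zero,
    appellSum_neg_one_of_reflect hq0 hq (α := 38) (by norm_num) (by norm_num)] at H
  replace H : HasSum (fun p : ℤ × ℤ × ℤ => coneWt p.2.1 (3 * p.2.2 - p.2.1 - 2) *
    tripleTerm353 q p) _ := e.hasSum_iff.2 H
  convert H using 1
  rw [show (48 - 38 : ℤ) = 10 by norm_num]
  simp only [signedPow, zpow_ofNat]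
  field_simp
  ring

/-- The four summands of `Φ_{3,2}(q⁴,q⁵,q)`, with arguments of theta functions beyond the base
reduced by quasi-periodicity. -/
theorem jTheta_neg_one_mul_PhiNP {q : ℂ} (hq0 : q ≠ 0) (hq : ‖q‖ < 1) :
    jTheta (-1) (q ^ 48) * PhiNP 3 2 (q ^ 4) (q ^ 5) q = J 32 q ^ 3 *
      (-q ^ 2 * (jTheta (q ^ 28) (q ^ 32) / (jTheta (q ^ 18) (q ^ 32) * jTheta (q ^ 10) (q ^ 32)) *
        jTheta (-(q ^ 3)⁻¹) (q ^ 12)) +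
      q ^ 8 * (jTheta (q ^ 44) (q ^ 32) / (jTheta (q ^ 18) (q ^ 32) * jTheta (q ^ 26) (q ^ 32)) *
        jTheta (-q ^ 3) (q ^ 12)) +
      q ^ 3 * (jTheta (q ^ 12) (q ^ 32) / (jTheta (q ^ 2) (q ^ 32) * jTheta (q ^ 10) (q ^ 32)) *
        jTheta (-(q ^ 9)⁻¹) (q ^ 12)) -
      (q ^ 2)⁻¹ * (jTheta (q ^ 28) (q ^ 32) / (jTheta (q ^ 2) (q ^ 32) * jTheta (q ^ 26) (q ^ 32)) *
        jTheta (-(q ^ 3)⁻¹) (q ^ 12))) := by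
  have hQ0 := pow_ne_zero 32 hq0
  have hQ := norm_q_pow_lt hq (k := 32) (by norm_num)
  have hne := fun {k : ℕ} (hk : ¬ 32 ∣ k) =>
    jTheta_pow_ne_zero hq0 hq (M := 32) (by norm_num) hk
  have n2 := hne (k := 2) (by norm_num)
  have n10 := hne (k := 10) (by norm_num)
  have n18 := hne (k := 18) (by norm_num)
  have n26 := hne (k := 26) (by norm_num)
  have s34 : jTheta (q ^ 34) (q ^ 32) = -(q ^ 2)⁻¹ * jTheta (q ^ 2) (q ^ 32) := by
    rw [← jTheta_mul_left hQ0 hQ (pow_ne_zero 2 hq0), ← pow_add]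
  have s44 : jTheta (q ^ 44) (q ^ 32) = -(q ^ 12)⁻¹ * jTheta (q ^ 12) (q ^ 32) := by
    rw [← jTheta_mul_left hQ0 hQ (pow_ne_zero 12 hq0), ← pow_add]
  have s60 : jTheta (q ^ 60) (q ^ 32) = -(q ^ 28)⁻¹ * jTheta (q ^ 28) (q ^ 32) := by
    rw [← jTheta_mul_left hQ0 hQ (pow_ne_zero 28 hq0), ← pow_add]
  have n48 : jTheta (-1) (q ^ 48) ≠ 0 := by
    simpa using jTheta_neg_zpow_ne_zero hq0 hq (M := 48) (by norm_num) 0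
  have a1 : -(q ^ 4) ^ 3 / (q ^ 5) ^ 3 = -(q ^ 3)⁻¹ := by field_simp
  have a2 : -(q ^ 6 * (q ^ 4) ^ 3) / (q ^ 5) ^ 3 = -q ^ 3 := by field_simp
  have a3 : -((q ^ 6)⁻¹ * (q ^ 4) ^ 3) / (q ^ 5) ^ 3 = -(q ^ 9)⁻¹ := by field_simp
  have b1 : q ^ 10 * (q ^ 4) ^ 2 * (q ^ 5) ^ 2 = q ^ 28 := by ring
  have b2 : q ^ 26 * (q ^ 4) ^ 2 * (q ^ 5) ^ 2 = q ^ 44 := by ring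
  have b3 : q ^ 42 * (q ^ 4) ^ 2 * (q ^ 5) ^ 2 = q ^ 60 := by ring
  have c1 : q ^ 5 * (-q ^ 5) ^ 5 / (-q ^ 4) ^ 3 = q ^ 18 := by field_simp
  have c2 : q ^ 5 * (-q ^ 4) ^ 5 / (-q ^ 5) ^ 3 = q ^ 10 := by field_simp
  have c3 : q ^ 21 * (-q ^ 5) ^ 5 / (-q ^ 4) ^ 3 = q ^ 34 := by field_simp
  have c4 : q ^ 21 * (-q ^ 4) ^ 5 / (-q ^ 5) ^ 3 = q ^ 26 := by field_simp
  simp only [PhiNP, sum_range_succ, sum_range_zero, zero_add]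
  norm_num [choose2]
  rw [JJbar, zpow_zero, zpow_ofNat, a1, a2, a3, b1, b2, b3, c1, c2, c3, c4, s34, s44, s60]
  field_simp
  ring

/-- The piece of weight `coneWt (s - 3t + 1) (r + 3t - 1)`: the four classes of the two arguments
modulo `2` are the four summands of `Φ_{3,2}`. -/
theorem hasSum_tripleTerm353_PhiNP {q : ℂ} (hq0 : q ≠ 0) (hq : ‖q‖ < 1) :
    HasSum (fun p : ℤ × ℤ × ℤ => coneWt (p.2.1 - 3 * p.2.2 + 1) (p.1 + 3 * p.2.2 - 1) *
      tripleTerm353 q p) (jTheta (-1) (q ^ 48) * PhiNP 3 2 (q ^ 4) (q ^ 5) q) := by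
  have h00 := hasSum_tripleTerm353_theta hq0 hq (α := 18) (β := 10) (i := 0) (j := 0) (l := -3)
    (c := 2) (by norm_num) (by norm_num) (by norm_num) (by norm_num) (by norm_num) (by norm_num)
    (by norm_num) (by norm_num) (fun R S u => by
      have a1 := two_mul_choose2 (2 * S - 0 + 2 - 3 * (1 - S + 0 + R - u))
      have a2 := two_mul_choose2 (2 * R + 0 - 1 + 3 * (1 - S + 0 + R - u))
      have a3 := two_mul_choose2 (1 - S + 0 + R - u)
      have a4 := two_mul_choose2 u
      linarith)
  have h01 := hasSum_tripleTerm353_theta hq0 hq (α := 18) (β := 26) (i := 0) (j := 1) (l := 3)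
    (c := 8) (by norm_num) (by norm_num) (by norm_num) (by norm_num) (by norm_num) (by norm_num)
    (by norm_num) (by norm_num) (fun R S u => by
      have a1 := two_mul_choose2 (2 * S - 0 + 2 - 3 * (1 - S + 0 + R - u))
      have a2 := two_mul_choose2 (2 * R + 1 - 1 + 3 * (1 - S + 0 + R - u))
      have a3 := two_mul_choose2 (1 - S + 0 + R - u)
      have a4 := two_mul_choose2 u
      linarith)
  have h10 := hasSum_tripleTerm353_theta hq0 hq (α := 2) (β := 10) (i := 1) (j := 0) (l := -9)
    (c := 3) (by norm_num) (by norm_num) (by norm_num) (by norm_num) (by norm_num) (by norm_num)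
    (by norm_num) (by norm_num) (fun R S u => by
      have a1 := two_mul_choose2 (2 * S - 1 + 2 - 3 * (1 - S + 1 + R - u))
      have a2 := two_mul_choose2 (2 * R + 0 - 1 + 3 * (1 - S + 1 + R - u))
      have a3 := two_mul_choose2 (1 - S + 1 + R - u)
      have a4 := two_mul_choose2 u
      linarith)
  have h11 := hasSum_tripleTerm353_theta hq0 hq (α := 2) (β := 26) (i := 1) (j := 1) (l := -3)
    (c := -2) (by norm_num) (by norm_num) (by norm_num) (by norm_num) (by norm_num) (by norm_num)
    (by norm_num) (by norm_num) (fun R S u => by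
      have a1 := two_mul_choose2 (2 * S - 1 + 2 - 3 * (1 - S + 1 + R - u))
      have a2 := two_mul_choose2 (2 * R + 1 - 1 + 3 * (1 - S + 1 + R - u))
      have a3 := two_mul_choose2 (1 - S + 1 + R - u)
      have a4 := two_mul_choose2 u
      linarith)
  -- The arguments of the weight, up to constants, as new summation variables.
  let e' : ℤ × ℤ × ℤ ≃ ℤ × ℤ × ℤ :=
    { toFun := fun p => (p.1 + 3 * p.2.2 - 2, p.2.1 - 3 * p.2.2 + 1, p.2.2)
      invFun := fun p => (p.1 + 2 - 3 * p.2.2, p.2.1 - 1 + 3 * p.2.2, p.2.2)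
      left_inv := fun p => by ext <;> simp
      right_inv := fun p => by ext <;> simp }
  let F : ℤ × ℤ × ℤ → ℂ := fun p => coneWt p.2.1 (p.1 + 1) *
    tripleTerm353 q (p.1 + 2 - 3 * p.2.2, p.2.1 - 1 + 3 * p.2.2, p.2.2)
  have key : ∀ (i : ℤ) {a₀ a₁ : ℂ},
      HasSum (fun p : ℤ × ℤ × ℤ => F (2 * p.1 + i, 2 * p.2.1 + 0, p.2.2)) a₀ →
      HasSum (fun p : ℤ × ℤ × ℤ => F (2 * p.1 + i, 2 * p.2.1 + 1, p.2.2)) a₁ →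
      HasSum (fun p : ℤ × ℤ × ℤ => F (2 * p.1 + i, p.2)) (a₀ + a₁) := by
    intro i a₀ a₁ k₀ k₁
    simp only [add_zero] at k₀
    exact hasSum_mod_two_snd (f := fun p : ℤ × ℤ × ℤ => F (2 * p.1 + i, p.2)) k₀ k₁
  have H0 := key 0 h00 h01
  have H1 := key 1 h10 h11
  simp only [add_zero] at H0
  have H := e'.hasSum_iff.2 (hasSum_mod_two H0 H1)
  have hF : ∀ p : ℤ × ℤ × ℤ, (F ∘ e') p = coneWt (p.2.1 - 3 * p.2.2 + 1) (p.1 + 3 * p.2.2 - 1) *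
      tripleTerm353 q p := fun ⟨r, s, t⟩ => by
    simp only [F, e', Function.comp, Equiv.coe_fn_mk]
    ring_nf
  replace H := (hasSum_congr' hF).1 H
  convert H using 1
  rw [jTheta_neg_one_mul_PhiNP hq0 hq]
  norm_num [signedPow]
  ring

/-- The double sum `f_{3,5,3}(q⁴,q⁵,q)` as a combination of Appell-Lerch series and theta
quotients. -/
theorem heckeF_353_eq_appellM {q : ℂ} (hq0 : q ≠ 0) (hq : ‖q‖ < 1) :
    1 / J 1 q * heckeF 3 5 3 (q ^ 4) (q ^ 5) q =
      - q⁻¹ * appellM (-q ^ 22) (q ^ 48) (-1) - (q ^ 2)⁻¹ * appellM (-q ^ 14) (q ^ 48) (-1)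
        - (q ^ 3)⁻¹ * appellM (-q ^ 10) (q ^ 48) (-1) - (q ^ 6)⁻¹ * appellM (-q ^ 2) (q ^ 48) (-1)
        + 1 / J 1 q * PhiNP 3 2 (q ^ 4) (q ^ 5) q := by
  have key := ((hasSum_tripleTerm353_PhiNP hq0 hq).add (hasSum_tripleTerm353_mod_fst hq0 hq)).add
    (hasSum_tripleTerm353_mod_snd hq0 hq)
  -- The identity of weights behind the theorem: with `A = s - 3t + 1` and `B = r + 3t - 1` the last
  -- two pieces have the weights `(sg r - sg B) / 2` and `(sg s - sg A) / 2`.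
  have hw : ∀ p : ℤ × ℤ × ℤ,
      coneWt (p.2.1 - 3 * p.2.2 + 1) (p.1 + 3 * p.2.2 - 1) * tripleTerm353 q p +
      coneWt p.1 (-p.1 - 3 * p.2.2) * tripleTerm353 q p +
      coneWt p.2.1 (3 * p.2.2 - p.2.1 - 2) * tripleTerm353 q p =
      coneWt p.1 p.2.1 * tripleTerm353 q p := fun p => by
    have w1 : sg (-p.1 - 3 * p.2.2) = -sg (p.1 + 3 * p.2.2 - 1) := by
      rw [← sg_neg_sub_one]; congr 1; ring
    have w2 : sg (3 * p.2.2 - p.2.1 - 2) = -sg (p.2.1 - 3 * p.2.2 + 1) := by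
      rw [← sg_neg_sub_one]; congr 1; ring
    simp only [coneWt, w1, w2]
    push_cast
    ring
  have h := (hasSum_tripleTerm353 hq0 hq).unique ((hasSum_congr' hw).1 key)
  have n1 := J_ne_zero hq one_ne_zero
  have n48 : jTheta (-1) (q ^ 48) ≠ 0 := by
    simpa using jTheta_neg_zpow_ne_zero hq0 hq (M := 48) (by norm_num) 0
  rw [appellM_eq, appellM_eq, appellM_eq, appellM_eq]
  field_simp
  field_simp at h
  linear_combination h

/-! ### The series divided by `q` -/

theorem tsum_psiTerm_eq {q : ℂ} (hq0 : q ≠ 0) : ∑' n, psiTerm q n = psi3 q / q := by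
  rw [psi3, ← tsum_div_const]
  refine tsum_congr fun n => ?_
  rw [psiTerm, show (n + 1) ^ 2 = n ^ 2 + 2 * n + 1 by ring, pow_succ q (_ + _), div_right_comm,
    mul_div_cancel_right₀ _ hq0]

theorem tsum_sigmaTerm_eq {q : ℂ} (hq0 : q ≠ 0) : ∑' n, sigmaTerm q n = sigma6 q / q := by
  rw [sigma6, ← tsum_div_const]
  refine tsum_congr fun n => ?_
  have e : (n + 2).choose 2 = (n ^ 2 + 3 * n) / 2 + 1 := by
    rw [Nat.choose_two_right, ← Nat.add_div_right _ two_pos]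
    congr 1
    rw [show n + 2 - 1 = n + 1 from rfl]
    ring
  rw [sigmaTerm, e, pow_succ q (_ / _)]
  field_simp

end MockTheta

theorem mainTheorem5 (q : ℂ) (hq0 : q ≠ 0) (hq1 : ‖q‖ < 1) :
    -- the second order mock theta function
    (Summable (A2Term q) ∧ Summable (A2OuterTerm q) ∧
      A2 q = q * (qPochInf (-q ^ 2) (q ^ 2) / qPochInf q q ^ 2) * ∑' n : ℕ, A2OuterTerm q n) ∧
    -- the third order mock theta function, divided by `q`
    (Summable (psiTerm q) ∧ Summable (psiOuterTerm q) ∧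
      Summable (heckeTerm 3 5 3 (q ^ 4) (q ^ 5) q) ∧
      Summable (heckeTerm 3 5 3 (q ^ 8) (q ^ 9) q) ∧
      Summable (appellTerm (-q ^ 22) (q ^ 48) (-1)) ∧
      Summable (appellTerm (-q ^ 14) (q ^ 48) (-1)) ∧
      Summable (appellTerm (-q ^ 10) (q ^ 48) (-1)) ∧
      Summable (appellTerm (-q ^ 2) (q ^ 48) (-1)) ∧
      Summable (appellTerm q (-q ^ 3) q) ∧
      ∑' n : ℕ, psiTerm q n = psi3 q / q ∧
      ∑' n : ℕ, psiTerm q n = 1 / qPochInf q q * ∑' n : ℕ, psiOuterTerm q n ∧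
      ∑' n : ℕ, psiTerm q n =
        1 / (2 * J 1 q) * (heckeF 3 5 3 (q ^ 4) (q ^ 5) q
          - q ^ 5 * heckeF 3 5 3 (q ^ 8) (q ^ 9) q + jTheta (q ^ 4) (q ^ 3)) ∧
      ∑' n : ℕ, psiTerm q n = 1 / J 1 q * heckeF 3 5 3 (q ^ 4) (q ^ 5) q ∧
      ∑' n : ℕ, psiTerm q n =
        - q⁻¹ * appellM (-q ^ 22) (q ^ 48) (-1) - (q ^ 2)⁻¹ * appellM (-q ^ 14) (q ^ 48) (-1)
          - (q ^ 3)⁻¹ * appellM (-q ^ 10) (q ^ 48) (-1)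
          - (q ^ 6)⁻¹ * appellM (-q ^ 2) (q ^ 48) (-1)
          + 1 / J 1 q * PhiNP 3 2 (q ^ 4) (q ^ 5) q ∧
      ∑' n : ℕ, psiTerm q n =
        - q⁻¹ * appellM q (-q ^ 3) q + J 12 q ^ 3 / (JJ 3 12 q * JJ 4 12 q)) ∧
    -- the false-theta-type identity
    (Summable (falseTerm q) ∧ Summable (falseOuterTerm q) ∧
      Summable (heckeBarTerm 1 2 1 (-q ^ 3) (-q ^ 4) (q ^ 2)) ∧
      Summable (heckeBarTerm 1 2 1 (-q ^ 6) (-q ^ 7) (q ^ 2)) ∧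
      ∑' n : ℕ, falseTerm q n = ∑' n : ℕ, falseOuterTerm q n ∧
      ∑' n : ℕ, falseTerm q n =
        1 / 2 * (heckeFbar 1 2 1 (-q ^ 3) (-q ^ 4) (q ^ 2)
          + q ^ 4 * heckeFbar 1 2 1 (-q ^ 6) (-q ^ 7) (q ^ 2) - q⁻¹)) ∧
    -- the sixth order mock theta function, divided by `q`
    (Summable (sigmaTerm q) ∧ Summable (sigmaOuterTerm q) ∧
      Summable (heckeTerm 1 2 1 (q ^ 3) (q ^ 4) (q ^ 2)) ∧
      Summable (heckeTerm 1 2 1 (q ^ 6) (q ^ 7) (q ^ 2)) ∧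
      Summable (appellTerm (q ^ 2) (q ^ 6) (-1)) ∧
      Summable (appellTerm (q ^ 2) (q ^ 6) q) ∧
      ∑' n : ℕ, sigmaTerm q n = sigma6 q / q ∧
      ∑' n : ℕ, sigmaTerm q n =
        qPochInf (-q) q / qPochInf q q * ∑' n : ℕ, sigmaOuterTerm q n ∧
      ∑' n : ℕ, sigmaTerm q n =
        J 2 q / (2 * J 1 q ^ 2) * (heckeF 1 2 1 (q ^ 3) (q ^ 4) (q ^ 2)
          - q ^ 4 * heckeF 1 2 1 (q ^ 6) (q ^ 7) (q ^ 2) + jTheta (q ^ 3) (q ^ 2)) ∧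
      ∑' n : ℕ, sigmaTerm q n = J 2 q / J 1 q ^ 2 * heckeF 1 2 1 (q ^ 3) (q ^ 4) (q ^ 2) ∧
      ∑' n : ℕ, sigmaTerm q n =
        - q⁻¹ * appellM (q ^ 2) (q ^ 6) (-1)
          + 1 / 2 * q⁻¹ * (J 2 q ^ 4 * J 6 q ^ 5 /
            (J 1 q ^ 2 * J 3 q ^ 2 * J 4 q ^ 2 * J 12 q ^ 2)) ∧
      ∑' n : ℕ, sigmaTerm q n = - q⁻¹ * appellM (q ^ 2) (q ^ 6) q) := by
  have hm1 : (-1 : ℂ) ≠ 0 := by norm_num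
  have hQ0 := pow_ne_zero 48 hq0
  have hQ := norm_q_pow_lt hq1 (k := 48) (by norm_num)
  have hR0 := pow_ne_zero 6 hq0
  have hR := norm_q_pow_lt hq1 (k := 6) (by norm_num)
  obtain ⟨a1, a2⟩ := A2_bailey hq0 hq1
  obtain ⟨b1, b2⟩ := psi_bailey hq0 hq1
  obtain ⟨c1, c2⟩ := false_bailey hq0 hq1
  obtain ⟨d1, d2⟩ := sigma_bailey hq0 hq1
  obtain ⟨f1, f2, f3, f4⟩ := heckeF_353 hq0 hq1
  obtain ⟨g1, g2, g3, g4⟩ := heckeFbar_121 hq0 hq1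
  obtain ⟨h1, h2, h3, h4⟩ := heckeF_121 hq0 hq1
  have hpsi : ∑' n, psiTerm q n = 1 / J 1 q * heckeF 3 5 3 (q ^ 4) (q ^ 5) q := by
    rw [b2.tsum_eq, f3, J, pow_one]
  have hsigma : ∑' n, sigmaTerm q n = J 2 q / J 1 q ^ 2 * heckeF 1 2 1 (q ^ 3) (q ^ 4) (q ^ 2) := by
    rw [d2.tsum_eq, h3, neg_qPochInf_div_eq hq1]
  have hneg := fun {k : ℕ} => neg_ne_zero.2 (pow_ne_zero k hq0)
  refine ⟨⟨a2.summable, a1, a2.tsum_eq⟩,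
    ⟨b2.summable, b1, f1, f2, summable_appellTerm hQ0 hQ hneg hm1,
      summable_appellTerm hQ0 hQ hneg hm1, summable_appellTerm hQ0 hQ hneg hm1,
      summable_appellTerm hQ0 hQ hneg hm1, summable_appellTerm hneg
        (by rw [norm_neg]; exact norm_q_pow_lt hq1 three_ne_zero) hq0 hq0,
      tsum_psiTerm_eq hq0, b2.tsum_eq, ?_, hpsi, hpsi.trans (heckeF_353_eq_appellM hq0 hq1),
      psi_appell hq0 hq1⟩,
    ⟨c2.summable, c1, g1, g2, c2.tsum_eq, ?_⟩,
    ⟨d2.summable, d1, h1, h2, summable_appellTerm hR0 hR (pow_ne_zero 2 hq0) hm1,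
      summable_appellTerm hR0 hR (pow_ne_zero 2 hq0) hq0, tsum_sigmaTerm_eq hq0, d2.tsum_eq, ?_,
      hsigma, ?_, hsigma.trans (heckeF_121_eq_appellM hq0 hq1)⟩⟩
  · rw [hpsi, ← f4]
    ring
  · rw [c2.tsum_eq, ← g3]
    linear_combination g4 / 2
  · rw [hsigma, ← h4]
    ring
  · rw [hsigma, heckeF_121_eq_appellM hq0 hq1, appellM_two_six_change_z hq0 hq1]
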